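/- Consider the following three-sorted first-order language. The sorts are $VF$ (the valued field), $k$ (the residue field) and $\Gamma$ (the value group, with $\infty$ adjoined as largest element, $\gamma+\infty=\infty$, $-\infty:=\infty$). The symbols are: $0,1,-,+,\cdot$ on $VF$ and on $k$; $0,-,+,<$ and a constant $1$ on $\Gamma$; and function symbols $\mathrm{val}: VF\to\Gamma$, $\mathrm{res}(\tfrac{x}{y}): VF^2\to k$ and $i:k\to VF$. Let $T_{loc}$ be the theory whose models are given by: an algebraically closed field $K$; a valuation $\mathrm{val}$ of $K$ onto an ordered abelian group $\Gamma$ (with $\mathrm{val}(0)=\infty$), with valuation ring $\mathcal O$ and maximal ideal $\mathfrak m$; a residue map $\mathrm{res}:\mathcal O\to k$ onto a field $k$, that is, a ring homomorphism with kernel $\mathfrak m$; a field embedding $i:k\to K$ that is a section of $\mathrm{res}$, so that $\mathcal O=\mathfrak m\oplus i(k)$; and a distinguished element $1>0$ of $\Gamma$. Here $\mathrm{res}(\tfrac{x}{y})$ is $0$ when $\mathrm{val}(x)<\mathrm{val}(y)$ or $x=y=0$, and otherwise it is the residue of $x/y$. Then $T_{loc}$ has quantifier elimination: every formula is equivalent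 modulo $T_{loc}$ to a quantifier-free formula in the same free variables. Moreover, in every model $M$ of $T_{loc}$ (where $\Gamma$ now denotes the value group without $\infty$): 1. $k$ and $\Gamma$ are stably embedded: every subset of $k^n$ (respectively $\Gamma^n$) that is definable in $M$ with parameters from $M$ is definable in $M$ with parameters from $k$ (respectively $\Gamma$). 2. $k$ and $\Gamma$ are strongly orthogonal: for every set $A$ of parameters from $M$, every $A$-definable subset of $k^m\times\Gamma^n$ is a finite union of rectangles $P\times Q$ with $P\subseteq k^m$ and $Q\subseteq\Gamma^n$ both $A$-definable. 3. The structure induced on $k$ is that of a pure field, and the structure induced on $\Gamma$ is that of a pure ordered group with distinguished element $1$: a subset of $k^n$ is $\emptyset$-definable in $M$ if and only if it is $\emptyset$-definable in the field $(k,0,1,+,-,\cdot)$, and a subset of $\Gamma^n$ is $\emptyset$-definable in $M$ if and only if it is $\emptyset$-definable in $(\Gamma,0,1,+,-,<)$. -/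

import Mathlib

universe u v w

/-! ### Many-sorted first-order logic -/

/-- A many-sorted first-order language with sorts `S`: a function symbol in `Fn l s` takes
arguments of the sorts listed in `l` and has a value of sort `s`; a relation symbol in `Rel l`
takes arguments of the sorts listed in `l`. Equality on each sort is part of the logic. -/
structure MSLanguage (S : Type) where
  Fn : List S → S → Type
  Rel : List S → Type

/-- A structure for a many-sorted language. -/
structure MSStructure {S : Type} (L : MSLanguage S) where
  carrier : S → Type u
  fn : ∀ {l : List S} {s : S}, L.Fn l s → (∀ j : Fin l.length, carrier (l.get j)) → carrier s
  rel : ∀ {l : List S}, L.Rel l → (∀ j : Fin l.length, carrier (l.get j)) → Prop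

/-- Terms in the variables `i : ι`, where the variable `i` has sort `σ i`. -/
inductive MSTerm {S : Type} (L : MSLanguage S) {ι : Type v} (σ : ι → S) : S → Type v
  | var (i : ι) : MSTerm L σ (σ i)
  | app {l : List S} {s : S} (f : L.Fn l s) (t : ∀ j : Fin l.length, MSTerm L σ (l.get j)) :
      MSTerm L σ s

/-- The sorts of the variables after one variable of sort `s`, named `none`, is added. -/
def extendSorts {S : Type} {ι : Type v} (σ : ι → S) (s : S) : Option ι → S
  | none => s
  | some i => σ i

/-- First-order formulas whose free variables are among the variables `i : ι` of sort `σ i`.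
The other connectives and the existential quantifier are the usual classical abbreviations. -/
inductive MSFormula {S : Type} (L : MSLanguage S) : {ι : Type v} → (ι → S) → Type (v + 1)
  | falsum {ι : Type v} {σ : ι → S} : MSFormula L σ
  | equal {ι : Type v} {σ : ι → S} {s : S} (t₁ t₂ : MSTerm L σ s) : MSFormula L σ
  | rel {ι : Type v} {σ : ι → S} {l : List S} (R : L.Rel l)
      (t : ∀ j : Fin l.length, MSTerm L σ (l.get j)) : MSFormula L σ
  | imp {ι : Type v} {σ : ι → S} (φ ψ : MSFormula L σ) : MSFormula L σ
  | all {ι : Type v} {σ : ι → S} (s : S) (φ : MSFormula L (extendSorts σ s)) : MSFormula L σ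

namespace MSFormula

/-- The formula has no quantifier. -/
def IsQuantifierFree {S : Type} {L : MSLanguage S} :
    {ι : Type v} → {σ : ι → S} → MSFormula L σ → Prop
  | _, _, falsum => True
  | _, _, equal _ _ => True
  | _, _, rel _ _ => True
  | _, _, imp φ ψ => φ.IsQuantifierFree ∧ ψ.IsQuantifierFree
  | _, _, all _ _ => False

end MSFormula

namespace MSStructure

variable {S : Type} {L : MSLanguage S}

/-- The value of a term under an assignment of its variables. -/
def value (M : MSStructure.{u} L) {ι : Type v} {σ : ι → S} (e : ∀ i, M.carrier (σ i)) :
    {s : S} → MSTerm L σ s → M.carrier s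
  | _, .var i => e i
  | _, .app f t => M.fn f fun j => M.value e (t j)

/-- Extend an assignment by a value of the new variable `none`. -/
def extendAssignment (M : MSStructure.{u} L) {ι : Type v} {σ : ι → S} {s : S}
    (e : ∀ i, M.carrier (σ i)) (a : M.carrier s) : ∀ o, M.carrier (extendSorts σ s o)
  | none => a
  | some i => e i

/-- Tarski's definition of truth of a formula under an assignment of its free variables. -/
def Sat (M : MSStructure.{u} L) :
    {ι : Type v} → {σ : ι → S} → MSFormula L σ → (∀ i, M.carrier (σ i)) → Prop
  | _, _, .falsum, _ => False
  | _, _, .equal t₁ t₂, e => M.value e t₁ = M.value e t₂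
  | _, _, .rel R t, e => M.rel R fun j => M.value e (t j)
  | _, _, .imp φ ψ, e => M.Sat φ e → M.Sat ψ e
  | _, _, .all s φ, e => ∀ a : M.carrier s, M.Sat φ (M.extendAssignment e a)

/-- The elements of a structure, of all sorts. -/
abbrev Elements (M : MSStructure.{u} L) : Type u := Σ s, M.carrier s

/-- `X ⊆ ∏ i, M (σ i)` is definable in `M` by a formula with parameters from `A`. The formula has
the variables `Sum.inl i`, and one variable `Sum.inr a` for each parameter `a ∈ A`. -/
def Definable (M : MSStructure.{u} L) (A : Set M.Elements) {ι : Type v} {σ : ι → S}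
    (X : Set (∀ i, M.carrier (σ i))) : Prop :=
  ∃ φ : MSFormula L (Sum.elim σ fun a : A => a.1.1),
    ∀ x, x ∈ X ↔ M.Sat φ
      (Sum.rec (motive := fun i => M.carrier (Sum.elim σ (fun a : A => a.1.1) i))
        x (fun a => a.1.2))

/-- `X ⊆ M(s)^n` is definable in `M` by a formula with parameters from `A`. -/
def DefinablePower (M : MSStructure.{u} L) (A : Set M.Elements) (s : S) {n : ℕ}
    (X : Set (Fin n → M.carrier s)) : Prop :=
  M.Definable A (σ := fun _ : Fin n => s) X

/-- `X ⊆ M(s)^m × M(t)^n` is definable in `M` by a formula with parameters from `A`. -/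
def DefinableProd (M : MSStructure.{u} L) (A : Set M.Elements) (s t : S) {m n : ℕ}
    (X : Set ((Fin m → M.carrier s) × (Fin n → M.carrier t))) : Prop :=
  M.Definable A (σ := Sum.elim (fun _ : Fin m => s) (fun _ : Fin n => t))
    {z | ((fun i => z (Sum.inl i)), (fun j => z (Sum.inr j))) ∈ X}

/-- A subset `D` of the sort `s` is stably embedded in `M`: every subset of a power `D^n` that is
definable in `M`, with any parameters from `M`, is definable in `M` with parameters from `D`. -/
def StablyEmbedded (M : MSStructure.{u} L) (s : S) (D : Set (M.carrier s)) : Prop :=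
  ∀ (n : ℕ) (X : Set (Fin n → M.carrier s)), (∀ x ∈ X, ∀ j, x j ∈ D) →
    M.DefinablePower Set.univ s X → M.DefinablePower (Sigma.mk s '' D) s X

/-- Strong orthogonality of `D ⊆ M(s)` and `E ⊆ M(t)`: for every set `A` of parameters from `M`,
every `A`-definable subset of `D^m × E^n` is a finite union of rectangles `P × Q` with `P` and `Q`
definable over the same `A`. -/
def StronglyOrthogonal (M : MSStructure.{u} L) (s t : S) (D : Set (M.carrier s))
    (E : Set (M.carrier t)) : Prop :=
  ∀ (A : Set M.Elements) (m n : ℕ) (X : Set ((Fin m → M.carrier s) × (Fin n → M.carrier t))),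
    (∀ x ∈ X, (∀ i, x.1 i ∈ D) ∧ (∀ j, x.2 j ∈ E)) → M.DefinableProd A s t X →
    ∃ (N : ℕ) (P : Fin N → Set (Fin m → M.carrier s)) (Q : Fin N → Set (Fin n → M.carrier t)),
      (∀ r, M.DefinablePower A s (P r)) ∧ (∀ r, M.DefinablePower A t (Q r)) ∧
        X = ⋃ r, P r ×ˢ Q r

end MSStructure

/-! ### The three-sorted language of valued fields with a section of the residue map -/

namespace TLoc

/-- The sorts: the valued field, the residue field, and the value group with `∞` adjoined. -/
inductive Srt : Type
  | VF
  | k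
  | Γ

/-- The function symbols. -/
inductive Fn : List Srt → Srt → Type
  | vfZero : Fn [] .VF
  | vfOne : Fn [] .VF
  | vfNeg : Fn [.VF] .VF
  | vfAdd : Fn [.VF, .VF] .VF
  | vfMul : Fn [.VF, .VF] .VF
  | kZero : Fn [] .k
  | kOne : Fn [] .k
  | kNeg : Fn [.k] .k
  | kAdd : Fn [.k, .k] .k
  | kMul : Fn [.k, .k] .k
  | gZero : Fn [] .Γ
  | gOne : Fn [] .Γ
  | gNeg : Fn [.Γ] .Γ
  | gAdd : Fn [.Γ, .Γ] .Γ
  | val : Fn [.VF] .Γ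
  | resDiv : Fn [.VF, .VF] .k
  | sec : Fn [.k] .VF

/-- The relation symbols: only the ordering of the value group. -/
inductive Rel : List Srt → Type
  | lt : Rel [.Γ, .Γ]

/-- The language of `T_loc`. -/
def lang : MSLanguage Srt where
  Fn := Fn
  Rel := Rel

/-- The valuation ring `𝒪 = {x | 0 ≤ val x}`. -/
def valuationRing {K Γ : Type*} [Field K] [AddCommGroup Γ] [LinearOrder Γ] [IsOrderedAddMonoid Γ]
    (val : AddValuation K (WithTop Γ)) : Subring K where
  carrier := {x | 0 ≤ val x}
  mul_mem' := by
    intro a b ha hb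
    simp only [Set.mem_ofPred_eq, val.map_mul] at *
    exact add_nonneg ha hb
  one_mem' := by simp
  add_mem' := by
    intro a b ha hb
    exact val.map_le_add ha hb
  zero_mem' := by simp
  neg_mem' := by
    intro a ha
    simpa only [Set.mem_ofPred_eq, val.map_neg] using ha

/-- The models of `T_loc`: an algebraically closed field `K` with a valuation `val` onto an ordered
abelian group `Γ` (with `val 0 = ∞`), its residue map `res : 𝒪 → k` (a ring homomorphism whose
kernel is `𝔪 = {x | 0 < val x}`), a field embedding `sec : k → K` that is a section of `res`
(so that `res` is onto and `𝒪 = 𝔪 ⊕ sec(k)`), and a distinguished element `one > 0` of `Γ`. -/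
structure Model where
  K : Type u
  k : Type u
  Γ : Type u
  [fieldK : Field K]
  [algClosed : IsAlgClosed K]
  [fieldk : Field k]
  [groupΓ : AddCommGroup Γ]
  [orderΓ : LinearOrder Γ]
  [orderedΓ : IsOrderedAddMonoid Γ]
  val : AddValuation K (WithTop Γ)
  val_surjective : Function.Surjective val
  res : valuationRing val →+* k
  res_eq_zero_iff : ∀ x : valuationRing val, res x = 0 ↔ 0 < val (x : K)
  sec : k →+* K
  sec_mem : ∀ c, sec c ∈ valuationRing val
  res_sec : ∀ c, res ⟨sec c, sec_mem c⟩ = c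
  one : Γ
  one_pos : 0 < one

namespace Model

attribute [instance] fieldK algClosed fieldk groupΓ orderΓ orderedΓ

open Classical in
/-- The function `res(x/y)`: it is `0` when `val x < val y`, and otherwise the residue of `x/y`
(for `x = y = 0` this is `0`, as `x/y = 0`). -/
noncomputable def resDiv (M : Model.{u}) (x y : M.K) : M.k :=
  if h : M.val x < M.val y then 0
  else M.res ⟨x / y, by
    change 0 ≤ M.val (x / y)
    by_cases hy : y = 0
    · simp [hy]
    · have hle : M.val y ≤ M.val x := not_lt.mp h
      have hmul : M.val (x / y) + M.val y = M.val x := by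
        rw [← M.val.map_mul, div_mul_cancel₀ x hy]
      by_contra hneg
      have hfin : M.val y ≠ ⊤ := (M.val.ne_top_iff).2 hy
      have hlt : M.val (x / y) + M.val y < 0 + M.val y :=
        WithTop.add_lt_add_right hfin (not_le.mp hneg)
      rw [hmul, zero_add] at hlt
      exact h hlt⟩

/-- The underlying sets of the three sorts. -/
def carrier (M : Model.{u}) : Srt → Type u
  | .VF => M.K
  | .k => M.k
  | .Γ => WithTop M.Γ

/-- The interpretation of the function symbols. In the sort `Γ`, `γ + ∞ = ∞` and `-∞ = ∞`. -/
noncomputable def fn (M : Model.{u}) {l : List Srt} {s : Srt} (f : Fn l s) :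
    (∀ j : Fin l.length, M.carrier (l.get j)) → M.carrier s :=
  match f with
  | .vfZero => fun _ => (0 : M.K)
  | .vfOne => fun _ => (1 : M.K)
  | .vfNeg => fun a => (-(show M.K from a 0) : M.K)
  | .vfAdd => fun a => ((show M.K from a 0) + (show M.K from a 1) : M.K)
  | .vfMul => fun a => ((show M.K from a 0) * (show M.K from a 1) : M.K)
  | .kZero => fun _ => (0 : M.k)
  | .kOne => fun _ => (1 : M.k)
  | .kNeg => fun a => (-(show M.k from a 0) : M.k)
  | .kAdd => fun a => ((show M.k from a 0) + (show M.k from a 1) : M.k)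
  | .kMul => fun a => ((show M.k from a 0) * (show M.k from a 1) : M.k)
  | .gZero => fun _ => (0 : WithTop M.Γ)
  | .gOne => fun _ => (M.one : WithTop M.Γ)
  | .gNeg => fun a => (-(show WithTop M.Γ from a 0) : WithTop M.Γ)
  | .gAdd => fun a => ((show WithTop M.Γ from a 0) + (show WithTop M.Γ from a 1) : WithTop M.Γ)
  | .val => fun a => M.val (show M.K from a 0)
  | .resDiv => fun a => M.resDiv (show M.K from a 0) (show M.K from a 1)
  | .sec => fun a => M.sec (show M.k from a 0)

/-- The interpretation of the ordering, with `∞` as largest element. -/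
def rel (M : Model.{u}) {l : List Srt} (R : Rel l) :
    (∀ j : Fin l.length, M.carrier (l.get j)) → Prop :=
  match R with
  | .lt => fun a => (show WithTop M.Γ from a 0) < (show WithTop M.Γ from a 1)

/-- A model of `T_loc` as a three-sorted structure. -/
noncomputable def toStructure (M : Model.{u}) : MSStructure.{u} lang where
  carrier := M.carrier
  fn := M.fn
  rel := M.rel

/-- The residue field, as a subset of its sort (all of it). -/
def resField (M : Model.{u}) : Set (M.toStructure.carrier .k) := Set.univ

/-- The value group, as a subset of its sort (everything except `∞`). -/
def valueGroup (M : Model.{u}) : Set (M.toStructure.carrier .Γ) :=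
  Set.range fun γ : M.Γ => (γ : WithTop M.Γ)

end Model

/-- `T_loc` has quantifier elimination: every formula in finitely many free variables is
equivalent, in all models of `T_loc`, to a quantifier-free formula in the same free variables. -/
def HasQuantifierElimination : Prop :=
  ∀ (ι : Type) [Finite ι] (σ : ι → Srt) (φ : MSFormula lang σ),
    ∃ ψ : MSFormula lang σ, ψ.IsQuantifierFree ∧
      ∀ (M : Model.{u}) (e : ∀ i, M.toStructure.carrier (σ i)),
        M.toStructure.Sat φ e ↔ M.toStructure.Sat ψ e

/-! ### The pure field and the pure ordered group -/

/-- `X` is definable without parameters in the pure field `F` (in the language of rings). -/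
def FieldDefinable (F : Type w) [Field F] {n : ℕ} (X : Set (Fin n → F)) : Prop :=
  letI := FirstOrder.Ring.compatibleRingOfRing F
  (∅ : Set F).Definable FirstOrder.Language.ring X

/-- The function symbols of ordered groups with a distinguished element. -/
inductive OGFn : ℕ → Type
  | zero : OGFn 0
  | one : OGFn 0
  | neg : OGFn 1
  | add : OGFn 2

/-- The relation symbol of ordered groups. -/
inductive OGRel : ℕ → Type
  | lt : OGRel 2

/-- The language of ordered groups with a distinguished element. -/
def ogLang : FirstOrder.Language where
  Functions := OGFn
  Relations := OGRel

/-- An ordered abelian group with a distinguished element `c`, as a first-order structure. -/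
@[reducible] def ogStructure (G : Type w) [AddCommGroup G] [LinearOrder G] (c : G) : ogLang.Structure G where
  funMap {n} f := match n, f with
    | _, OGFn.zero => fun _ => 0
    | _, OGFn.one => fun _ => c
    | _, OGFn.neg => fun a => -a 0
    | _, OGFn.add => fun a => a 0 + a 1
  RelMap {n} R := match n, R with
    | _, OGRel.lt => fun a => a 0 < a 1

/-- `X` is definable without parameters in the ordered group `G` with distinguished element `c`. -/
def OrderedGroupDefinable (G : Type w) [AddCommGroup G] [LinearOrder G] (c : G) {n : ℕ}
    (X : Set (Fin n → G)) : Prop :=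
  letI := ogStructure G c
  (∅ : Set G).Definable ogLang X

namespace Model

/-- The structure induced on the residue field is that of a pure field: a subset of `k^n` is
definable without parameters in the model iff it is so in the field `k`. -/
def ResFieldInducedPure (M : Model.{u}) : Prop :=
  ∀ (n : ℕ) (X : Set (Fin n → M.k)),
    M.toStructure.DefinablePower ∅ .k X ↔ FieldDefinable M.k X

/-- The structure induced on the value group is that of an ordered group with the distinguished
element `one`: a subset of `Γ^n` is definable without parameters in the model iff it is so in
the ordered group `Γ` with distinguished element `one`. -/
def ValueGroupInducedPure (M : Model.{u}) : Prop :=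
  ∀ (n : ℕ) (X : Set (Fin n → M.Γ)),
    M.toStructure.DefinablePower ∅ .Γ
        ((fun (x : Fin n → M.Γ) (j : Fin n) => ((x j : M.Γ) : WithTop M.Γ)) '' X) ↔
      OrderedGroupDefinable M.Γ M.one X

end Model

end TLoc

set_option linter.unusedSectionVars false

section

/-! Quantifier elimination comes from a back-and-forth argument between ℵ₁-saturated models. If a
formula had no quantifier-free equivalent, ultraproducts of counterexamples would give two saturated
models and two tuples with the same quantifier-free type on which the formula differs
(`exists_isQuantifierFree_of_saturated`, `ultra_saturated`, `sat_ultra`). It therefore suffices to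
extend such tuples by one element at a time (`exists_extendAssignment`).

Two such tuples generate a partial isomorphism `PIso`, kept as a graph in each sort. The data lie in
a countable algebraically closed subfield `E` that is closed under residues
(`exists_isClosedSubfield`). Zorn's lemma yields a maximal extension with domain in `E`, and
maximality forces it to be defined on all of `E`, sort by sort.

Values: the value group is divisible and dense, so every cut over a countable group is realised in
the target (`exists_matching_value`). The group `G` only has to contain the values of the ring `R`,
so it can be enlarged by itself.

Residues: the residue field is algebraically closed, so a partner of a new residue exists
(`exists_matching_residue`). That the valuation does not obstruct the extension is due to the
section. It makes `R` a vector space over its residues, and every finite subset lies in the span of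
vectors with strictly increasing values (`exists_separated_list`). Values and residues of a
combination with coefficients in a larger field are then read off from its first nonzero
coefficient.

Field elements: when all residues and values of `E` have partners, take an `x` in `E` outside the
domain that is a root of a polynomial `m` of least degree, with `m = 0` if no polynomial is
available. A Newton polygon criterion (`HasDominantTerm`) shows that a root of the transported `m`
at a prescribed distance exists, and saturation gives a root `y` with the right distance to every
element of the domain at once. Polynomials of smaller degree than `m` split over the domain. So
every element of the ring generated by `(x, y)` has a leading term built from the domain and at most
one new element `u` whose value is independent (`hasLead_evalPair`), and the partial isomorphism
extends.

Induced structure: by quantifier elimination it is enough to find a class of functions closed under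
the symbols of the language together with a Boolean algebra containing the atomic sets
(`FunctionFamily`). On powers of the value group, field elements and residues are constant. On
powers of the residue field, field-valued terms are combinations of constants with residue functions
as coefficients; separation shows that their values range over a finite set and that residues of
their quotients stay in the given ring (`simple_val_of_mem_span`). No symbol leads out of the value
group. Hence a definable subset of a product depends on the residues only through a finite definable
partition, which is strong orthogonality; that the pieces need no new parameters is `simple_val`. -/

lemma nsmul_lt_nsmul_left_of_neg' {G : Type*} [AddCommGroup G] [LinearOrder G]
    [IsOrderedAddMonoid G] {g : G} (hg : g < 0) {m n : ℕ} (h : m < n) : n • g < m • g := by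
  have := nsmul_lt_nsmul_left (neg_pos.2 hg) h
  simpa using this

/-! ### Residues of quotients, and algebra of the residue field and value group -/

namespace TLoc.Model

variable (M : Model.{u})

lemma val_eq_top_iff {x : M.K} : M.val x = ⊤ ↔ x = 0 := M.val.top_iff

lemma exists_val_eq {x : M.K} (hx : x ≠ 0) : ∃ γ : M.Γ, M.val x = γ := by
  obtain ⟨γ, hγ⟩ := WithTop.ne_top_iff_exists.1 ((M.val.ne_top_iff).2 hx)
  exact ⟨γ, hγ.symm⟩

lemma val_sec {c : M.k} (hc : c ≠ 0) : M.val (M.sec c) = 0 := by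
  have h1 : 0 ≤ M.val (M.sec c) := M.sec_mem c
  have h2 : 0 ≤ M.val (M.sec c⁻¹) := M.sec_mem c⁻¹
  have h3 : M.val (M.sec c) + M.val (M.sec c⁻¹) = 0 := by
    rw [← M.val.map_mul, ← map_mul, mul_inv_cancel₀ hc, map_one, M.val.map_one]
  refine le_antisymm ?_ h1
  calc M.val (M.sec c) = M.val (M.sec c) + 0 := (add_zero _).symm
    _ ≤ M.val (M.sec c) + M.val (M.sec c⁻¹) := by gcongr
    _ = 0 := h3

lemma val_le_val_sec_mul (c : M.k) (x : M.K) : M.val x ≤ M.val (M.sec c * x) := by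
  rw [M.val.map_mul]
  exact le_add_of_nonneg_left (M.sec_mem c)

lemma resDiv_of_lt {x y : M.K} (h : M.val x < M.val y) : M.resDiv x y = 0 := by
  simp [resDiv, h]

lemma val_lt_mul_iff_pos {x y : M.K} (hy : y ≠ 0) : M.val y < M.val (x * y) ↔ 0 < M.val x := by
  rw [M.val.map_mul]
  obtain ⟨γ, hγ⟩ := M.exists_val_eq hy
  rw [hγ]
  by_cases hx : x = 0
  · simp [hx]
  · obtain ⟨δ, hδ⟩ := M.exists_val_eq hx
    rw [hδ]
    norm_cast
    simp

lemma val_mul_lt_iff_neg {x y : M.K} (hy : y ≠ 0) : M.val (x * y) < M.val y ↔ M.val x < 0 := by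
  rw [M.val.map_mul]
  obtain ⟨γ, hγ⟩ := M.exists_val_eq hy
  rw [hγ]
  by_cases hx : x = 0
  · simp [hx]
  · obtain ⟨δ, hδ⟩ := M.exists_val_eq hx
    rw [hδ]
    norm_cast
    simp

/-- Through the section, `x / y - sec c` is an element of the valuation ring, and its residue
vanishes exactly when its value is positive. Later computations with residues are thereby reduced to
inequalities between values. -/
lemma resDiv_eq_iff {x y : M.K} (hy : y ≠ 0) (h : M.val y ≤ M.val x) (c : M.k) :
    M.resDiv x y = c ↔ M.val y < M.val (x - M.sec c * y) := by
  have e1 : x - M.sec c * y = (x / y - M.sec c) * y := by field_simp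
  rw [e1, M.val_lt_mul_iff_pos hy]
  have hp : x / y ∈ valuationRing M.val := by
    change 0 ≤ M.val (x / y)
    by_contra hneg
    rw [not_le, ← M.val_mul_lt_iff_neg hy, div_mul_cancel₀ x hy] at hneg
    exact absurd hneg h.not_gt
  have key : M.resDiv x y = M.res ⟨x / y, hp⟩ := by
    simp only [resDiv, not_lt.2 h, dif_neg, not_false_eq_true]
  rw [key]
  have := M.res_eq_zero_iff (⟨x / y, hp⟩ - ⟨M.sec c, M.sec_mem c⟩)
  rw [map_sub, M.res_sec, sub_eq_zero] at this
  exact this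

lemma resDiv_zero_right (x : M.K) : M.resDiv x 0 = 0 := by
  by_cases h : M.val x < M.val 0
  · exact M.resDiv_of_lt h
  · simp only [resDiv, h, dif_neg, not_false_eq_true]
    rw [M.res_eq_zero_iff]
    simp

/-- No side condition is needed: the strict inequality already forces `y ≠ 0` and `val y ≤ val x`.
-/
lemma resDiv_eq_of_lt {x y : M.K} {c : M.k} (h : M.val y < M.val (x - M.sec c * y)) :
    M.resDiv x y = c := by
  have hy : y ≠ 0 := by
    rintro rfl
    simp at h
  refine (M.resDiv_eq_iff hy ?_ c).2 h
  have : x = (x - M.sec c * y) + M.sec c * y := by ring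
  rw [this]
  exact M.val.map_le_add h.le (M.val_le_val_sec_mul c y)

lemma val_lt_sub_resDiv {x y : M.K} (hy : y ≠ 0) (h : M.val y ≤ M.val x) :
    M.val y < M.val (x - M.sec (M.resDiv x y) * y) :=
  (M.resDiv_eq_iff hy h _).1 rfl

lemma resDiv_eq_zero_of_ne {x y : M.K} (h : M.val x ≠ M.val y) : M.resDiv x y = 0 := by
  rcases lt_or_gt_of_ne h with h | h
  · exact M.resDiv_of_lt h
  · exact M.resDiv_eq_of_lt (by simpa using h)

lemma resDiv_zero_left (y : M.K) : M.resDiv 0 y = 0 := by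
  by_cases hy : y = 0
  · rw [hy, resDiv_zero_right]
  · apply resDiv_eq_zero_of_ne
    rw [M.val.map_zero]
    exact fun h => hy (M.val_eq_top_iff.1 h.symm)

lemma resDiv_self {x : M.K} (hx : x ≠ 0) : M.resDiv x x = 1 := by
  refine M.resDiv_eq_of_lt ?_
  have := (M.val.ne_top_iff).2 hx
  simpa using lt_top_iff_ne_top.2 this

lemma val_eq_of_lt_sub {z w : M.K} (h : M.val w < M.val (z - w)) : M.val z = M.val w :=
  M.val.map_eq_of_lt_sub h

/-- Residues of quotients depend only on leading terms: `z - sec c * z'` and `w - sec c * w'` differ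
by terms of value greater than `val w'`. -/
lemma resDiv_congr {z w z' w' : M.K} (h : M.val w < M.val (z - w))
    (h' : M.val w' < M.val (z' - w')) : M.resDiv z z' = M.resDiv w w' := by
  have e := M.val_eq_of_lt_sub h
  have e' := M.val_eq_of_lt_sub h'
  rcases lt_or_ge (M.val w) (M.val w') with hlt | hle
  · rw [M.resDiv_of_lt hlt, M.resDiv_of_lt (by rwa [e, e'])]
  · have hw' : w' ≠ 0 := by
      rintro rfl
      simp at h'
    apply M.resDiv_eq_of_lt
    rw [e']
    set c := M.resDiv w w'
    have : z - M.sec c * z' = (w - M.sec c * w') + ((z - w) - M.sec c * (z' - w')) := by ring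
    rw [this]
    refine M.val.map_lt_add (M.val_lt_sub_resDiv hw' hle) ?_
    rw [sub_eq_add_neg]
    refine M.val.map_lt_add (hle.trans_lt h) ?_
    rw [M.val.map_neg]
    exact h'.trans_le (M.val_le_val_sec_mul _ _)

lemma val_mul_lt_mul {x y u : M.K} (hu : u ≠ 0) :
    M.val (x * u) < M.val (y * u) ↔ M.val x < M.val y := by
  rw [M.val.map_mul, M.val.map_mul]
  obtain ⟨γ, hγ⟩ := M.exists_val_eq hu
  rw [hγ]
  exact WithTop.add_lt_add_iff_right WithTop.coe_ne_top

lemma resDiv_mul_right {x y u : M.K} (hu : u ≠ 0) :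
    M.resDiv (x * u) (y * u) = M.resDiv x y := by
  by_cases hy : y = 0
  · simp [hy, resDiv_zero_right]
  rcases lt_or_ge (M.val x) (M.val y) with hlt | hle
  · rw [M.resDiv_of_lt hlt, M.resDiv_of_lt ((M.val_mul_lt_mul hu).2 hlt)]
  · apply M.resDiv_eq_of_lt
    have : x * u - M.sec (M.resDiv x y) * (y * u) = (x - M.sec (M.resDiv x y) * y) * u := by ring
    rw [this, M.val_mul_lt_mul hu]
    exact M.val_lt_sub_resDiv hy hle

lemma resDiv_div_div {a b a' b' : M.K} (hb : b ≠ 0) (hb' : b' ≠ 0) :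
    M.resDiv (a / b) (a' / b') = M.resDiv (a * b') (a' * b) := by
  rw [← M.resDiv_mul_right (mul_ne_zero hb hb')]
  congr 1 <;> field_simp

lemma val_sec_mul_add {s z : M.K} (hz : M.val s < M.val z) {e : M.k} (he : e ≠ 0) :
    M.val (M.sec e * s + z) = M.val s := by
  have h1 : M.val (M.sec e * s) = M.val s := by rw [M.val.map_mul, M.val_sec he, zero_add]
  rw [M.val.map_add_eq_of_lt_left (by rwa [h1]), h1]

/-- Both elements are constants times `s` up to terms of higher value. When `f = 0` the quotient is
not integral, and the convention that its residue is then `0` agrees with `0⁻¹ = 0`. -/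
lemma resDiv_sec_mul_add {s z w : M.K} (hz : M.val s < M.val z) (hw : M.val s < M.val w)
    {e f : M.k} (h : e ≠ 0 ∨ f ≠ 0) :
    M.resDiv (M.sec e * s + z) (M.sec f * s + w) = e * f⁻¹ := by
  by_cases hf : f = 0
  · have he : e ≠ 0 := by simpa [hf] using h
    rw [M.resDiv_of_lt, hf, inv_zero, mul_zero]
    rw [M.val_sec_mul_add hz he, hf]
    simpa using hw
  · apply M.resDiv_eq_of_lt
    rw [M.val_sec_mul_add hw hf]
    have : M.sec e * s + z - M.sec (e * f⁻¹) * (M.sec f * s + w) = z - M.sec (e * f⁻¹) * w := by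
      rw [mul_add, ← mul_assoc, ← map_mul, inv_mul_cancel_right₀ hf]
      ring
    rw [this, sub_eq_add_neg]
    refine M.val.map_lt_add hz ?_
    rw [M.val.map_neg]
    exact hw.trans_le (M.val_le_val_sec_mul _ _)

lemma resDiv_sec (a b : M.k) : M.resDiv (M.sec a) (M.sec b) = a * b⁻¹ := by
  by_cases h : a ≠ 0 ∨ b ≠ 0
  · have h1 : M.val (1 : M.K) < M.val (0 : M.K) := by simp
    simpa using M.resDiv_sec_mul_add h1 h1 h
  · push Not at h
    simp [h.1, h.2, resDiv_zero_right]

/-- The section carries a monic irreducible polynomial to `K`, where it has a root. The root is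
integral, and its residue is a root of the original polynomial. -/
lemma isAlgClosed_k : IsAlgClosed M.k := by
  apply IsAlgClosed.of_exists_root
  intro p hp hirr
  have hdeg : (p.map M.sec).degree ≠ 0 := by
    rw [Polynomial.degree_map]
    exact (Polynomial.degree_pos_of_irreducible hirr).ne'
  obtain ⟨z, hz⟩ := IsAlgClosed.exists_root (p.map M.sec) hdeg
  have hz0 : z ∈ valuationRing M.val := by
    change 0 ≤ M.val z
    by_contra hneg
    rw [not_le] at hneg
    have hzne : z ≠ 0 := by rintro rfl; simp at hneg
    obtain ⟨γ, hγ⟩ := M.exists_val_eq hzne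
    have hγ0 : γ < 0 := by rw [hγ] at hneg; exact_mod_cast hneg
    rw [Polynomial.IsRoot, Polynomial.eval_map, Polynomial.eval₂_eq_sum_range,
      Finset.sum_range_succ, hp.coeff_natDegree, map_one, one_mul] at hz
    -- For a root of negative value the leading power would have strictly smaller value than the
    -- remaining terms, since sections have nonnegative value; the sum could not vanish.
    have h1 : M.val (z ^ p.natDegree) <
        M.val (∑ i ∈ Finset.range p.natDegree, M.sec (p.coeff i) * z ^ i) := by
      apply M.val.map_lt_sum
      · simp [hγ, M.val.map_pow, ← WithTop.coe_nsmul]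
      · intro i hi
        refine lt_of_lt_of_le ?_ (M.val_le_val_sec_mul _ _)
        rw [M.val.map_pow, M.val.map_pow, hγ, ← WithTop.coe_nsmul, ← WithTop.coe_nsmul,
          WithTop.coe_lt_coe]
        exact nsmul_lt_nsmul_left_of_neg' hγ0 (Finset.mem_range.1 hi)
    have h2 := M.val.map_add_eq_of_lt_right h1
    rw [hz, M.val.map_zero, eq_comm, M.val_eq_top_iff] at h2
    exact hzne (pow_eq_zero_iff hirr.natDegree_pos.ne' |>.1 h2)
  refine ⟨M.res ⟨z, hz0⟩, ?_⟩
  let sec' : M.k →+* valuationRing M.val := M.sec.codRestrict _ M.sec_mem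
  have hs : (valuationRing M.val).subtype.comp sec' = M.sec := rfl
  have h3 : Polynomial.eval₂ sec' ⟨z, hz0⟩ p = 0 := by
    apply Subtype.ext
    have := Polynomial.hom_eval₂ p sec' (valuationRing M.val).subtype ⟨z, hz0⟩
    rw [hs] at this
    simp only [Subring.subtype_apply] at this
    rw [this, ← Polynomial.eval_map]
    exact hz
  have h4 := Polynomial.hom_eval₂ p sec' M.res ⟨z, hz0⟩
  have hr : M.res.comp sec' = RingHom.id _ := RingHom.ext M.res_sec
  rw [h3, map_zero, hr] at h4
  exact h4.symm

lemma exists_nsmul_eq (γ : M.Γ) {n : ℕ} (hn : n ≠ 0) : ∃ δ : M.Γ, n • δ = γ := by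
  obtain ⟨x, hx⟩ := M.val_surjective γ
  obtain ⟨z, hz⟩ := IsAlgClosed.exists_pow_nat_eq x (Nat.pos_of_ne_zero hn)
  have hzne : z ≠ 0 := by
    rintro rfl
    rw [zero_pow hn] at hz
    rw [← hz, M.val.map_zero] at hx
    exact WithTop.top_ne_coe hx
  obtain ⟨δ, hδ⟩ := M.exists_val_eq hzne
  refine ⟨δ, ?_⟩
  rw [← hz, M.val.map_pow, hδ, ← WithTop.coe_nsmul, WithTop.coe_inj] at hx
  exact hx

instance : Nontrivial M.Γ := ⟨⟨0, M.one, M.one_pos.ne⟩⟩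

lemma denselyOrdered : DenselyOrdered M.Γ := by
  refine ⟨fun a b hab => ?_⟩
  obtain ⟨c, hc⟩ := M.exists_nsmul_eq (a + b) two_ne_zero
  rw [two_nsmul] at hc
  refine ⟨c, ?_, ?_⟩
  · by_contra h
    rw [not_lt] at h
    exact absurd hc (by
      have : c + c ≤ a + a := add_le_add h h
      exact (this.trans_lt (by gcongr)).ne)
  · by_contra h
    rw [not_lt] at h
    exact absurd hc (by
      have : b + b ≤ c + c := add_le_add h h
      exact ((add_lt_add_left hab b).trans_le this).ne')

end TLoc.Model

end

/-! ### Renaming of variables and closure properties of definable sets -/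

section

section Renaming

variable {S : Type} {L : MSLanguage S}

/-- Rename the variables of a term along a sort-preserving map. -/
def MSTerm.rename {ι : Type v} {κ : Type w} {τ : ι → S} {σ : κ → S} (f : ι → κ)
    (h : ∀ i, τ i = σ (f i)) : ∀ {s : S}, MSTerm L τ s → MSTerm L σ s
  | _, .var i => (h i).symm ▸ .var (f i)
  | _, .app g t => .app g fun j => (t j).rename f h

lemma extendSorts_map {ι : Type v} {κ : Type w} {τ : ι → S} {σ : κ → S} (f : ι → κ)
    (h : ∀ i, τ i = σ (f i)) (s : S) :
    ∀ o, extendSorts τ s o = extendSorts σ s (o.map f)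
  | none => rfl
  | some i => h i

/-- Rename the free variables of a formula along a sort-preserving map. -/
def MSFormula.rename : {ι : Type v} → {κ : Type w} → {τ : ι → S} → {σ : κ → S} → (f : ι → κ) →
    (∀ i, τ i = σ (f i)) → MSFormula L τ → MSFormula L σ
  | _, _, _, _, _, _, .falsum => .falsum
  | _, _, _, _, f, h, .equal t₁ t₂ => .equal (t₁.rename f h) (t₂.rename f h)
  | _, _, _, _, f, h, .rel R t => .rel R fun j => (t j).rename f h
  | _, _, _, _, f, h, .imp φ ψ => .imp (φ.rename f h) (ψ.rename f h)
  | _, _, _, _, f, h, .all s φ => .all s (φ.rename (Option.map f) (extendSorts_map f h s))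

namespace MSStructure

lemma value_rename (M : MSStructure.{u} L) {ι : Type v} {κ : Type w} {τ : ι → S} {σ : κ → S}
    (f : ι → κ) (h : ∀ i, τ i = σ (f i)) (e : ∀ k, M.carrier (σ k)) (e' : ∀ i, M.carrier (τ i))
    (he : ∀ i, e' i ≍ e (f i)) {s : S} (t : MSTerm L τ s) :
    M.value e (t.rename f h) = M.value e' t := by
  induction t with
  | var i =>
    have key : ∀ {s : S} (hs : σ (f i) = s) (x : M.carrier s), x ≍ e (f i) →
        M.value e (hs ▸ (MSTerm.var (f i) : MSTerm L σ _)) = x := by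
      rintro s rfl x hx
      exact (eq_of_heq hx).symm
    exact key (h i).symm (e' i) (he i)
  | app g t ih =>
    simp only [MSTerm.rename, value]
    exact congrArg _ (funext ih)

lemma sat_rename (M : MSStructure.{u} L) {ι : Type v} {τ : ι → S} (φ : MSFormula L τ) :
    ∀ {κ : Type w} {σ : κ → S} (f : ι → κ) (h : ∀ i, τ i = σ (f i))
      (e : ∀ k, M.carrier (σ k)) (e' : ∀ i, M.carrier (τ i)) (_ : ∀ i, e' i ≍ e (f i)),
      M.Sat (φ.rename f h) e ↔ M.Sat φ e' := by
  induction φ with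
  | falsum => intros; rfl
  | equal t₁ t₂ =>
    intro κ σ f h e e' he
    simp only [MSFormula.rename, Sat, M.value_rename f h e e' he]
  | rel R t =>
    intro κ σ f h e e' he
    simp only [MSFormula.rename, Sat, M.value_rename f h e e' he]
  | imp φ ψ ih₁ ih₂ =>
    intro κ σ f h e e' he
    simp only [MSFormula.rename, Sat, ih₁ f h e e' he, ih₂ f h e e' he]
  | all s φ ih =>
    intro κ σ f h e e' he
    simp only [MSFormula.rename, Sat]
    refine forall_congr' fun a => ih _ _ _ _ ?_
    rintro (_ | i)
    · exact HEq.rfl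
    · exact he i

end MSStructure

lemma MSTerm.exists_finite_support {ι : Type v} {σ : ι → S} {s : S} (t : MSTerm L σ s) :
    ∃ (κ : Type) (_ : Finite κ) (f : κ → ι) (t₀ : MSTerm L (fun k => σ (f k)) s),
      ∀ (M : MSStructure.{u} L) (e : ∀ i, M.carrier (σ i)),
        M.value (fun k => e (f k)) t₀ = M.value e t := by
  induction t with
  | var i => exact ⟨Unit, inferInstance, fun _ => i, .var (), fun _ _ => rfl⟩
  | @app l s g t ih =>
    choose κ hκ f t₀ ht using ih
    refine ⟨Σ j, κ j, inferInstance, fun p => f p.1 p.2,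
      .app g fun j => (t₀ j).rename (fun k => ⟨j, k⟩) fun _ => rfl, fun M e => ?_⟩
    simp only [MSStructure.value]
    refine congrArg _ (funext fun j => ?_)
    rw [← ht]
    exact M.value_rename (σ := fun p : Σ j, κ j => σ (f p.1 p.2))
      (fun k => (⟨j, k⟩ : Σ j, κ j)) (fun _ => rfl) (fun p => e (f p.1 p.2)) (fun k => e (f j k)) (fun _ => HEq.rfl) (t₀ j)

/-- Definability uses one variable for each parameter, possibly infinitely many, whereas quantifier
elimination concerns finitely many variables. Only the variables that occur matter, and their number
is finite by induction on the formula. -/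
lemma MSFormula.exists_finite_support {ι : Type v} {σ : ι → S} (φ : MSFormula L σ) :
    ∃ (κ : Type) (_ : Finite κ) (f : κ → ι) (φ₀ : MSFormula L (fun k => σ (f k))),
      ∀ (M : MSStructure.{u} L) (e : ∀ i, M.carrier (σ i)),
        M.Sat φ₀ (fun k => e (f k)) ↔ M.Sat φ e := by
  induction φ with
  | falsum => exact ⟨Empty, inferInstance, Empty.elim, .falsum, fun _ _ => Iff.rfl⟩
  | equal t₁ t₂ =>
    obtain ⟨κ₁, _, f₁, u₁, h₁⟩ := t₁.exists_finite_support
    obtain ⟨κ₂, _, f₂, u₂, h₂⟩ := t₂.exists_finite_support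
    refine ⟨κ₁ ⊕ κ₂, inferInstance, Sum.elim f₁ f₂, .equal (u₁.rename Sum.inl fun _ => rfl)
      (u₂.rename Sum.inr fun _ => rfl), fun M e => ?_⟩
    exact iff_of_eq (congrArg₂ _
      ((M.value_rename Sum.inl (fun _ => rfl) (fun k => e (Sum.elim f₁ f₂ k))
        (fun k => e (f₁ k)) (fun _ => HEq.rfl) u₁).trans (h₁ M e))
      ((M.value_rename Sum.inr (fun _ => rfl) (fun k => e (Sum.elim f₁ f₂ k))
        (fun k => e (f₂ k)) (fun _ => HEq.rfl) u₂).trans (h₂ M e)))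
  | @rel ι σ l R t =>
    choose κ hκ f t₀ ht using fun j => (t j).exists_finite_support
    refine ⟨Σ j, κ j, inferInstance, fun p => f p.1 p.2,
      .rel R fun j => (t₀ j).rename (fun k => ⟨j, k⟩) fun _ => rfl, fun M e => ?_⟩
    simp only [MSStructure.Sat]
    refine iff_of_eq (congrArg _ (funext fun j => ?_))
    rw [← ht]
    exact M.value_rename (σ := fun p : Σ j, κ j => σ (f p.1 p.2))
      (fun k => (⟨j, k⟩ : Σ j, κ j)) (fun _ => rfl) (fun p => e (f p.1 p.2)) (fun k => e (f j k)) (fun _ => HEq.rfl) (t₀ j)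
  | imp φ ψ ih₁ ih₂ =>
    obtain ⟨κ₁, _, f₁, u₁, h₁⟩ := ih₁
    obtain ⟨κ₂, _, f₂, u₂, h₂⟩ := ih₂
    refine ⟨κ₁ ⊕ κ₂, inferInstance, Sum.elim f₁ f₂, .imp (u₁.rename Sum.inl fun _ => rfl)
      (u₂.rename Sum.inr fun _ => rfl), fun M e => ?_⟩
    exact imp_congr
      ((M.sat_rename u₁ Sum.inl (fun _ => rfl) (fun k => e (Sum.elim f₁ f₂ k))
        (fun k => e (f₁ k)) (fun _ => HEq.rfl)).trans (h₁ M e))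
      ((M.sat_rename u₂ Sum.inr (fun _ => rfl) (fun k => e (Sum.elim f₁ f₂ k))
        (fun k => e (f₂ k)) (fun _ => HEq.rfl)).trans (h₂ M e))
  | @all ι σ s φ ih =>
    obtain ⟨κ, _, f, φ₀, h⟩ := ih
    -- Variables sent to `none` by `f` stand for the bound variable; the others remain free and keep
    -- their index.
    let g : κ → Option {k : κ // (f k).isSome} := fun k =>
      if hk : (f k).isSome then some ⟨k, hk⟩ else none
    have hg : ∀ k, f k = (g k).map fun k' => (f k'.1).get k'.2 := by
      intro k
      by_cases hk : (f k).isSome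
      · simp [g, hk]
      · simp only [g, hk]
        simpa using hk
    have hsort : ∀ k, extendSorts σ s (f k) =
        extendSorts (fun k' : {k : κ // (f k).isSome} => σ ((f k'.1).get k'.2)) s (g k) := by
      intro k
      conv_lhs => rw [hg k]
      cases g k <;> rfl
    refine ⟨{k : κ // (f k).isSome}, inferInstance, fun k => (f k.1).get k.2,
      .all s (φ₀.rename g hsort), fun M e => ?_⟩
    simp only [MSStructure.Sat]
    refine forall_congr' fun a => ?_
    rw [← h]
    refine M.sat_rename _ _ _ _ _ fun k => ?_
    rw [hg k]
    cases g k <;> exact HEq.rfl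

end Renaming

namespace MSStructure

variable {S : Type} {L : MSLanguage S} (M : MSStructure.{u} L) (A : Set M.Elements)

/-- The assignment that gives the variables `Sum.inl i` the values `x i`, and the variables
`Sum.inr a` the parameters `a`. -/
def withParams {ι : Type v} {σ : ι → S} (x : ∀ i, M.carrier (σ i)) :
    ∀ i, M.carrier (Sum.elim σ (fun a : A => a.1.1) i) :=
  Sum.rec (motive := fun i => M.carrier (Sum.elim σ (fun a : A => a.1.1) i)) x (fun a => a.1.2)

/-- The assignment on a sum of two families of variables. -/
def sumAssign {ι : Type v} {κ : Type w} {σ : ι → S} {τ : κ → S} (x : ∀ i, M.carrier (σ i))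
    (y : ∀ k, M.carrier (τ k)) : ∀ i, M.carrier (Sum.elim σ τ i) :=
  Sum.rec (motive := fun i => M.carrier (Sum.elim σ τ i)) x y

variable {M A} {ι : Type v} {σ : ι → S} {X Y : Set (∀ i, M.carrier (σ i))}

lemma Definable.falsum : M.Definable A (∅ : Set (∀ i, M.carrier (σ i))) :=
  ⟨.falsum, fun _ => Iff.rfl⟩

lemma Definable.imp (hX : M.Definable A X) (hY : M.Definable A Y) :
    M.Definable A {x | x ∈ X → x ∈ Y} := by
  obtain ⟨φ, hφ⟩ := hX
  obtain ⟨ψ, hψ⟩ := hY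
  exact ⟨.imp φ ψ, fun x => imp_congr (hφ x) (hψ x)⟩

lemma Definable.congr (hX : M.Definable A X) (h : ∀ x, x ∈ Y ↔ x ∈ X) : M.Definable A Y := by
  rwa [show Y = X from Set.ext h]

lemma Definable.compl (hX : M.Definable A X) : M.Definable A Xᶜ :=
  (hX.imp .falsum).congr fun _ => Iff.rfl

lemma Definable.inter (hX : M.Definable A X) (hY : M.Definable A Y) : M.Definable A (X ∩ Y) :=
  (hX.imp hY.compl).compl.congr fun x => by
    simp only [Set.mem_inter_iff, Set.mem_compl_iff, Set.mem_ofPred_eq]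
    tauto

lemma Definable.biInter {T : Type w} (s : Finset T) {F : T → Set (∀ i, M.carrier (σ i))}
    (h : ∀ t ∈ s, M.Definable A (F t)) : M.Definable A {x | ∀ t ∈ s, x ∈ F t} := by
  classical
  induction s using Finset.induction_on with
  | empty => exact Definable.falsum.compl.congr fun x => by simp
  | insert a s ha ih =>
    refine ((h a (by simp)).inter (ih fun t ht => h t (by simp [ht]))).congr fun x => ?_
    simp

/-- All substitutions of variables in definable sets go through this. The tuples are compared by
heterogeneous equality because corresponding sorts agree only propositionally. -/
lemma Definable.reindex {κ : Type w} {τ : κ → S} {Z : Set (∀ k, M.carrier (τ k))}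
    (hZ : M.Definable A Z) (f : κ → ι) (h : ∀ k, τ k = σ (f k))
    (hX : ∀ (x : ∀ i, M.carrier (σ i)) (z : ∀ k, M.carrier (τ k)),
      (∀ k, z k ≍ x (f k)) → (x ∈ X ↔ z ∈ Z)) : M.Definable A X := by
  obtain ⟨φ, hφ⟩ := hZ
  refine ⟨φ.rename (Sum.map f id) ?_, fun x => ?_⟩
  · rintro (k | a)
    · exact h k
    · rfl
  · let z : ∀ k, M.carrier (τ k) := fun k => cast (congrArg M.carrier (h k).symm) (x (f k))
    have hz : ∀ k, z k ≍ x (f k) := fun k => cast_heq _ _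
    rw [hX x z hz, hφ z]
    symm
    apply M.sat_rename
    rintro (k | a)
    · exact hz k
    · exact HEq.rfl

lemma Definable.all {s : S} {Z : Set (∀ o, M.carrier (extendSorts σ s o))}
    (hZ : M.Definable A Z) : M.Definable A {x | ∀ a, M.extendAssignment x a ∈ Z} := by
  obtain ⟨φ, hφ⟩ := hZ
  refine ⟨.all s (φ.rename (Sum.elim (Option.map Sum.inl) (fun a => some (Sum.inr a))) ?_),
    fun x => ?_⟩
  · rintro ((_ | i) | a) <;> rfl
  · simp only [Sat, Set.mem_ofPred_eq]
    refine forall_congr' fun a => ?_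
    rw [hφ]
    symm
    apply M.sat_rename
    rintro ((_ | i) | a) <;> exact HEq.rfl

lemma Definable.allFin {s : S} {m : ℕ} :
    ∀ {ι : Type v} {σ : ι → S} {Z : Set (∀ i, M.carrier (Sum.elim (fun _ : Fin m => s) σ i))},
      M.Definable A Z → M.Definable A {x | ∀ y : Fin m → M.carrier s, M.sumAssign y x ∈ Z} := by
  induction m with
  | zero =>
    intro ι σ Z hZ
    refine hZ.reindex (Sum.elim Fin.elim0 id) (by rintro (k | i); exacts [k.elim0, rfl]) ?_
    intro x z hz
    have : ∀ y : Fin 0 → M.carrier s, M.sumAssign y x = z := by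
      intro y
      funext i
      rcases i with k | i
      · exact k.elim0
      · exact (eq_of_heq (hz (Sum.inr i))).symm
    simp only [Set.mem_ofPred_eq, this]
    exact ⟨fun h => h Fin.elim0, fun h _ => h⟩
  | succ m ih =>
    intro ι σ Z hZ
    have h1 : M.Definable A (σ := Sum.elim (fun _ : Fin m => s) (extendSorts σ s))
        {w | M.sumAssign (σ := fun _ : Fin (m + 1) => s) (τ := σ)
          (Fin.cons (α := fun _ => M.carrier s) (w (Sum.inr none)) fun k => w (Sum.inl k))
          (fun i => w (Sum.inr (some i))) ∈ Z} := by
      refine hZ.reindex (Sum.elim (Fin.cons (Sum.inr none) Sum.inl) fun i => Sum.inr (some i))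
        ?_ ?_
      · rintro (k | i)
        · refine Fin.cases ?_ (fun k => ?_) k <;> rfl
        · rfl
      · intro w z hz
        simp only [Set.mem_ofPred_eq]
        refine iff_of_eq (congrArg (· ∈ Z) ?_)
        funext i
        rcases i with k | i
        · have := hz (Sum.inl k)
          revert this
          refine Fin.cases ?_ (fun k => ?_) k
          · intro h; exact (eq_of_heq h).symm
          · intro h; exact (eq_of_heq h).symm
        · exact (eq_of_heq (hz (Sum.inr i))).symm
    refine (ih h1).all.congr fun x => ?_
    constructor
    · intro h a y
      exact h _
    · intro h y
      have := h (y 0) (fun k => y k.succ)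
      simp only [Set.mem_ofPred_eq] at this
      rw [show y = Fin.cons (y 0) (Fin.tail y) from (Fin.cons_self_tail y).symm]
      exact this

lemma Definable.existsFin {s : S} {m : ℕ} {Z : Set (∀ i, M.carrier (Sum.elim (fun _ : Fin m => s) σ i))}
    (hZ : M.Definable A Z) :
    M.Definable A {x | ∃ y : Fin m → M.carrier s, M.sumAssign y x ∈ Z} :=
  (hZ.compl.allFin).compl.congr fun x => by simp

end MSStructure

end

/-! ### Ultraproducts of fields and of ordered groups -/

section
open Filter

namespace TLoc

section Ultraproduct

variable {I : Type} (U : Ultrafilter I)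

/-- The ideal of the sequences that vanish almost everywhere. -/
def nullIdeal (R : I → Type u) [∀ i, CommRing (R i)] : Ideal (∀ i, R i) where
  carrier := {f | ∀ᶠ i in U, f i = 0}
  zero_mem' := Eventually.of_forall fun _ => rfl
  add_mem' := by
    intro f g hf hg
    filter_upwards [hf, hg] with i h1 h2
    simp [h1, h2]
  smul_mem' := by
    intro f g hg
    filter_upwards [hg] with i h
    simp [h]

/-- The ultraproduct of a family of rings. -/
abbrev UltraRing (R : I → Type u) [∀ i, CommRing (R i)] : Type u := (∀ i, R i) ⧸ nullIdeal U R

/-- The class of a sequence in the ultraproduct of a family of rings. -/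
abbrev ultraMk (R : I → Type u) [∀ i, CommRing (R i)] : (∀ i, R i) →+* UltraRing U R :=
  Ideal.Quotient.mk (nullIdeal U R)

variable {U}

lemma ultraMk_surjective {R : I → Type u} [∀ i, CommRing (R i)] :
    Function.Surjective (ultraMk U R) := Ideal.Quotient.mk_surjective

lemma ultraMk_eq_iff {R : I → Type u} [∀ i, CommRing (R i)] {f g : ∀ i, R i} :
    ultraMk U R f = ultraMk U R g ↔ ∀ᶠ i in U, f i = g i := by
  rw [Ideal.Quotient.eq]
  change (∀ᶠ i in U, (f - g) i = 0) ↔ _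
  simp only [Pi.sub_apply, sub_eq_zero]

lemma ultraMk_eq_zero_iff {R : I → Type u} [∀ i, CommRing (R i)] {f : ∀ i, R i} :
    ultraMk U R f = 0 ↔ ∀ᶠ i in U, f i = 0 := by
  rw [← map_zero (ultraMk U R), ultraMk_eq_iff]
  rfl

instance nullIdeal_isMaximal (F : I → Type u) [∀ i, Field (F i)] :
    (nullIdeal U F).IsMaximal := by
  apply Ideal.Quotient.maximal_of_isField
  refine ⟨⟨0, 1, ?_⟩, mul_comm, ?_⟩
  · intro h
    have h' : ultraMk U F 1 = 0 := by rw [map_one]; exact h.symm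
    rw [ultraMk_eq_zero_iff] at h'
    obtain ⟨i, hi⟩ := h'.exists
    exact one_ne_zero hi
  · intro a ha
    obtain ⟨f, rfl⟩ := ultraMk_surjective a
    refine ⟨ultraMk U F fun i => (f i)⁻¹, ?_⟩
    rw [← map_mul, ← map_one (ultraMk U F), ultraMk_eq_iff]
    have := (Ultrafilter.eventually_not.2 fun h => ha (ultraMk_eq_zero_iff.2 h) :
      ∀ᶠ i in U, ¬ f i = 0)
    filter_upwards [this] with i hi
    exact mul_inv_cancel₀ hi

noncomputable instance ultraField (F : I → Type u) [∀ i, Field (F i)] : Field (UltraRing U F) :=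
  Ideal.Quotient.field _

lemma eval_ultraMk {R : I → Type u} [∀ i, CommRing (R i)] (P : Polynomial (∀ i, R i))
    (f : ∀ i, R i) : (P.map (ultraMk U R)).eval (ultraMk U R f) =
      ultraMk U R fun i => (P.map (Pi.evalRingHom R i)).eval (f i) := by
  have h0 := Polynomial.hom_eval₂ P (RingHom.id _) (ultraMk U R) f
  rw [RingHom.comp_id] at h0
  rw [Polynomial.eval_map, ← h0]
  congr 1
  funext i
  have := Polynomial.hom_eval₂ P (RingHom.id _) (Pi.evalRingHom R i) f
  simp only [Pi.evalRingHom_apply, RingHom.comp_id] at this ⊢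
  rw [this, Polynomial.eval_map]

instance ultraAlgClosed (F : I → Type u) [∀ i, Field (F i)] [∀ i, IsAlgClosed (F i)] :
    IsAlgClosed (UltraRing U F) := by
  apply IsAlgClosed.of_exists_root
  intro p hp hirr
  have hl : p ∈ Polynomial.lifts (ultraMk U F) := by
    rw [Polynomial.lifts_iff_coeff_lifts]
    exact fun n => ultraMk_surjective _
  -- A monic lift of the same degree is essential: it keeps the degree positive in every coordinate,
  -- so that each coordinate polynomial has a root.
  obtain ⟨P, rfl, hdeg, hP⟩ := Polynomial.lifts_and_natDegree_eq_and_monic hl hp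
  have hroot : ∀ i, ∃ x : F i, (P.map (Pi.evalRingHom F i)).eval x = 0 := by
    intro i
    apply IsAlgClosed.exists_root
    have hm := hP.map (Pi.evalRingHom F i)
    intro h0
    have h1 : (P.map (Pi.evalRingHom F i)).natDegree = P.natDegree := hP.natDegree_map _
    have h2 := hirr.natDegree_pos
    rw [← hdeg, ← h1, Polynomial.natDegree_eq_of_degree_eq_some h0] at h2
    exact lt_irrefl _ h2
  choose x hx using hroot
  refine ⟨ultraMk U F x, ?_⟩
  rw [eval_ultraMk, ultraMk_eq_zero_iff]
  exact Eventually.of_forall hx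

variable (U)

/-- The subgroup of the sequences that vanish almost everywhere. -/
def nullSubgroup (G : I → Type u) [∀ i, AddCommGroup (G i)] : AddSubgroup (∀ i, G i) where
  carrier := {f | ∀ᶠ i in U, f i = 0}
  zero_mem' := Eventually.of_forall fun _ => rfl
  add_mem' := by
    intro f g hf hg
    filter_upwards [hf, hg] with i h1 h2
    simp [h1, h2]
  neg_mem' := by
    intro f hf
    filter_upwards [hf] with i h
    simp [h]

/-- The ultraproduct of a family of abelian groups. -/
abbrev UltraGroup (G : I → Type u) [∀ i, AddCommGroup (G i)] : Type u :=
  (∀ i, G i) ⧸ nullSubgroup U G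

/-- The class of a sequence in the ultraproduct of a family of abelian groups. -/
abbrev ultraMkG (G : I → Type u) [∀ i, AddCommGroup (G i)] : (∀ i, G i) →+ UltraGroup U G :=
  QuotientAddGroup.mk' (nullSubgroup U G)

variable {U}

lemma ultraMkG_surjective {G : I → Type u} [∀ i, AddCommGroup (G i)] :
    Function.Surjective (ultraMkG U G) := QuotientAddGroup.mk'_surjective _

lemma ultraMkG_eq_iff {G : I → Type u} [∀ i, AddCommGroup (G i)] {f g : ∀ i, G i} :
    ultraMkG U G f = ultraMkG U G g ↔ ∀ᶠ i in U, f i = g i := by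
  rw [← sub_eq_zero, ← map_sub, ← AddMonoidHom.mem_ker, QuotientAddGroup.ker_mk']
  change (∀ᶠ i in U, (f - g) i = 0) ↔ _
  simp only [Pi.sub_apply, sub_eq_zero]

section Order

variable (G : I → Type u) [∀ i, AddCommGroup (G i)] [∀ i, LinearOrder (G i)]

instance ultraLE : LE (UltraGroup U G) where
  le a b := ∃ f g, ultraMkG U G f = a ∧ ultraMkG U G g = b ∧ ∀ᶠ i in U, f i ≤ g i

variable {G}

lemma ultraMkG_le_iff {f g : ∀ i, G i} :
    ultraMkG U G f ≤ ultraMkG U G g ↔ ∀ᶠ i in U, f i ≤ g i := by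
  constructor
  · rintro ⟨f', g', hf, hg, h⟩
    filter_upwards [ultraMkG_eq_iff.1 hf, ultraMkG_eq_iff.1 hg, h] with i h1 h2 h3
    rwa [← h1, ← h2]
  · exact fun h => ⟨f, g, rfl, rfl, h⟩

variable (G)

open Classical in
noncomputable instance ultraLinearOrder : LinearOrder (UltraGroup U G) where
  le_refl a := by
    obtain ⟨f, rfl⟩ := ultraMkG_surjective a
    exact ultraMkG_le_iff.2 (Eventually.of_forall fun _ => le_rfl)
  le_trans a b c hab hbc := by
    obtain ⟨f, rfl⟩ := ultraMkG_surjective a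
    obtain ⟨g, rfl⟩ := ultraMkG_surjective b
    obtain ⟨h, rfl⟩ := ultraMkG_surjective c
    rw [ultraMkG_le_iff] at *
    filter_upwards [hab, hbc] with i h1 h2
    exact h1.trans h2
  le_antisymm a b hab hba := by
    obtain ⟨f, rfl⟩ := ultraMkG_surjective a
    obtain ⟨g, rfl⟩ := ultraMkG_surjective b
    rw [ultraMkG_le_iff] at *
    rw [ultraMkG_eq_iff]
    filter_upwards [hab, hba] with i h1 h2
    exact le_antisymm h1 h2
  le_total a b := by
    obtain ⟨f, rfl⟩ := ultraMkG_surjective a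
    obtain ⟨g, rfl⟩ := ultraMkG_surjective b
    rw [ultraMkG_le_iff, ultraMkG_le_iff, ← Ultrafilter.eventually_or]
    exact Eventually.of_forall fun i => le_total _ _
  toDecidableLE := Classical.decRel _

variable {G}

lemma ultraMkG_lt_iff {f g : ∀ i, G i} :
    ultraMkG U G f < ultraMkG U G g ↔ ∀ᶠ i in U, f i < g i := by
  rw [← not_le, ultraMkG_le_iff, ← Ultrafilter.eventually_not]
  simp only [not_le]

variable (G)

instance ultraOrdered [∀ i, IsOrderedAddMonoid (G i)] : IsOrderedAddMonoid (UltraGroup U G) where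
  add_le_add_left a b hab c := by
    obtain ⟨f, rfl⟩ := ultraMkG_surjective a
    obtain ⟨g, rfl⟩ := ultraMkG_surjective b
    obtain ⟨h, rfl⟩ := ultraMkG_surjective c
    rw [← map_add, ← map_add, ultraMkG_le_iff]
    rw [ultraMkG_le_iff] at hab
    filter_upwards [hab] with i h1
    simpa using h1

open Classical in
/-- The class of a sequence of elements of groups with `∞` adjoined. -/
noncomputable def ultraMkTop (U : Ultrafilter I) (e : ∀ i, WithTop (G i)) :
    WithTop (UltraGroup U G) :=
  if ∀ᶠ i in U, e i = ⊤ then ⊤ else (ultraMkG U G fun i => (e i).untopD 0 : UltraGroup U G)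

variable {G}

lemma ultraMkTop_of_top {e : ∀ i, WithTop (G i)} (h : ∀ᶠ i in U, e i = ⊤) :
    ultraMkTop G U e = ⊤ := if_pos h

lemma ultraMkTop_of_coe {e : ∀ i, WithTop (G i)} {g : ∀ i, G i} (h : ∀ᶠ i in U, e i = g i) :
    ultraMkTop G U e = (ultraMkG U G g : UltraGroup U G) := by
  have h' : ¬ ∀ᶠ i in U, e i = ⊤ := by
    intro h'
    obtain ⟨i, h1, h2⟩ := (h.and h').exists
    rw [h2] at h1
    exact WithTop.top_ne_coe h1
  rw [ultraMkTop, if_neg h', WithTop.coe_inj, ultraMkG_eq_iff]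
  filter_upwards [h] with i hi
  simp [hi]

/-- The ultrafilter decides between `∞` and finite values. This dichotomy reduces statements about
classes with `∞` adjoined to the group itself. -/
lemma eventually_top_or_coe (U : Ultrafilter I) (e : ∀ i, WithTop (G i)) :
    (∀ᶠ i in U, e i = ⊤) ∨ ∃ g : ∀ i, G i, ∀ᶠ i in U, e i = g i := by
  by_cases h : ∀ᶠ i in U, e i = ⊤
  · exact Or.inl h
  · refine Or.inr ⟨fun i => (e i).untopD 0, ?_⟩
    filter_upwards [Ultrafilter.eventually_not.2 h] with i hi
    obtain ⟨g, hg⟩ := WithTop.ne_top_iff_exists.1 hi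
    rw [← hg]
    rfl

lemma ultraMkTop_surjective : Function.Surjective (ultraMkTop G U) := by
  intro a
  induction a using WithTop.recTopCoe with
  | top => exact ⟨fun _ => ⊤, ultraMkTop_of_top (Eventually.of_forall fun _ => rfl)⟩
  | coe a =>
    obtain ⟨g, rfl⟩ := ultraMkG_surjective a
    exact ⟨fun i => g i, ultraMkTop_of_coe (Eventually.of_forall fun _ => rfl)⟩

lemma ultraMkTop_lt_iff {e e' : ∀ i, WithTop (G i)} :
    ultraMkTop G U e < ultraMkTop G U e' ↔ ∀ᶠ i in U, e i < e' i := by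
  rcases eventually_top_or_coe U e with h | ⟨g, h⟩
  · rw [ultraMkTop_of_top h]
    simp only [not_top_lt, false_iff]
    intro h'
    obtain ⟨i, h1, h2⟩ := (h.and h').exists
    rw [h1] at h2
    exact not_top_lt h2
  · rcases eventually_top_or_coe U e' with h' | ⟨g', h'⟩
    · rw [ultraMkTop_of_coe h, ultraMkTop_of_top h']
      simp only [WithTop.coe_lt_top, true_iff]
      filter_upwards [h, h'] with i h1 h2
      rw [h1, h2]
      exact WithTop.coe_lt_top _
    · rw [ultraMkTop_of_coe h, ultraMkTop_of_coe h', WithTop.coe_lt_coe, ultraMkG_lt_iff]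
      refine Filter.eventually_congr ?_
      filter_upwards [h, h'] with i h1 h2
      rw [h1, h2, WithTop.coe_lt_coe]

lemma ultraMkTop_le_iff {e e' : ∀ i, WithTop (G i)} :
    ultraMkTop G U e ≤ ultraMkTop G U e' ↔ ∀ᶠ i in U, e i ≤ e' i := by
  rw [← not_lt, ultraMkTop_lt_iff, ← Ultrafilter.eventually_not]
  simp only [not_lt]

lemma ultraMkTop_eq_iff {e e' : ∀ i, WithTop (G i)} :
    ultraMkTop G U e = ultraMkTop G U e' ↔ ∀ᶠ i in U, e i = e' i := by
  rw [le_antisymm_iff, ultraMkTop_le_iff, ultraMkTop_le_iff, ← Filter.eventually_and]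
  simp only [le_antisymm_iff]

lemma ultraMkTop_add (e e' : ∀ i, WithTop (G i)) :
    ultraMkTop G U (fun i => e i + e' i) = ultraMkTop G U e + ultraMkTop G U e' := by
  rcases eventually_top_or_coe U e with h | ⟨g, h⟩
  · rw [ultraMkTop_of_top h, WithTop.top_add, ultraMkTop_of_top]
    filter_upwards [h] with i h1
    rw [h1, WithTop.top_add]
  · rcases eventually_top_or_coe U e' with h' | ⟨g', h'⟩
    · rw [ultraMkTop_of_top h', WithTop.add_top, ultraMkTop_of_top]
      filter_upwards [h'] with i h1
      rw [h1, WithTop.add_top]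
    · rw [ultraMkTop_of_coe h, ultraMkTop_of_coe h', ← WithTop.coe_add, ← map_add]
      apply ultraMkTop_of_coe
      filter_upwards [h, h'] with i h1 h2
      rw [h1, h2]
      rfl

lemma ultraMkTop_neg (e : ∀ i, WithTop (G i)) :
    ultraMkTop G U (fun i => -e i) = -ultraMkTop G U e := by
  rcases eventually_top_or_coe U e with h | ⟨g, h⟩
  · rw [ultraMkTop_of_top h, ultraMkTop_of_top]
    · rfl
    · filter_upwards [h] with i h1
      rw [h1]
      rfl
  · rw [ultraMkTop_of_coe h]
    change _ = ((-(ultraMkG U G g) : UltraGroup U G) : WithTop (UltraGroup U G))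
    rw [← map_neg]
    apply ultraMkTop_of_coe
    filter_upwards [h] with i h1
    rw [h1]
    rfl

lemma ultraMkTop_zero : ultraMkTop G U (fun _ => 0) = 0 := by
  rw [← WithTop.coe_zero, ← map_zero (ultraMkG U G)]
  exact ultraMkTop_of_coe (Eventually.of_forall fun _ => rfl)

end Order

end Ultraproduct

end TLoc

end

/-! ### Ultraproducts of models and Łoś's theorem -/

section
open Filter

namespace TLoc

namespace Model

/-- Expresses the residue map by a total function. A representative of an integral class is integral
only almost everywhere, so the ultraproduct of the residue maps is built from this total form. -/
lemma resDiv_one (M : Model.{u}) {x : M.K} (hx : x ∈ valuationRing M.val) :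
    M.resDiv x 1 = M.res ⟨x, hx⟩ := by
  apply M.resDiv_eq_of_lt
  rw [mul_one, M.val.map_one]
  have h := M.res_eq_zero_iff (⟨x, hx⟩ - ⟨M.sec (M.res ⟨x, hx⟩), M.sec_mem _⟩)
  rw [map_sub, M.res_sec, sub_self] at h
  exact h.1 rfl

section Ultra

variable {I : Type} (U : Ultrafilter I) (M : I → Model.{u})

/-- The valuation of an ultraproduct of models, as a function. -/
noncomputable def ultraValFun (a : UltraRing U fun i => (M i).K) :
    WithTop (UltraGroup U fun i => (M i).Γ) :=
  ultraMkTop (fun i => (M i).Γ) U fun i => (M i).val ((ultraMk_surjective a).choose i)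

lemma ultraValFun_mk (f : ∀ i, (M i).K) : ultraValFun U M (ultraMk U _ f) =
    ultraMkTop (fun i => (M i).Γ) U fun i => (M i).val (f i) := by
  have h := ultraMk_eq_iff.1 (ultraMk_surjective (ultraMk U (fun i => (M i).K) f)).choose_spec
  rw [ultraValFun, ultraMkTop_eq_iff]
  filter_upwards [h] with i hi
  rw [hi]

/-- The valuation of an ultraproduct of models. -/
noncomputable def ultraVal : AddValuation (UltraRing U fun i => (M i).K)
    (WithTop (UltraGroup U fun i => (M i).Γ)) :=
  AddValuation.of (ultraValFun U M)
    (by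
      rw [← map_zero (ultraMk U _), ultraValFun_mk]
      exact ultraMkTop_of_top (Eventually.of_forall fun i => (M i).val.map_zero))
    (by
      rw [← map_one (ultraMk U _), ultraValFun_mk, ← ultraMkTop_zero, ultraMkTop_eq_iff]
      exact Eventually.of_forall fun i => (M i).val.map_one)
    (by
      intro x y
      obtain ⟨f, rfl⟩ := ultraMk_surjective x
      obtain ⟨g, rfl⟩ := ultraMk_surjective y
      rw [← map_add, ultraValFun_mk, ultraValFun_mk, ultraValFun_mk, min_le_iff, ultraMkTop_le_iff,
        ultraMkTop_le_iff, ← Ultrafilter.eventually_or]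
      exact Eventually.of_forall fun i => min_le_iff.1 ((M i).val.map_add _ _))
    (by
      intro x y
      obtain ⟨f, rfl⟩ := ultraMk_surjective x
      obtain ⟨g, rfl⟩ := ultraMk_surjective y
      rw [← map_mul, ultraValFun_mk, ultraValFun_mk, ultraValFun_mk, ← ultraMkTop_add,
        ultraMkTop_eq_iff]
      exact Eventually.of_forall fun i => (M i).val.map_mul _ _)

lemma ultraVal_mk (f : ∀ i, (M i).K) : ultraVal U M (ultraMk U _ f) =
    ultraMkTop (fun i => (M i).Γ) U fun i => (M i).val (f i) := ultraValFun_mk U M f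

lemma ultraVal_nonneg_iff (f : ∀ i, (M i).K) :
    0 ≤ ultraVal U M (ultraMk U _ f) ↔ ∀ᶠ i in U, 0 ≤ (M i).val (f i) := by
  rw [ultraVal_mk, ← ultraMkTop_zero, ultraMkTop_le_iff]

/-- The residue map of an ultraproduct of models, as a function. -/
noncomputable def ultraResFun (a : UltraRing U fun i => (M i).K) : UltraRing U fun i => (M i).k :=
  ultraMk U _ fun i => (M i).resDiv ((ultraMk_surjective a).choose i) 1

lemma ultraResFun_mk (f : ∀ i, (M i).K) : ultraResFun U M (ultraMk U _ f) =
    ultraMk U _ fun i => (M i).resDiv (f i) 1 := by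
  have h := ultraMk_eq_iff.1 (ultraMk_surjective (ultraMk U (fun i => (M i).K) f)).choose_spec
  rw [ultraResFun, ultraMk_eq_iff]
  filter_upwards [h] with i hi
  rw [hi]

/-- The residue map of an ultraproduct of models. -/
noncomputable def ultraRes : valuationRing (ultraVal U M) →+* UltraRing U fun i => (M i).k where
  toFun x := ultraResFun U M x
  map_zero' := by
    rw [Subring.coe_zero, ← map_zero (ultraMk U _), ultraResFun_mk, ← map_zero (ultraMk U _)]
    congr 1
    exact funext fun i => (M i).resDiv_zero_left _
  map_one' := by
    rw [Subring.coe_one, ← map_one (ultraMk U _), ultraResFun_mk, ← map_one (ultraMk U _)]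
    congr 1
    exact funext fun i => (M i).resDiv_self one_ne_zero
  map_add' := by
    rintro ⟨x, hx⟩ ⟨y, hy⟩
    obtain ⟨f, rfl⟩ := ultraMk_surjective x
    obtain ⟨g, rfl⟩ := ultraMk_surjective y
    have hx' := (ultraVal_nonneg_iff U M f).1 hx
    have hy' := (ultraVal_nonneg_iff U M g).1 hy
    change ultraResFun U M (ultraMk U _ f + ultraMk U _ g) = ultraResFun U M (ultraMk U _ f) +
      ultraResFun U M (ultraMk U _ g)
    rw [← map_add, ultraResFun_mk, ultraResFun_mk, ultraResFun_mk, ← map_add, ultraMk_eq_iff]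
    filter_upwards [hx', hy'] with i h1 h2
    have h3 : f i ∈ valuationRing (M i).val := h1
    have h4 : g i ∈ valuationRing (M i).val := h2
    simp only [Pi.add_apply]
    rw [resDiv_one _ h3, resDiv_one _ h4, resDiv_one _ (add_mem h3 h4), ← map_add]
    rfl
  map_mul' := by
    rintro ⟨x, hx⟩ ⟨y, hy⟩
    obtain ⟨f, rfl⟩ := ultraMk_surjective x
    obtain ⟨g, rfl⟩ := ultraMk_surjective y
    have hx' := (ultraVal_nonneg_iff U M f).1 hx
    have hy' := (ultraVal_nonneg_iff U M g).1 hy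
    change ultraResFun U M (ultraMk U _ f * ultraMk U _ g) = ultraResFun U M (ultraMk U _ f) *
      ultraResFun U M (ultraMk U _ g)
    rw [← map_mul, ultraResFun_mk, ultraResFun_mk, ultraResFun_mk, ← map_mul, ultraMk_eq_iff]
    filter_upwards [hx', hy'] with i h1 h2
    have h3 : f i ∈ valuationRing (M i).val := h1
    have h4 : g i ∈ valuationRing (M i).val := h2
    simp only [Pi.mul_apply]
    rw [resDiv_one _ h3, resDiv_one _ h4, resDiv_one _ (mul_mem h3 h4), ← map_mul]
    rfl

/-- The section of an ultraproduct of models. -/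
noncomputable def ultraSec : (UltraRing U fun i => (M i).k) →+* UltraRing U fun i => (M i).K :=
  Ideal.Quotient.lift _ ((ultraMk U fun i => (M i).K).comp
      (RingHom.pi fun i => (M i).sec.comp (Pi.evalRingHom _ i))) <| by
    intro f hf
    rw [RingHom.comp_apply, ultraMk_eq_zero_iff]
    filter_upwards [hf] with i hi
    exact (congrArg (M i).sec hi).trans (map_zero _)

lemma ultraSec_mk (c : ∀ i, (M i).k) :
    ultraSec U M (ultraMk U _ c) = ultraMk U _ fun i => (M i).sec (c i) := rfl

/-- The ultraproduct of a family of models. -/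
noncomputable def ultra : Model.{u} where
  K := UltraRing U fun i => (M i).K
  k := UltraRing U fun i => (M i).k
  Γ := UltraGroup U fun i => (M i).Γ
  val := ultraVal U M
  val_surjective a := by
    obtain ⟨e, rfl⟩ := ultraMkTop_surjective a
    choose f hf using fun i => (M i).val_surjective (e i)
    refine ⟨ultraMk U _ f, ?_⟩
    rw [ultraVal_mk]
    simp only [hf]
  res := ultraRes U M
  res_eq_zero_iff := by
    rintro ⟨x, hx⟩
    obtain ⟨f, rfl⟩ := ultraMk_surjective x
    change ultraResFun U M (ultraMk U _ f) = 0 ↔ _ < ultraVal U M (ultraMk U _ f)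
    rw [ultraResFun_mk, ultraMk_eq_zero_iff, ultraVal_mk, ← ultraMkTop_zero, ultraMkTop_lt_iff]
    refine eventually_congr ?_
    filter_upwards [(ultraVal_nonneg_iff U M f).1 hx] with i hi
    rw [resDiv_one (M i) hi]
    exact (M i).res_eq_zero_iff _
  sec := ultraSec U M
  sec_mem c := by
    obtain ⟨c, rfl⟩ := ultraMk_surjective c
    rw [ultraSec_mk]
    exact (ultraVal_nonneg_iff U M _).2 (Eventually.of_forall fun i => (M i).sec_mem _)
  res_sec c := by
    obtain ⟨c, rfl⟩ := ultraMk_surjective c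
    change ultraResFun U M (ultraSec U M _) = _
    rw [ultraSec_mk, ultraResFun_mk]
    congr 1
    funext i
    have := (M i).resDiv_sec (c i) 1
    simpa using this
  one := ultraMkG U _ fun i => (M i).one
  one_pos := by
    rw [← map_zero (ultraMkG U _), ultraMkG_lt_iff]
    exact Eventually.of_forall fun i => (M i).one_pos

/-- The ultrafilter decides which of the three cases in the definition occurs; in the last one, the
residue is characterised by an inequality of values, which passes to the ultraproduct. -/
lemma resDiv_ultra (f g : ∀ i, (M i).K) :
    (ultra U M).resDiv (ultraMk U _ f) (ultraMk U _ g) =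
      ultraMk U _ fun i => (M i).resDiv (f i) (g i) := by
  by_cases hg : ∀ᶠ i in U, g i = 0
  · have h0 : ultraMk U _ g = 0 := ultraMk_eq_zero_iff.2 hg
    have h1 : (ultraMk U _ fun i => (M i).resDiv (f i) (g i)) = 0 := by
      rw [ultraMk_eq_zero_iff]
      filter_upwards [hg] with i hi
      rw [hi, resDiv_zero_right]
    rw [h0, h1]
    exact (ultra U M).resDiv_zero_right _
  by_cases hlt : ∀ᶠ i in U, (M i).val (f i) < (M i).val (g i)
  · have h1 : (ultraMk U _ fun i => (M i).resDiv (f i) (g i)) = 0 := by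
      rw [ultraMk_eq_zero_iff]
      filter_upwards [hlt] with i hi
      exact (M i).resDiv_of_lt hi
    rw [h1]
    apply (ultra U M).resDiv_of_lt
    change ultraVal U M _ < ultraVal U M _
    rw [ultraVal_mk, ultraVal_mk, ultraMkTop_lt_iff]
    exact hlt
  · apply (ultra U M).resDiv_eq_of_lt
    change ultraVal U M _ < ultraVal U M (_ - ultraSec U M _ * _)
    rw [ultraSec_mk, ← map_mul, ← map_sub, ultraVal_mk, ultraVal_mk, ultraMkTop_lt_iff]
    filter_upwards [Ultrafilter.eventually_not.2 hg, Ultrafilter.eventually_not.2 hlt] with i h1 h2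
    exact (M i).val_lt_sub_resDiv h1 (not_lt.1 h2)

/-- The class of a sequence in the ultraproduct of models, in any sort. -/
noncomputable def ultraClass : (s : Srt) → (∀ i, (M i).carrier s) → (ultra U M).carrier s
  | .VF => fun a => ultraMk U (fun i => (M i).K) a
  | .k => fun a => ultraMk U (fun i => (M i).k) a
  | .Γ => fun a => ultraMkTop (fun i => (M i).Γ) U a

lemma ultraClass_surjective (s : Srt) : Function.Surjective (ultraClass U M s) := by
  cases s
  · exact ultraMk_surjective (R := fun i => (M i).K)
  · exact ultraMk_surjective (R := fun i => (M i).k)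
  · exact ultraMkTop_surjective (G := fun i => (M i).Γ)

lemma ultraClass_eq_iff (s : Srt) (a b : ∀ i, (M i).carrier s) :
    ultraClass U M s a = ultraClass U M s b ↔ ∀ᶠ i in U, a i = b i := by
  cases s
  · exact ultraMk_eq_iff (R := fun i => (M i).K)
  · exact ultraMk_eq_iff (R := fun i => (M i).k)
  · exact ultraMkTop_eq_iff (G := fun i => (M i).Γ)

lemma ultraClass_fn {l : List Srt} {s : Srt} (f : Fn l s)
    (a : ∀ i, ∀ j : Fin l.length, (M i).carrier (l.get j)) :
    ultraClass U M s (fun i => (M i).fn f (a i)) =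
      (ultra U M).fn f fun j => ultraClass U M (l.get j) fun i => a i j := by
  cases f with
  | vfZero => exact map_zero (ultraMk U _)
  | vfOne => exact map_one (ultraMk U _)
  | vfNeg =>
    exact map_neg (ultraMk U fun i => (M i).K)
        (show ∀ i, (M i).K from fun i => a i 0)
  | vfAdd =>
    exact map_add (ultraMk U fun i => (M i).K)
        (show ∀ i, (M i).K from fun i => a i 0) (show ∀ i, (M i).K from fun i => a i 1)
  | vfMul =>
    exact map_mul (ultraMk U fun i => (M i).K)
        (show ∀ i, (M i).K from fun i => a i 0) (show ∀ i, (M i).K from fun i => a i 1)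
  | kZero => exact map_zero (ultraMk U _)
  | kOne => exact map_one (ultraMk U _)
  | kNeg =>
    exact map_neg (ultraMk U fun i => (M i).k)
        (show ∀ i, (M i).k from fun i => a i 0)
  | kAdd =>
    exact map_add (ultraMk U fun i => (M i).k)
        (show ∀ i, (M i).k from fun i => a i 0) (show ∀ i, (M i).k from fun i => a i 1)
  | kMul =>
    exact map_mul (ultraMk U fun i => (M i).k)
        (show ∀ i, (M i).k from fun i => a i 0) (show ∀ i, (M i).k from fun i => a i 1)
  | gZero => exact ultraMkTop_zero
  | gOne => exact ultraMkTop_of_coe (Eventually.of_forall fun _ => rfl)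
  | gNeg => exact ultraMkTop_neg (G := fun i => (M i).Γ) (fun i => a i 0)
  | gAdd => exact ultraMkTop_add (G := fun i => (M i).Γ) (fun i => a i 0) (fun i => a i 1)
  | val => exact (ultraVal_mk U M fun i => a i 0).symm
  | resDiv => exact (resDiv_ultra U M (fun i => a i 0) (fun i => a i 1)).symm
  | sec => exact (ultraSec_mk U M fun i => a i 0).symm

lemma ultraClass_rel {l : List Srt} (R : Rel l)
    (a : ∀ i, ∀ j : Fin l.length, (M i).carrier (l.get j)) :
    (ultra U M).rel R (fun j => ultraClass U M (l.get j) fun i => a i j) ↔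
      ∀ᶠ i in U, (M i).rel R (a i) := by
  cases R with
  | lt => exact ultraMkTop_lt_iff (G := fun i => (M i).Γ)

/-- The class of a sequence of assignments. -/
noncomputable def ultraAssign {ι : Type v} {σ : ι → Srt}
    (e : ∀ i, ∀ j, (M i).toStructure.carrier (σ j)) : ∀ j, (ultra U M).toStructure.carrier (σ j) :=
  fun j => ultraClass U M (σ j) fun i => e i j

lemma value_ultra {ι : Type v} {σ : ι → Srt} (e : ∀ i, ∀ j, (M i).toStructure.carrier (σ j))
    {s : Srt} (t : MSTerm lang σ s) :
    (ultra U M).toStructure.value (ultraAssign U M e) t =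
      ultraClass U M s fun i => (M i).toStructure.value (e i) t := by
  induction t with
  | var j => rfl
  | app f t ih =>
    refine Eq.trans ?_ (ultraClass_fn U M f
      (fun i j => (M i).toStructure.value (e i) (t j))).symm
    exact congrArg ((ultra U M).fn f) (funext ih)

/-- Łoś's theorem. -/
theorem sat_ultra {ι : Type v} {σ : ι → Srt} (φ : MSFormula lang σ) :
    ∀ e : ∀ i, ∀ j, (M i).toStructure.carrier (σ j),
      (ultra U M).toStructure.Sat φ (ultraAssign U M e) ↔
        ∀ᶠ i in U, (M i).toStructure.Sat φ (e i) := by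
  induction φ with
  | falsum =>
    intro e
    simp only [MSStructure.Sat]
    simp [U.neBot.ne]
  | equal t₁ t₂ =>
    intro e
    simp only [MSStructure.Sat, value_ultra]
    exact ultraClass_eq_iff U M _ _ _
  | rel R t =>
    intro e
    simp only [MSStructure.Sat, value_ultra]
    exact ultraClass_rel U M R (fun i j => (M i).toStructure.value (e i) (t j))
  | imp φ ψ ih₁ ih₂ =>
    intro e
    simp only [MSStructure.Sat, ih₁, ih₂]
    exact Ultrafilter.eventually_imp.symm
  | @all ι σ s φ ih =>
    intro e
    have hext : ∀ a : ∀ i, (M i).carrier s,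
        (ultra U M).toStructure.extendAssignment (ultraAssign U M e) (ultraClass U M s a) =
          ultraAssign U M fun i => (M i).toStructure.extendAssignment (e i) (a i) := by
      intro a
      funext o
      cases o <;> rfl
    simp only [MSStructure.Sat]
    constructor
    · intro h
      by_contra hn
      rw [← Ultrafilter.eventually_not] at hn
      -- A coordinatewise counterexample wherever there is one, and an arbitrary element elsewhere;
      -- all sorts are nonempty.
      have : ∀ i, ∃ a : (M i).carrier s,
          ¬ (∀ b, (M i).toStructure.Sat φ ((M i).toStructure.extendAssignment (e i) b)) →
          ¬ (M i).toStructure.Sat φ ((M i).toStructure.extendAssignment (e i) a) := by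
        intro i
        by_cases hi : ∀ b, (M i).toStructure.Sat φ ((M i).toStructure.extendAssignment (e i) b)
        · have : Nonempty ((M i).carrier s) := by
            cases s
            · exact ⟨(0 : (M i).K)⟩
            · exact ⟨(0 : (M i).k)⟩
            · exact ⟨(0 : WithTop (M i).Γ)⟩
          exact ⟨this.some, fun h => absurd hi h⟩
        · push Not at hi
          obtain ⟨a, ha⟩ := hi
          exact ⟨a, fun _ => ha⟩
      choose a ha using this
      have h1 := h (ultraClass U M s a)
      rw [hext, ih] at h1
      obtain ⟨i, h2, h3⟩ := (h1.and hn).exists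
      exact ha i h3 h2
    · intro h b
      obtain ⟨a, rfl⟩ := ultraClass_surjective U M s b
      rw [hext, ih]
      filter_upwards [h] with i hi
      exact hi _

end Ultra

end Model

end TLoc

end

/-! ### Saturation of ultraproducts for countable sets of conditions -/

section
open Filter

namespace TLoc

/-- The diagonal argument for ℵ₁-saturation: at the index `i`, satisfy as many of the first
conditions as possible, up to the bound `N i`. Since `N` tends to infinity along the ultrafilter,
each condition is satisfied almost everywhere. -/
lemma exists_forall_eventually_mem {I : Type} {U : Ultrafilter I} {X : I → Type u} {N : I → ℕ}
    (hN : ∀ j, ∀ᶠ i in U, j ≤ N i) (E : ℕ → ∀ i, Set (X i))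
    (h : ∀ n, ∃ f : ∀ i, X i, ∀ j ≤ n, ∀ᶠ i in U, f i ∈ E j i) :
    ∃ f : ∀ i, X i, ∀ j, ∀ᶠ i in U, f i ∈ E j i := by
  classical
  obtain ⟨f₀, -⟩ := h 0
  let P : I → ℕ → Prop := fun i n => ∃ x, ∀ j ≤ n, x ∈ E j i
  have hP : ∀ n, ∀ᶠ i in U, P i n := by
    intro n
    obtain ⟨f, hf⟩ := h n
    have : ∀ᶠ i in U, ∀ j ∈ Finset.range (n + 1), f i ∈ E j i := by
      rw [Filter.eventually_all_finset]
      exact fun j hj => hf j (Nat.lt_succ_iff.1 (Finset.mem_range.1 hj))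
    filter_upwards [this] with i hi
    exact ⟨f i, fun j hj => hi j (Finset.mem_range.2 (Nat.lt_succ_of_le hj))⟩
  have hx : ∀ i, ∃ x, ∀ n ≤ N i, P i n → ∀ j ≤ n, x ∈ E j i := by
    intro i
    by_cases h0 : ∃ n ≤ N i, P i n
    · obtain ⟨n, hn, hPn⟩ := h0
      -- A point chosen for the largest `n ≤ N i` with a common solution of the conditions up to `n`
      -- also serves every smaller `n`.
      have hspec := Nat.findGreatest_spec (P := P i) hn hPn
      obtain ⟨x, hx⟩ := hspec
      refine ⟨x, fun n' hn' hP' j hj => hx j ?_⟩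
      exact hj.trans (Nat.le_findGreatest hn' hP')
    · push Not at h0
      exact ⟨f₀ i, fun n hn hPn => absurd hPn (h0 n hn)⟩
  choose f hf using hx
  refine ⟨f, fun j => ?_⟩
  filter_upwards [hN j, hP j] with i h1 h2
  exact hf i j h1 h2 j le_rfl

namespace Model

section Internal

variable {I : Type} {U : Ultrafilter I} {M : I → Model.{u}}

/-- A subset of a sort of an ultraproduct is internal if it comes from a family of subsets of the
factors. -/
def Internal {s : Srt} (E : Set ((ultra U M).carrier s)) : Prop :=
  ∃ E' : ∀ i, Set ((M i).carrier s), ∀ a, ultraClass U M s a ∈ E ↔ ∀ᶠ i in U, a i ∈ E' i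

/-- A condition may prescribe either truth value; an ultrafilter commutes with complements, so both
choices are internal. -/
lemma Internal.iff {s : Srt} {E : Set ((ultra U M).carrier s)} (h : Internal E) (p : Prop) :
    Internal {x | x ∈ E ↔ p} := by
  obtain ⟨E', hE'⟩ := h
  by_cases hp : p
  · exact ⟨E', fun a => by simp [hp, hE']⟩
  · refine ⟨fun i => (E' i)ᶜ, fun a => ?_⟩
    simp only [Set.mem_ofPred_eq, hp, iff_false, hE', Set.mem_compl_iff]
    exact Ultrafilter.eventually_not.symm

lemma exists_mem_of_internal {N : I → ℕ} (hN : ∀ j, ∀ᶠ i in U, j ≤ N i) {s : Srt} {T : Type v}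
    {P : Set T} (hP : P.Countable) (E : T → Set ((ultra U M).carrier s))
    (hE : ∀ t, Internal (E t))
    (h : ∀ F : Finset T, ↑F ⊆ P → ∃ x, ∀ t ∈ F, x ∈ E t) : ∃ x, ∀ t ∈ P, x ∈ E t := by
  classical
  rcases P.eq_empty_or_nonempty with rfl | hne
  · obtain ⟨x, -⟩ := h ∅ (by simp)
    exact ⟨x, by simp⟩
  obtain ⟨g, rfl⟩ := hP.exists_eq_range hne
  choose E' hE' using hE
  obtain ⟨f, hf⟩ := exists_forall_eventually_mem hN (fun j => E' (g j)) (by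
    intro n
    obtain ⟨x, hx⟩ := h ((Finset.range (n + 1)).image g) (by
      rw [Finset.coe_image]
      exact Set.image_subset_range _ _)
    obtain ⟨a, rfl⟩ := ultraClass_surjective U M s x
    refine ⟨a, fun j hj => (hE' _ _).1 (hx _ ?_)⟩
    exact Finset.mem_image_of_mem _ (Finset.mem_range.2 (Nat.lt_succ_of_le hj)))
  refine ⟨ultraClass U M s f, ?_⟩
  rintro _ ⟨j, rfl⟩
  exact (hE' _ _).2 (hf j)

end Internal

lemma ultraVal_sub_eq_iff {I : Type} {U : Ultrafilter I} {M : I → Model.{u}}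
    (a f : ∀ i, (M i).K) (g : ∀ i, (M i).Γ) :
    ultraVal U M (ultraMk U (fun i => (M i).K) a - ultraMk U (fun i => (M i).K) f) =
      ((ultraMkG U (fun i => (M i).Γ) g : UltraGroup U fun i => (M i).Γ) : WithTop _) ↔
      ∀ᶠ i in U, (M i).val (a i - f i) = g i := by
  rw [← map_sub, ultraVal_mk, ← ultraMkTop_of_coe (e := fun i => (g i : WithTop (M i).Γ))
    (Eventually.of_forall fun _ => rfl), ultraMkTop_eq_iff]
  rfl

lemma exists_coe_eq_ultraMkTop_iff {I : Type} {U : Ultrafilter I} {G : I → Type u}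
    [∀ i, AddCommGroup (G i)] [∀ i, LinearOrder (G i)] (b : ∀ i, G i) (n : ℤ) (t : Prop)
    (a : ∀ i, WithTop (G i)) :
    (∃ δ : UltraGroup U G, (δ : WithTop (UltraGroup U G)) = ultraMkTop G U a ∧
      (0 < ultraMkG U G b + n • δ ↔ t)) ↔
      ∀ᶠ i in U, ∃ g : G i, (g : WithTop (G i)) = a i ∧ (0 < b i + n • g ↔ t) := by
  rcases eventually_top_or_coe U a with ha | ⟨g, hg⟩
  · rw [ultraMkTop_of_top ha]
    constructor
    · rintro ⟨δ, hδ, -⟩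
      exact absurd hδ WithTop.coe_ne_top
    · intro h'
      obtain ⟨i, h1, g, h2, -⟩ := (ha.and h').exists
      exact absurd (h2.trans h1) WithTop.coe_ne_top
  · rw [ultraMkTop_of_coe hg]
    have e2 : (∀ᶠ i in U, ∃ g : G i, (g : WithTop (G i)) = a i ∧ (0 < b i + n • g ↔ t)) ↔
        ∀ᶠ i in U, (0 < b i + n • g i ↔ t) := by
      refine eventually_congr ?_
      filter_upwards [hg] with i hi
      simp only [hi, WithTop.coe_inj, exists_eq_left]
    have e3 : (0 < ultraMkG U G b + n • ultraMkG U G g) ↔ ∀ᶠ i in U, 0 < b i + n • g i := by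
      rw [← map_zsmul, ← map_add, ← map_zero (ultraMkG U _), ultraMkG_lt_iff]
      rfl
    simp only [e2, WithTop.coe_inj, exists_eq_left, e3]
    by_cases ht : t
    · simp [ht]
    · simp only [ht, iff_false]
      exact Ultrafilter.eventually_not.symm

/-- The consequences of `ℵ₁`-saturation that are used to extend partial isomorphisms. -/
structure Saturated (N : Model.{u}) : Prop where
  resField : ∀ P : Set (Polynomial N.k × Prop), P.Countable →
    (∀ F : Finset (Polynomial N.k × Prop), ↑F ⊆ P → ∃ d : N.k, ∀ p ∈ F, p.1.eval d = 0 ↔ p.2) →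
    ∃ d : N.k, ∀ p ∈ P, p.1.eval d = 0 ↔ p.2
  valueGroup : ∀ P : Set (ℤ × N.Γ × Prop), P.Countable →
    (∀ F : Finset (ℤ × N.Γ × Prop), ↑F ⊆ P →
      ∃ δ : N.Γ, ∀ p ∈ F, 0 < p.2.1 + p.1 • δ ↔ p.2.2) →
    ∃ δ : N.Γ, ∀ p ∈ P, 0 < p.2.1 + p.1 • δ ↔ p.2.2
  field : ∀ (m : Polynomial N.K) (P : Set (N.K × N.Γ)), P.Countable →
    (∀ F : Finset (N.K × N.Γ), ↑F ⊆ P →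
      ∃ y : N.K, m.eval y = 0 ∧ ∀ p ∈ F, N.val (y - p.1) = p.2) →
    ∃ y : N.K, m.eval y = 0 ∧ ∀ p ∈ P, N.val (y - p.1) = p.2

lemma eval_map_ultraMk_eq_zero_iff {I : Type} {U : Ultrafilter I} {R : I → Type u}
    [∀ i, CommRing (R i)] (P : Polynomial (∀ i, R i)) (f : ∀ i, R i) :
    (P.map (ultraMk U R)).eval (ultraMk U R f) = 0 ↔
      ∀ᶠ i in U, (P.map (Pi.evalRingHom R i)).eval (f i) = 0 := by
  rw [eval_ultraMk, ultraMk_eq_zero_iff]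

lemma exists_map_ultraMk_eq {I : Type} {U : Ultrafilter I} {R : I → Type u} [∀ i, CommRing (R i)]
    (p : Polynomial (UltraRing U R)) : ∃ P : Polynomial (∀ i, R i), P.map (ultraMk U R) = p := by
  have hl : p ∈ Polynomial.lifts (ultraMk U R) := by
    rw [Polynomial.lifts_iff_coeff_lifts]
    exact fun n => ultraMk_surjective _
  exact (Polynomial.mem_lifts _).1 hl

theorem ultra_saturated {I : Type} {U : Ultrafilter I} (M : I → Model.{u}) {N : I → ℕ}
    (hN : ∀ j, ∀ᶠ i in U, j ≤ N i) : (ultra U M).Saturated where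
  resField P hP h := by
    refine exists_mem_of_internal (U := U) (M := M) (s := .k) hN hP
      (fun p => {d : (ultra U M).k | p.1.eval d = 0 ↔ p.2}) (fun p => ?_) h
    refine Internal.iff (U := U) (M := M) (s := .k) (E := {d : (ultra U M).k | p.1.eval d = 0}) ?_ _
    obtain ⟨Q, hQ⟩ := exists_map_ultraMk_eq (U := U) (R := fun i => (M i).k) p.1
    refine ⟨fun i => {d : (M i).k | (Q.map (Pi.evalRingHom (fun i => (M i).k) i)).eval d = 0},
      fun a => ?_⟩
    change Polynomial.eval (ultraMk U (fun i => (M i).k) a) p.1 = 0 ↔ _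
    rw [← hQ]
    exact eval_map_ultraMk_eq_zero_iff Q _
  valueGroup P hP h := by
    -- The sort `Γ` contains `∞`. Any single condition excludes it, so only the empty set of
    -- conditions needs separate treatment.
    rcases P.eq_empty_or_nonempty with rfl | ⟨p₀, hp₀⟩
    · exact ⟨0, by simp⟩
    let E : ℤ × (ultra U M).Γ × Prop → Set ((ultra U M).carrier .Γ) :=
      fun p => {d : WithTop (ultra U M).Γ | ∃ δ : (ultra U M).Γ,
        (δ : WithTop (ultra U M).Γ) = d ∧ (0 < p.2.1 + p.1 • δ ↔ p.2.2)}
    suffices hs : ∃ x, ∀ p ∈ P, x ∈ E p by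
      obtain ⟨x, hx⟩ := hs
      obtain ⟨δ, rfl, -⟩ := hx _ hp₀
      refine ⟨δ, fun p hp => ?_⟩
      obtain ⟨δ', h1, h2⟩ := hx p hp
      rwa [WithTop.coe_inj.1 h1] at h2
    refine exists_mem_of_internal hN hP E (fun p => ?_) ?_
    · obtain ⟨n, β, t⟩ := p
      obtain ⟨b, rfl⟩ := ultraMkG_surjective (U := U) (G := fun i => (M i).Γ) β
      exact ⟨fun i => {d : WithTop (M i).Γ | ∃ g : (M i).Γ, (g : WithTop (M i).Γ) = d ∧
        (0 < b i + n • g ↔ t)}, fun a =>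
          exists_coe_eq_ultraMkTop_iff (G := fun i => (M i).Γ) b n t a⟩
    · intro F hF
      obtain ⟨δ, hδ⟩ := h F hF
      exact ⟨(δ : WithTop (ultra U M).Γ), fun p hp => ⟨δ, rfl, hδ p hp⟩⟩
  field m P hP h := by
    -- The index `none` carries the polynomial equation, so that it is one more condition among the
    -- countably many.
    let E : Option ((ultra U M).K × (ultra U M).Γ) → Set ((ultra U M).carrier .VF) :=
      fun o => o.elim {y : (ultra U M).K | m.eval y = 0}
        (fun p => {y : (ultra U M).K | (ultra U M).val (y - p.1) = p.2})
    suffices hs : ∃ y, ∀ o ∈ insert none (some '' P), y ∈ E o by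
      obtain ⟨y, hy⟩ := hs
      refine ⟨y, hy none (Set.mem_insert _ _), fun p hp => ?_⟩
      exact hy (some p) (Set.mem_insert_of_mem _ (Set.mem_image_of_mem _ hp))
    refine exists_mem_of_internal hN ((hP.image _).insert _) E (fun o => ?_) ?_
    · rcases o with _ | ⟨a, γ⟩
      · obtain ⟨Q, hQ⟩ := exists_map_ultraMk_eq (U := U) (R := fun i => (M i).K) m
        refine ⟨fun i => {d : (M i).K | (Q.map (Pi.evalRingHom (fun i => (M i).K) i)).eval d = 0},
          fun a => ?_⟩
        change Polynomial.eval (ultraMk U (fun i => (M i).K) a) m = 0 ↔ _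
        rw [← hQ]
        exact eval_map_ultraMk_eq_zero_iff Q _
      · obtain ⟨f, rfl⟩ := ultraMk_surjective (U := U) (R := fun i => (M i).K) a
        obtain ⟨g, rfl⟩ := ultraMkG_surjective (U := U) (G := fun i => (M i).Γ) γ
        exact ⟨fun i => {d : (M i).K | (M i).val (d - f i) = g i}, fun a =>
          ultraVal_sub_eq_iff a f g⟩
    · classical
      intro F hF
      obtain ⟨y, hy, hy'⟩ := h (Finset.eraseNone F) (by
        intro p hp
        simp only [Finset.mem_coe, Finset.mem_eraseNone] at hp
        have := hF hp
        simpa using this)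
      refine ⟨y, fun o ho => ?_⟩
      rcases o with _ | p
      · exact hy
      · exact hy' p (Finset.mem_eraseNone.2 ho)

end Model

end TLoc

end

/-! ### Partial isomorphisms as graphs -/

section

namespace TLoc

section GTop

variable {A B : Type*} [AddCommGroup A] [LinearOrder A] [IsOrderedAddMonoid A] [AddCommGroup B]
  [LinearOrder B] [IsOrderedAddMonoid B]

/-- The correspondence given by a group of pairs, extended by `∞ ↦ ∞`. -/
def GTop (G : AddSubgroup (A × B)) (v : WithTop A) (w : WithTop B) : Prop :=
  (v = ⊤ ∧ w = ⊤) ∨ ∃ p ∈ G, v = (p.1 : A) ∧ w = (p.2 : B)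

variable {G : AddSubgroup (A × B)} {v v' : WithTop A} {w w' : WithTop B}

lemma GTop.top : GTop G ⊤ ⊤ := Or.inl ⟨rfl, rfl⟩

lemma GTop.coe {p : A × B} (hp : p ∈ G) : GTop G p.1 p.2 := Or.inr ⟨p, hp, rfl, rfl⟩

lemma GTop.zero : GTop G 0 0 := GTop.coe G.zero_mem

lemma GTop.mono {G' : AddSubgroup (A × B)} (hG : G ≤ G') (h : GTop G v w) : GTop G' v w := by
  rcases h with h | ⟨p, hp, h⟩
  exacts [Or.inl h, Or.inr ⟨p, hG hp, h⟩]

lemma GTop.add (h : GTop G v w) (h' : GTop G v' w') : GTop G (v + v') (w + w') := by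
  rcases h with ⟨rfl, rfl⟩ | ⟨p, hp, rfl, rfl⟩
  · simpa using GTop.top
  · rcases h' with ⟨rfl, rfl⟩ | ⟨q, hq, rfl, rfl⟩
    · simpa using GTop.top
    · exact GTop.coe (G.add_mem hp hq)

lemma GTop.nsmul (h : GTop G v w) (n : ℕ) : GTop G (n • v) (n • w) := by
  induction n with
  | zero => simpa using GTop.zero
  | succ n ih => simpa only [succ_nsmul] using ih.add h

lemma GTop.neg (h : GTop G v w) : GTop G (-v) (-w) := by
  rcases h with ⟨rfl, rfl⟩ | ⟨p, hp, rfl, rfl⟩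
  · exact GTop.top
  · exact GTop.coe (G.neg_mem hp)

variable (hG : ∀ p ∈ G, 0 < p.1 ↔ 0 < p.2)
include hG

lemma GTop.lt_iff (h : GTop G v w) (h' : GTop G v' w') : v < v' ↔ w < w' := by
  rcases h with ⟨rfl, rfl⟩ | ⟨p, hp, rfl, rfl⟩
  · simp
  · rcases h' with ⟨rfl, rfl⟩ | ⟨q, hq, rfl, rfl⟩
    · simp
    · have := hG _ (G.sub_mem hq hp)
      simpa using this

lemma GTop.le_iff (h : GTop G v w) (h' : GTop G v' w') : v ≤ v' ↔ w ≤ w' := by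
  rw [← not_lt, ← not_lt, h'.lt_iff hG h]

lemma GTop.eq_iff (h : GTop G v w) (h' : GTop G v' w') : v = v' ↔ w = w' := by
  rw [le_antisymm_iff, le_antisymm_iff, h.le_iff hG h', h'.le_iff hG h]

end GTop

/-- A partial isomorphism between models, given by its graph in each sort. -/
structure PIso (M N : Model.{u}) where
  R : Subring (M.K × N.K)
  D : Subring (M.k × N.k)
  G : AddSubgroup (M.Γ × N.Γ)
  one_mem : (M.one, N.one) ∈ G
  pos_iff : ∀ p ∈ G, 0 < p.1 ↔ 0 < p.2
  val_mem : ∀ p ∈ R, GTop G (M.val p.1) (N.val p.2)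
  sec_mem : ∀ p ∈ D, (M.sec p.1, N.sec p.2) ∈ R
  resDiv_mem : ∀ p ∈ R, ∀ q ∈ R, (M.resDiv p.1 q.1, N.resDiv p.2 q.2) ∈ D

namespace PIso

variable {M N : Model.{u}} (P : PIso M N)

/-- The value `∞` corresponds only to `∞`. Applied to differences, this shows that the subring `R`
is the graph of an injective map. -/
lemma fst_eq_zero_iff {p : M.K × N.K} (hp : p ∈ P.R) : p.1 = 0 ↔ p.2 = 0 := by
  rw [← M.val_eq_top_iff, ← N.val_eq_top_iff]
  exact (P.val_mem p hp).eq_iff P.pos_iff GTop.top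

lemma fst_eq_zero_iff_D {p : M.k × N.k} (hp : p ∈ P.D) : p.1 = 0 ↔ p.2 = 0 := by
  have := P.fst_eq_zero_iff (P.sec_mem p hp)
  simpa using this

/-- The inverse of `c` is the residue of `1 / sec c`, so the residues form a field although `D` is
only required to be a subring. -/
lemma inv_mem_D {p : M.k × N.k} (hp : p ∈ P.D) : (p.1⁻¹, p.2⁻¹) ∈ P.D := by
  have := P.resDiv_mem _ P.R.one_mem _ (P.sec_mem p hp)
  simp only [Prod.fst_one, Prod.snd_one] at this
  rw [← map_one M.sec, ← map_one N.sec, M.resDiv_sec, N.resDiv_sec, one_mul, one_mul] at this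
  exact this

lemma inv_mem_D' (p : M.k × N.k) (hp : p ∈ P.D) : p⁻¹ ∈ P.D := P.inv_mem_D hp

/-- The correspondence between elements of a sort given by a partial isomorphism. -/
def rel : (s : Srt) → M.carrier s → N.carrier s → Prop
  | .VF => fun x y => ((x, y) : M.K × N.K) ∈ P.R
  | .k => fun x y => ((x, y) : M.k × N.k) ∈ P.D
  | .Γ => fun x y => GTop P.G x y

lemma rel_fn {l : List Srt} {s : Srt} (f : Fn l s) (a : ∀ j : Fin l.length, M.carrier (l.get j))
    (b : ∀ j : Fin l.length, N.carrier (l.get j)) (h : ∀ j, P.rel (l.get j) (a j) (b j)) :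
    P.rel s (M.fn f a) (N.fn f b) := by
  cases f with
  | vfZero => exact P.R.zero_mem
  | vfOne => exact P.R.one_mem
  | vfNeg => exact P.R.neg_mem (h 0)
  | vfAdd => exact P.R.add_mem (h 0) (h 1)
  | vfMul => exact P.R.mul_mem (h 0) (h 1)
  | kZero => exact P.D.zero_mem
  | kOne => exact P.D.one_mem
  | kNeg => exact P.D.neg_mem (h 0)
  | kAdd => exact P.D.add_mem (h 0) (h 1)
  | kMul => exact P.D.mul_mem (h 0) (h 1)
  | gZero => exact GTop.zero
  | gOne => exact GTop.coe P.one_mem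
  | gNeg => exact GTop.neg (h 0)
  | gAdd => exact GTop.add (h 0) (h 1)
  | val => exact P.val_mem _ (h 0)
  | resDiv => exact P.resDiv_mem _ (h 0) _ (h 1)
  | sec => exact P.sec_mem _ (h 0)

lemma rel_value {ι : Type v} {σ : ι → Srt} {e : ∀ i, M.toStructure.carrier (σ i)}
    {e' : ∀ i, N.toStructure.carrier (σ i)} (h : ∀ i, P.rel (σ i) (e i) (e' i)) {s : Srt}
    (t : MSTerm lang σ s) : P.rel s (M.toStructure.value e t) (N.toStructure.value e' t) := by
  induction t with
  | var i => exact h i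
  | app f t ih => exact P.rel_fn f _ _ ih

lemma rel_eq_iff {s : Srt} {a a' : M.carrier s} {b b' : N.carrier s} (h : P.rel s a b)
    (h' : P.rel s a' b') : a = a' ↔ b = b' := by
  cases s with
  | VF =>
    have := P.fst_eq_zero_iff (P.R.sub_mem h h')
    exact (@sub_eq_zero M.K _ a a').symm.trans (this.trans (@sub_eq_zero N.K _ b b'))
  | k =>
    have := P.fst_eq_zero_iff_D (P.D.sub_mem h h')
    exact (@sub_eq_zero M.k _ a a').symm.trans (this.trans (@sub_eq_zero N.k _ b b'))
  | Γ => exact GTop.eq_iff P.pos_iff h h'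

/-- Partial isomorphisms preserve the truth of quantifier-free formulas. -/
theorem sat_iff {ι : Type v} {σ : ι → Srt} (φ : MSFormula lang σ) (hφ : φ.IsQuantifierFree)
    {e : ∀ i, M.toStructure.carrier (σ i)} {e' : ∀ i, N.toStructure.carrier (σ i)}
    (h : ∀ i, P.rel (σ i) (e i) (e' i)) : M.toStructure.Sat φ e ↔ N.toStructure.Sat φ e' := by
  induction φ with
  | falsum => exact Iff.rfl
  | equal t₁ t₂ => exact P.rel_eq_iff (P.rel_value h t₁) (P.rel_value h t₂)
  | rel R t =>
    cases R with
    | lt => exact GTop.lt_iff P.pos_iff (P.rel_value h (t 0)) (P.rel_value h (t 1))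
  | imp φ ψ ih₁ ih₂ => exact imp_congr (ih₁ hφ.1 h) (ih₂ hφ.2 h)
  | all => exact hφ.elim

/-- Extension of partial isomorphisms. -/
instance : Preorder (PIso M N) where
  le P Q := P.R ≤ Q.R ∧ P.D ≤ Q.D ∧ P.G ≤ Q.G
  le_refl P := ⟨le_rfl, le_rfl, le_rfl⟩
  le_trans P Q S h h' := ⟨h.1.trans h'.1, h.2.1.trans h'.2.1, h.2.2.trans h'.2.2⟩

lemma rel_mono {P Q : PIso M N} (h : P ≤ Q) {s : Srt} {a : M.carrier s} {b : N.carrier s}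
    (hab : P.rel s a b) : Q.rel s a b := by
  cases s with
  | VF => exact h.1 hab
  | k => exact h.2.1 hab
  | Γ => exact GTop.mono h.2.2 hab

/-- The union of a nonempty chain of partial isomorphisms. -/
noncomputable def chainUnion (c : Set (PIso M N)) (hc : IsChain (· ≤ ·) c) (hne : c.Nonempty) :
    PIso M N :=
  have hne' : Nonempty c := hne.to_subtype
  have hR : Directed (· ≤ ·) fun P : c => P.1.R := fun P Q => by
    rcases hc.total P.2 Q.2 with h | h
    exacts [⟨Q, h.1, le_rfl⟩, ⟨P, le_rfl, h.1⟩]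
  have hD : Directed (· ≤ ·) fun P : c => P.1.D := fun P Q => by
    rcases hc.total P.2 Q.2 with h | h
    exacts [⟨Q, h.2.1, le_rfl⟩, ⟨P, le_rfl, h.2.1⟩]
  have hG : Directed (· ≤ ·) fun P : c => P.1.G := fun P Q => by
    rcases hc.total P.2 Q.2 with h | h
    exacts [⟨Q, h.2.2, le_rfl⟩, ⟨P, le_rfl, h.2.2⟩]
  { R := ⨆ P : c, P.1.R
    D := ⨆ P : c, P.1.D
    G := ⨆ P : c, P.1.G
    one_mem := (AddSubgroup.mem_iSup_of_directed hG).2 ⟨⟨_, hne.some_mem⟩, PIso.one_mem _⟩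
    pos_iff := fun p hp => by
      obtain ⟨P, hP⟩ := (AddSubgroup.mem_iSup_of_directed hG).1 hp
      exact P.1.pos_iff p hP
    val_mem := fun p hp => by
      obtain ⟨P, hP⟩ := (Subring.mem_iSup_of_directed hR).1 hp
      exact (P.1.val_mem p hP).mono (le_iSup (fun P : c => P.1.G) P)
    sec_mem := fun p hp => by
      obtain ⟨P, hP⟩ := (Subring.mem_iSup_of_directed hD).1 hp
      exact (le_iSup (fun P : c => P.1.R) P) (P.1.sec_mem p hP)
    resDiv_mem := fun p hp q hq => by
      obtain ⟨P, hP⟩ := (Subring.mem_iSup_of_directed hR).1 hp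
      obtain ⟨Q, hQ⟩ := (Subring.mem_iSup_of_directed hR).1 hq
      obtain ⟨S, hS, hS'⟩ := hR P Q
      exact (le_iSup (fun P : c => P.1.D) S) (S.1.resDiv_mem p (hS hP) q (hS' hQ)) }

lemma le_chainUnion (c : Set (PIso M N)) (hc : IsChain (· ≤ ·) c) (hne : c.Nonempty)
    {P : PIso M N} (hP : P ∈ c) : P ≤ chainUnion c hc hne :=
  ⟨le_iSup (fun P : c => P.1.R) ⟨P, hP⟩, le_iSup (fun P : c => P.1.D) ⟨P, hP⟩,
    le_iSup (fun P : c => P.1.G) ⟨P, hP⟩⟩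

/-- The domain of a partial isomorphism is contained in the substructure given by a subfield. -/
structure DomLE (P : PIso M N) (E : Subfield M.K) : Prop where
  field : ∀ p ∈ P.R, p.1 ∈ E
  resField : ∀ p ∈ P.D, M.sec p.1 ∈ E
  valueGroup : ∀ p ∈ P.G, ∃ x ∈ E, M.val x = (p.1 : M.Γ)

lemma chainUnion_domLE (c : Set (PIso M N)) (hc : IsChain (· ≤ ·) c) (hne : c.Nonempty)
    {E : Subfield M.K} (h : ∀ P ∈ c, P.DomLE E) : (chainUnion c hc hne).DomLE E := by
  have hne' : Nonempty c := hne.to_subtype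
  have hR : Directed (· ≤ ·) fun P : c => P.1.R := fun P Q => by
    rcases hc.total P.2 Q.2 with h | h
    exacts [⟨Q, h.1, le_rfl⟩, ⟨P, le_rfl, h.1⟩]
  have hD : Directed (· ≤ ·) fun P : c => P.1.D := fun P Q => by
    rcases hc.total P.2 Q.2 with h | h
    exacts [⟨Q, h.2.1, le_rfl⟩, ⟨P, le_rfl, h.2.1⟩]
  have hG : Directed (· ≤ ·) fun P : c => P.1.G := fun P Q => by
    rcases hc.total P.2 Q.2 with h | h
    exacts [⟨Q, h.2.2, le_rfl⟩, ⟨P, le_rfl, h.2.2⟩]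
  constructor
  · intro p hp
    obtain ⟨P, hP⟩ := (Subring.mem_iSup_of_directed hR).1 hp
    exact (h P.1 P.2).field p hP
  · intro p hp
    obtain ⟨P, hP⟩ := (Subring.mem_iSup_of_directed hD).1 hp
    exact (h P.1 P.2).resField p hP
  · intro p hp
    obtain ⟨P, hP⟩ := (AddSubgroup.mem_iSup_of_directed hG).1 hp
    exact (h P.1 P.2).valueGroup p hP

lemma exists_le_maximal {P : PIso M N} {E : Subfield M.K} (hP : P.DomLE E) :
    ∃ Q : PIso M N, P ≤ Q ∧ Maximal (fun S : PIso M N => S.DomLE E) Q := by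
  obtain ⟨Q, hPQ, hQ⟩ := zorn_le_nonempty₀ {S : PIso M N | S.DomLE E} (fun c hcs hc Q hQ =>
    ⟨chainUnion c hc ⟨Q, hQ⟩, chainUnion_domLE c hc ⟨Q, hQ⟩ fun S hS => hcs hS,
      fun S hS => le_chainUnion c hc ⟨Q, hQ⟩ hS⟩) P hP
  exact ⟨Q, hPQ, hQ⟩

section Countable

variable {P} {E : Subfield M.K}

/-- A graph is determined by its first coordinates. Countability of the three graphs is what permits
the use of saturation in the target. -/
lemma countable_R (hE : (E : Set M.K).Countable) (h : P.DomLE E) :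
    (P.R : Set (M.K × N.K)).Countable := by
  refine Set.countable_of_injective_of_countable_image (f := Prod.fst) ?_
    (hE.mono (by rintro _ ⟨p, hp, rfl⟩; exact h.field p hp))
  intro p hp q hq hpq
  refine Prod.ext hpq ?_
  exact (P.rel_eq_iff (s := .VF) hp hq).1 hpq

lemma countable_D (hE : (E : Set M.K).Countable) (h : P.DomLE E) :
    (P.D : Set (M.k × N.k)).Countable := by
  refine Set.countable_of_injective_of_countable_image (f := fun p => M.sec p.1) ?_
    (hE.mono (by rintro _ ⟨p, hp, rfl⟩; exact h.resField p hp))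
  intro p hp q hq hpq
  have hpq' : p.1 = q.1 := M.sec.injective hpq
  refine Prod.ext hpq' ?_
  exact (P.rel_eq_iff (s := .k) hp hq).1 hpq'

lemma countable_G (hE : (E : Set M.K).Countable) (h : P.DomLE E) :
    (P.G : Set (M.Γ × N.Γ)).Countable := by
  refine Set.countable_of_injective_of_countable_image (f := fun p => (p.1 : WithTop M.Γ)) ?_
    ((hE.image M.val).mono (by
      rintro _ ⟨p, hp, rfl⟩
      obtain ⟨x, hx, hx'⟩ := h.valueGroup p hp
      exact ⟨x, hx, hx'⟩))
  intro p hp q hq hpq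
  have hpq' : p.1 = q.1 := WithTop.coe_inj.1 hpq
  refine Prod.ext hpq' (WithTop.coe_inj.1 ?_)
  exact (P.rel_eq_iff (s := .Γ) (GTop.coe hp) (GTop.coe hq)).1 hpq

end Countable

end PIso

end TLoc

end

/-! ### Extending by values and closing under division -/

section

namespace TLoc

section Cut

variable {A B : Type*} [AddCommGroup A] [LinearOrder A] [IsOrderedAddMonoid A] [AddCommGroup B]
  [LinearOrder B] [IsOrderedAddMonoid B] {G : AddSubgroup (A × B)}
  (hG : ∀ p ∈ G, 0 < p.1 ↔ 0 < p.2)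
include hG

lemma fst_lt_iff_of_pos_iff {p q : A × B} (hp : p ∈ G) (hq : q ∈ G) : p.1 < q.1 ↔ p.2 < q.2 := by
  simpa using hG _ (G.sub_mem hq hp)

/-- Either `γ` occurs in `T` and its partner works, or density without endpoints gives an element
between the images of the lower and the upper part. -/
lemma exists_same_cut [DenselyOrdered B] [Nontrivial B] (T : Finset (A × B)) (hT : ∀ p ∈ T, p ∈ G)
    (γ : A) : ∃ δ : B, ∀ p ∈ T, (p.1 < γ ↔ p.2 < δ) ∧ (γ < p.1 ↔ δ < p.2) := by
  classical
  by_cases h : ∃ p ∈ T, p.1 = γ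
  · obtain ⟨q, hq, rfl⟩ := h
    exact ⟨q.2, fun p hp => ⟨fst_lt_iff_of_pos_iff hG (hT p hp) (hT q hq),
      fst_lt_iff_of_pos_iff hG (hT q hq) (hT p hp)⟩⟩
  · push Not at h
    obtain ⟨δ, h1, h2⟩ := Order.exists_between_finsets ((T.filter fun p => p.1 < γ).image Prod.snd)
      ((T.filter fun p => γ < p.1).image Prod.snd) (by
        intro x hx y hy
        obtain ⟨p, hp, rfl⟩ := Finset.mem_image.1 hx
        obtain ⟨q, hq, rfl⟩ := Finset.mem_image.1 hy
        rw [Finset.mem_filter] at hp hq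
        exact (fst_lt_iff_of_pos_iff hG (hT p hp.1) (hT q hq.1)).1 (hp.2.trans hq.2))
    refine ⟨δ, fun p hp => ?_⟩
    rcases lt_or_gt_of_ne (h p hp) with hlt | hlt
    · have := h1 p.2 (Finset.mem_image_of_mem _ (Finset.mem_filter.2 ⟨hp, hlt⟩))
      exact ⟨iff_of_true hlt this, iff_of_false hlt.not_gt this.not_gt⟩
    · have := h2 p.2 (Finset.mem_image_of_mem _ (Finset.mem_filter.2 ⟨hp, hlt⟩))
      exact ⟨iff_of_false hlt.not_gt this.not_gt, iff_of_true hlt this⟩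

end Cut

/-- The fractions with numerator and denominator in a ring of pairs. -/
def fractionSubring {K L : Type*} [Field K] [Field L] (R : Subring (K × L))
    (h : ∀ z ∈ R, z.1 = 0 ↔ z.2 = 0) : Subring (K × L) where
  carrier := {z | ∃ a ∈ R, ∃ b ∈ R, b.1 ≠ 0 ∧ z = a / b}
  mul_mem' := by
    rintro _ _ ⟨a, ha, b, hb, hb0, rfl⟩ ⟨a', ha', b', hb', hb0', rfl⟩
    exact ⟨a * a', R.mul_mem ha ha', b * b', R.mul_mem hb hb', mul_ne_zero hb0 hb0',
      Prod.ext (div_mul_div_comm _ _ _ _) (div_mul_div_comm _ _ _ _)⟩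
  one_mem' := ⟨1, R.one_mem, 1, R.one_mem, one_ne_zero,
    Prod.ext (div_one (1 : K)).symm (div_one (1 : L)).symm⟩
  add_mem' := by
    rintro _ _ ⟨a, ha, b, hb, hb0, rfl⟩ ⟨a', ha', b', hb', hb0', rfl⟩
    exact ⟨a * b' + b * a', R.add_mem (R.mul_mem ha hb') (R.mul_mem hb ha'), b * b',
      R.mul_mem hb hb', mul_ne_zero hb0 hb0', Prod.ext (div_add_div _ _ hb0 hb0')
        (div_add_div _ _ (mt (h b hb).2 hb0) (mt (h b' hb').2 hb0'))⟩
  zero_mem' := ⟨0, R.zero_mem, 1, R.one_mem, one_ne_zero,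
    Prod.ext (zero_div (1 : K)).symm (zero_div (1 : L)).symm⟩
  neg_mem' := by
    rintro _ ⟨a, ha, b, hb, hb0, rfl⟩
    exact ⟨-a, R.neg_mem ha, b, hb, hb0, Prod.ext (neg_div _ _).symm (neg_div _ _).symm⟩

lemma le_fractionSubring {K L : Type*} [Field K] [Field L] (R : Subring (K × L))
    (h : ∀ z ∈ R, z.1 = 0 ↔ z.2 = 0) : R ≤ fractionSubring R h :=
  fun a ha => ⟨a, ha, 1, R.one_mem, one_ne_zero, Prod.ext (div_one _).symm (div_one _).symm⟩

lemma inv_mem_fractionSubring {K L : Type*} [Field K] [Field L] {R : Subring (K × L)}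
    {h : ∀ z ∈ R, z.1 = 0 ↔ z.2 = 0} {z : K × L} (hz : z ∈ fractionSubring R h) :
    z⁻¹ ∈ fractionSubring R h := by
  obtain ⟨a, ha, b, hb, hb0, rfl⟩ := hz
  by_cases h0 : a.1 = 0
  · have h0' : a.2 = 0 := (h a ha).1 h0
    rw [show (a / b)⁻¹ = 0 from Prod.ext (by simp [h0]) (by simp [h0'])]
    exact zero_mem _
  · exact ⟨b, hb, a, ha, h0, Prod.ext (inv_div _ _) (inv_div _ _)⟩

lemma fst_eq_zero_iff_fractionSubring {K L : Type*} [Field K] [Field L] {R : Subring (K × L)}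
    {h : ∀ z ∈ R, z.1 = 0 ↔ z.2 = 0} {z : K × L} (hz : z ∈ fractionSubring R h) :
    z.1 = 0 ↔ z.2 = 0 := by
  obtain ⟨a, ha, b, hb, hb0, rfl⟩ := hz
  have hb0' := mt (h b hb).2 hb0
  have := h a ha
  simp [hb0, hb0', this]

namespace PIso

variable {M N : Model.{u}} (P : PIso M N)

/-- Finitely many conditions can be multiplied to have the same coefficient, up to sign, of `γ`;
they then describe a cut for one multiple of `γ`. The cut is realised by density, the realisation is
divided by that coefficient, and saturation handles all conditions together. -/
lemma exists_matching_value (hN : N.Saturated) (hP : (P.G : Set (M.Γ × N.Γ)).Countable)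
    (γ : M.Γ) : ∃ δ : N.Γ, ∀ p ∈ P.G, ∀ n : ℤ, 0 < p.1 + n • γ ↔ 0 < p.2 + n • δ := by
  classical
  let S : Set (ℤ × N.Γ × Prop) :=
    (fun q : (M.Γ × N.Γ) × ℤ => (q.2, q.1.2, 0 < q.1.1 + q.2 • γ)) '' ((P.G : Set _) ×ˢ Set.univ)
  have hS : S.Countable := (hP.prod Set.countable_univ).image _
  obtain ⟨δ, hδ⟩ := hN.valueGroup S hS (by
    intro F hF
    have : ∀ q : ℤ × N.Γ × Prop, ∃ α : M.Γ, q ∈ F → (α, q.2.1) ∈ P.G ∧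
        (q.2.2 ↔ 0 < α + q.1 • γ) := by
      intro q
      by_cases hq : q ∈ F
      · obtain ⟨⟨p, n⟩, hp, rfl⟩ := hF hq
        exact ⟨p.1, fun _ => ⟨hp.1, Iff.rfl⟩⟩
      · exact ⟨0, fun h => absurd h hq⟩
    choose α hα using this
    -- A zero coefficient is replaced by `1`, so that the product `n₀` is nonzero and division by it
    -- is possible.
    let c : ℤ × N.Γ × Prop → ℕ := fun q => if q.1 = 0 then 1 else q.1.natAbs
    have hc0 : ∀ q, c q ≠ 0 := by
      intro q
      by_cases h : q.1 = 0 <;> simp [c, h]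
    let n₀ : ℕ := ∏ q ∈ F, c q
    have hn₀ : n₀ ≠ 0 := Finset.prod_ne_zero_iff.2 fun q _ => hc0 q
    let d : ℤ × N.Γ × Prop → ℕ := fun q => ∏ q' ∈ F.erase q, c q'
    have hd0 : ∀ q, d q ≠ 0 := fun q => Finset.prod_ne_zero_iff.2 fun q' _ => hc0 q'
    have hd : ∀ q ∈ F, d q * c q = n₀ := fun q hq => Finset.prod_erase_mul F c hq
    have := N.denselyOrdered
    -- A positive coefficient bounds `n₀ • γ` from below by `-(d q • α q)`, a negative one from
    -- above by `d q • α q`; hence both signs are included.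
    obtain ⟨δ', hδ'⟩ := exists_same_cut P.pos_iff
      (F.image (fun q => (d q • α q, d q • q.2.1)) ∪ F.image fun q => (-(d q • α q), -(d q • q.2.1)))
      (by
        intro p hp
        rw [Finset.mem_union, Finset.mem_image, Finset.mem_image] at hp
        rcases hp with ⟨q, hq, rfl⟩ | ⟨q, hq, rfl⟩
        · exact P.G.nsmul_mem (hα q hq).1 (d q)
        · exact P.G.neg_mem (P.G.nsmul_mem (hα q hq).1 (d q))) (n₀ • γ)
    obtain ⟨δ, rfl⟩ := N.exists_nsmul_eq δ' hn₀
    refine ⟨δ, fun q hq => ?_⟩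
    rw [(hα q hq).2]
    have hpos : ∀ {C : Type u} [AddCommGroup C] [LinearOrder C] [IsOrderedAddMonoid C] (x : C),
        0 < x ↔ 0 < d q • x := fun x => (nsmul_pos_iff (hd0 q)).symm
    rw [hpos (α q + _), hpos (q.2.1 + _), nsmul_add, nsmul_add]
    rcases lt_trichotomy q.1 0 with hneg | hzero | hpos'
    · have hcq : (c q : ℤ) = -q.1 := by simp [c, hneg.ne]; omega
      have key : ∀ {C : Type u} [AddCommGroup C] (x : C), d q • q.1 • x = -(n₀ • x) := by
        intro C _ x
        rw [← natCast_zsmul, ← natCast_zsmul, ← neg_zsmul, smul_smul, ← hd q hq]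
        push_cast
        rw [hcq]
        ring_nf
      have h2 := (hδ' _ (Finset.mem_union_left _ (Finset.mem_image_of_mem _ hq))).2
      simp only at h2
      rw [key, key, ← sub_eq_add_neg, ← sub_eq_add_neg, sub_pos, sub_pos, h2]
    · have := P.pos_iff _ (P.G.nsmul_mem (hα q hq).1 (d q))
      simpa [hzero] using this.symm
    · have hcq : (c q : ℤ) = q.1 := by simp [c, hpos'.ne']; omega
      have key : ∀ {C : Type u} [AddCommGroup C] (x : C), d q • q.1 • x = n₀ • x := by
        intro C _ x
        rw [← natCast_zsmul, ← natCast_zsmul, smul_smul, ← hd q hq]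
        push_cast
        rw [hcq]
      have h1 := (hδ' _ (Finset.mem_union_right _ (Finset.mem_image_of_mem _ hq))).1
      simp only at h1
      rw [key, key, ← neg_lt_iff_pos_add', ← neg_lt_iff_pos_add', h1])
  refine ⟨δ, fun p hp n => ?_⟩
  exact (hδ (n, p.2, 0 < p.1 + n • γ) ⟨(p, n), ⟨hp, trivial⟩, rfl⟩).symm

/-- Add a pair of values to a partial isomorphism. -/
def addValue (γ : M.Γ) (δ : N.Γ)
    (h : ∀ p ∈ P.G, ∀ n : ℤ, 0 < p.1 + n • γ ↔ 0 < p.2 + n • δ) : PIso M N where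
  R := P.R
  D := P.D
  G := P.G ⊔ AddSubgroup.zmultiples (γ, δ)
  one_mem := AddSubgroup.mem_sup_left P.one_mem
  pos_iff p hp := by
    obtain ⟨q, hq, _, ⟨n, rfl⟩, rfl⟩ := AddSubgroup.mem_sup.1 hp
    exact h q hq n
  val_mem p hp := (P.val_mem p hp).mono le_sup_left
  sec_mem := P.sec_mem
  resDiv_mem := P.resDiv_mem

lemma exists_val_eq_of_mem_sup {E : Subfield M.K} {G : AddSubgroup (M.Γ × N.Γ)}
    (hG : ∀ p ∈ G, ∃ x ∈ E, M.val x = (p.1 : M.Γ)) {x : M.K} (hx : x ∈ E) {γ : M.Γ}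
    (hγ : M.val x = γ) {δ : N.Γ} :
    ∀ p ∈ G ⊔ AddSubgroup.zmultiples (γ, δ), ∃ x ∈ E, M.val x = (p.1 : M.Γ) := by
  intro p hp
  obtain ⟨q, hq, _, ⟨n, rfl⟩, rfl⟩ := AddSubgroup.mem_sup.1 hp
  obtain ⟨z, hz, hz'⟩ := hG q hq
  have hpow : M.val (x ^ n) = ((n • γ : M.Γ) : WithTop M.Γ) := by
    cases n with
    | ofNat m => simp [M.val.map_pow, hγ]
    | negSucc m =>
      rw [zpow_negSucc, M.val.map_inv, M.val.map_pow, hγ, negSucc_zsmul, ← WithTop.coe_nsmul]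
      rfl
  refine ⟨z * x ^ n, E.mul_mem hz (E.zpow_mem hx n), ?_⟩
  rw [M.val.map_mul, hz', hpow]
  rfl

/-- In a maximal partial isomorphism with domain in `E`, every value of `E` has a partner. -/
lemma exists_mem_G_of_maximal {E : Subfield M.K} (hN : N.Saturated)
    (hE : (E : Set M.K).Countable) (hP : Maximal (fun S : PIso M N => S.DomLE E) P) {x : M.K}
    (hx : x ∈ E) {γ : M.Γ} (hγ : M.val x = γ) : ∃ δ, (γ, δ) ∈ P.G := by
  obtain ⟨δ, hδ⟩ := P.exists_matching_value hN (countable_G hE hP.prop) γ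
  refine ⟨δ, ?_⟩
  have hdom : (P.addValue γ δ hδ).DomLE E :=
    ⟨hP.prop.field, hP.prop.resField, exists_val_eq_of_mem_sup hP.prop.valueGroup hx hγ⟩
  have := hP.le_of_ge hdom ⟨le_rfl, le_rfl, le_sup_left⟩
  exact this.2.2 (AddSubgroup.mem_sup_right (AddSubgroup.mem_zmultiples _))

/-- Close a partial isomorphism under division in the valued field. -/
def addFractions : PIso M N where
  R := fractionSubring P.R fun _ hz => P.fst_eq_zero_iff hz
  D := P.D
  G := P.G
  one_mem := P.one_mem
  pos_iff := P.pos_iff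
  val_mem := by
    rintro _ ⟨a, ha, b, hb, hb0, rfl⟩
    have e : GTop P.G (M.val (a.1 * b.1⁻¹)) (N.val (a.2 * b.2⁻¹)) := by
      rw [M.val.map_mul, N.val.map_mul, M.val.map_inv, N.val.map_inv]
      exact (P.val_mem a ha).add (P.val_mem b hb).neg
    rw [← div_eq_mul_inv, ← div_eq_mul_inv] at e
    exact e
  sec_mem p hp := le_fractionSubring _ _ (P.sec_mem p hp)
  resDiv_mem := by
    rintro _ ⟨a, ha, b, hb, hb0, rfl⟩ _ ⟨a', ha', b', hb', hb0', rfl⟩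
    have e : (M.resDiv (a.1 / b.1) (a'.1 / b'.1), N.resDiv (a.2 / b.2) (a'.2 / b'.2)) ∈ P.D := by
      rw [M.resDiv_div_div hb0 hb0', N.resDiv_div_div (mt (P.fst_eq_zero_iff hb).2 hb0)
        (mt (P.fst_eq_zero_iff hb').2 hb0')]
      exact P.resDiv_mem _ (P.R.mul_mem ha hb') _ (P.R.mul_mem ha' hb)
    exact e

lemma inv_mem_of_maximal {E : Subfield M.K} (hP : Maximal (fun S : PIso M N => S.DomLE E) P)
    {p : M.K × N.K} (hp : p ∈ P.R) : p⁻¹ ∈ P.R := by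
  have hdom : P.addFractions.DomLE E := by
    refine ⟨?_, hP.prop.resField, hP.prop.valueGroup⟩
    rintro _ ⟨a, ha, b, hb, hb0, rfl⟩
    exact E.div_mem (hP.prop.field a ha) (hP.prop.field b hb)
  have hle : P ≤ P.addFractions :=
    ⟨le_fractionSubring P.R fun _ hz => P.fst_eq_zero_iff hz, le_rfl, le_rfl⟩
  exact (hP.le_of_ge hdom hle).1
    (inv_mem_fractionSubring (h := fun _ hz => P.fst_eq_zero_iff hz) (hle.1 hp))

end PIso

end TLoc

end

/-! ### Extending by residues: separated families over the residue field -/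

section

namespace TLoc

section Separation

variable {D V Λ : Type*} [Ring D] [AddCommGroup V] [Module D V] [LinearOrder Λ] [OrderTop Λ]
  {v : V → Λ}

/-- A finite subset of a valued vector space in which residues of quotients are scalars lies in the
span of a finite list of vectors with increasing values. -/
lemma exists_separated_list (W : Submodule D V)
    (htop : ∀ x ∈ W, v x = ⊤ → x = 0)
    (hres : ∀ x ∈ W, ∀ y ∈ W, v x = v y → v y ≠ ⊤ → ∃ c : D, v y < v (x - c • y)) (n : ℕ) :
    ∀ t : Finset V, t.card ≤ n → (∀ x ∈ t, x ∈ W) → ∃ s : List V,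
      (∀ x ∈ s, x ∈ W ∧ v x ≠ ⊤) ∧ s.Pairwise (fun x y => v x < v y) ∧
      (∀ x ∈ s, ∃ y ∈ t, v y ≤ v x) ∧ ∀ x ∈ t, x ∈ Submodule.span D {x | x ∈ s} := by
  classical
  induction n with
  | zero =>
    intro t ht _
    rw [Nat.le_zero, Finset.card_eq_zero] at ht
    subst ht
    exact ⟨[], by simp, List.Pairwise.nil, by simp, by simp⟩
  | succ n ih =>
    intro t ht htW
    rcases t.eq_empty_or_nonempty with rfl | hne
    · exact ⟨[], by simp, List.Pairwise.nil, by simp, by simp⟩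
    -- Gram-Schmidt for valued spaces: a vector of minimal value is split off, and subtracting
    -- scalar multiples of it strictly raises the values of the others. If the minimum is `⊤`, all
    -- vectors vanish.
    obtain ⟨r, hr, hmin⟩ := t.exists_min_image v hne
    by_cases hr0 : v r = ⊤
    · refine ⟨[], by simp, List.Pairwise.nil, by simp, fun x hx => ?_⟩
      have : v x = ⊤ := top_le_iff.1 (hr0 ▸ hmin x hx)
      rw [htop x (htW x hx) this]
      exact Submodule.zero_mem _
    have hc : ∀ x, ∃ c : D, x ∈ t → v r < v (x - c • r) := by
      intro x
      by_cases hx : x ∈ t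
      · rcases (hmin x hx).lt_or_eq with h | h
        · exact ⟨0, fun _ => by simpa using h⟩
        · obtain ⟨c, hc⟩ := hres x (htW x hx) r (htW r hr) h.symm hr0
          exact ⟨c, fun _ => hc⟩
      · exact ⟨0, fun h => absurd h hx⟩
    choose c hc using hc
    obtain ⟨s, hs1, hs2, hs3, hs4⟩ := ih ((t.erase r).image fun x => x - c x • r)
      (Finset.card_image_le.trans (by rw [Finset.card_erase_of_mem hr]; omega))
      (by
        intro x hx
        obtain ⟨y, hy, rfl⟩ := Finset.mem_image.1 hx
        exact W.sub_mem (htW y (Finset.mem_of_mem_erase hy)) (W.smul_mem _ (htW r hr)))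
    have hlt : ∀ x ∈ s, v r < v x := by
      intro x hx
      obtain ⟨y, hy, hyx⟩ := hs3 x hx
      obtain ⟨z, hz, rfl⟩ := Finset.mem_image.1 hy
      exact (hc z (Finset.mem_of_mem_erase hz)).trans_le hyx
    refine ⟨r :: s, ?_, List.pairwise_cons.2 ⟨hlt, hs2⟩, ?_, fun x hx => ?_⟩
    · intro x hx
      rcases List.mem_cons.1 hx with rfl | hx
      exacts [⟨htW _ hr, hr0⟩, hs1 x hx]
    · intro x hx
      rcases List.mem_cons.1 hx with rfl | hx
      exacts [⟨_, hr, le_rfl⟩, ⟨r, hr, (hlt x hx).le⟩]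
    · have hrs : r ∈ Submodule.span D {x | x ∈ r :: s} :=
        Submodule.subset_span List.mem_cons_self
      by_cases hxr : x = r
      · rwa [hxr]
      have h1 := hs4 _ (Finset.mem_image_of_mem _ (Finset.mem_erase.2 ⟨hxr, hx⟩))
      have h2 : x - c x • r ∈ Submodule.span D {x | x ∈ r :: s} :=
        Submodule.span_mono (fun y hy => List.mem_cons_of_mem _ hy) h1
      have := Submodule.add_mem _ h2 (Submodule.smul_mem _ (c x) hrs)
      simpa using this

/-- The ultrametric inequality, for an abstract `v`, so that it applies to either coordinate of a
pair and to the value of a function at a point. -/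
lemma lt_of_mem_span (hsub : ∀ x y, min (v x) (v y) ≤ v (x - y))
    (hsmul : ∀ (c : D) x, v x ≤ v (c • x)) (hzero : v 0 = ⊤) {β : Λ} (hβ : β < ⊤) {S : Set V}
    (hS : ∀ x ∈ S, β < v x) {z : V} (hz : z ∈ Submodule.span D S) : β < v z := by
  induction hz using Submodule.span_induction with
  | mem x hx => exact hS x hx
  | zero => rwa [hzero]
  | add x y _ _ hx hy =>
    have hy' : β < v (0 - y) := (lt_min (by rwa [hzero]) hy).trans_le (hsub 0 y)
    have := (lt_min hx hy').trans_le (hsub x (0 - y))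
    simpa using this
  | smul c x _ hx => exact hx.trans_le (hsmul c x)

lemma mem_span_cons_iff {x z : V} {s : List V} : z ∈ Submodule.span D {y | y ∈ x :: s} ↔
    ∃ e : D, ∃ z' ∈ Submodule.span D {y | y ∈ s}, z = e • x + z' := by
  have : {y | y ∈ x :: s} = insert x {y | y ∈ s} := by
    ext y
    simp
  rw [this, Submodule.mem_span_insert]

end Separation

namespace PIso

variable {M N : Model.{u}}

/-- Pairs of residues act on pairs of field elements through the sections. -/
noncomputable instance secAlgebra (D : Subring (M.k × N.k)) : Algebra D (M.K × N.K) :=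
  ((RingHom.prodMap M.sec N.sec).comp D.subtype).toAlgebra

lemma sec_smul_def (D : Subring (M.k × N.k)) (c : D) (z : M.K × N.K) :
    c • z = (M.sec c.1.1 * z.1, N.sec c.1.2 * z.2) := rfl

variable (P : PIso M N)

/-- The elements of a partial isomorphism, as a module over its residues. -/
noncomputable def moduleR : Submodule P.D (M.K × N.K) where
  carrier := P.R
  add_mem' := P.R.add_mem
  zero_mem' := P.R.zero_mem
  smul_mem' c _ hz := P.R.mul_mem (P.sec_mem c.1 c.2) hz

lemma val_sub_fst (x y : M.K × N.K) : min (M.val x.1) (M.val y.1) ≤ M.val (x - y).1 :=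
  M.val.map_sub _ _

lemma val_sub_snd (x y : M.K × N.K) : min (N.val x.2) (N.val y.2) ≤ N.val (x - y).2 :=
  N.val.map_sub _ _

lemma val_smul_fst (D : Subring (M.k × N.k)) (c : D) (z : M.K × N.K) :
    M.val z.1 ≤ M.val (c • z).1 := M.val_le_val_sec_mul _ _

lemma val_smul_snd (D : Subring (M.k × N.k)) (c : D) (z : M.K × N.K) :
    N.val z.2 ≤ N.val (c • z).2 := N.val_le_val_sec_mul _ _

lemma exists_separated (t : Finset (M.K × N.K)) (ht : ∀ x ∈ t, x ∈ P.R) :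
    ∃ s : List (M.K × N.K), (∀ x ∈ s, x ∈ P.R ∧ M.val x.1 ≠ ⊤) ∧
      s.Pairwise (fun x y => M.val x.1 < M.val y.1) ∧
      ∀ x ∈ t, x ∈ Submodule.span P.D {x | x ∈ s} := by
  obtain ⟨s, h1, h2, -, h4⟩ := exists_separated_list (D := P.D)
    (v := fun z : M.K × N.K => M.val z.1) P.moduleR
    (by
      intro x hx h0
      have h0' : x.1 = 0 := M.val_eq_top_iff.1 h0
      exact Prod.ext h0' ((P.fst_eq_zero_iff hx).1 h0'))
    (by
      intro x hx y hy hxy hy0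
      exact ⟨⟨_, P.resDiv_mem x hx y hy⟩,
        M.val_lt_sub_resDiv ((M.val.ne_top_iff).1 hy0) hxy.ge⟩) t.card t le_rfl ht
  exact ⟨s, h1, h2, h4⟩

lemma mem_span_of_le {D D' : Subring (M.k × N.k)} (h : D ≤ D') {S : Set (M.K × N.K)}
    {x : M.K × N.K} (hx : x ∈ Submodule.span D S) : x ∈ Submodule.span D' S := by
  induction hx using Submodule.span_induction with
  | mem x hx => exact Submodule.subset_span hx
  | zero => exact Submodule.zero_mem _
  | add x y _ _ hx hy => exact Submodule.add_mem _ hx hy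
  | smul c x _ hx => exact Submodule.smul_mem _ (⟨c.1, h c.2⟩ : D') hx

section Span

variable {P} {D' : Subring (M.k × N.k)} (hinv : ∀ c ∈ D', c⁻¹ ∈ D')
  (hzero : ∀ c ∈ D', c.1 = 0 ↔ c.2 = 0)
include hinv hzero

/-- Values increase strictly along the list, so the first nonzero coefficient decides the value of a
combination. Nonzero coefficients have sections of value `0`, and coefficients vanish in both
coordinates simultaneously, so the two sides are computed alike. -/
lemma val_resDiv_of_mem_span_list (s : List (M.K × N.K)) (h1 : ∀ x ∈ s, x ∈ P.R ∧ M.val x.1 ≠ ⊤)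
    (h2 : s.Pairwise fun x y => M.val x.1 < M.val y.1) :
    ∀ z ∈ Submodule.span D' {x | x ∈ s}, GTop P.G (M.val z.1) (N.val z.2) ∧
      ∀ w ∈ Submodule.span D' {x | x ∈ s}, (M.resDiv z.1 w.1, N.resDiv z.2 w.2) ∈ D' := by
  induction s with
  | nil =>
    intro z hz
    have hz0 : z = 0 := by simpa using hz
    subst hz0
    refine ⟨?_, fun w hw => ?_⟩
    · simpa using GTop.top
    · simp only [Prod.fst_zero, Prod.snd_zero, Model.resDiv_zero_left]
      exact D'.zero_mem
  | cons x s ih =>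
    rw [List.pairwise_cons] at h2
    have ih' := ih (fun y hy => h1 y (List.mem_cons_of_mem _ hy)) h2.2
    have hx := h1 x List.mem_cons_self
    have hx2 : N.val x.2 < ⊤ := by
      have := ((P.val_mem x hx.1).lt_iff P.pos_iff GTop.top).1 (lt_top_iff_ne_top.2 hx.2)
      exact this
    have b1 : ∀ z ∈ Submodule.span D' {y | y ∈ s}, M.val x.1 < M.val z.1 := fun z hz =>
      lt_of_mem_span (v := fun z : M.K × N.K => M.val z.1) val_sub_fst (val_smul_fst D')
        M.val.map_zero (lt_top_iff_ne_top.2 hx.2) h2.1 hz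
    have b2 : ∀ z ∈ Submodule.span D' {y | y ∈ s}, N.val x.2 < N.val z.2 := fun z hz =>
      lt_of_mem_span (v := fun z : M.K × N.K => N.val z.2) val_sub_snd (val_smul_snd D')
        N.val.map_zero hx2 (fun y hy => ((P.val_mem x hx.1).lt_iff P.pos_iff
          (P.val_mem y (h1 y (List.mem_cons_of_mem _ hy)).1)).1 (h2.1 y hy)) hz
    intro z hz
    obtain ⟨e, z', hz', rfl⟩ := mem_span_cons_iff.1 hz
    have he := hzero e.1 e.2
    refine ⟨?_, fun w hw => ?_⟩
    · by_cases h0 : e.1.1 = 0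
      · have h0' := he.1 h0
        have : e • x + z' = z' := by
          rw [sec_smul_def, h0, h0']
          simp
        rw [this]
        exact (ih' z' hz').1
      · have h0' := mt he.2 h0
        have e1 : M.val (e • x + z').1 = M.val x.1 := M.val_sec_mul_add (b1 z' hz') h0
        have e2 : N.val (e • x + z').2 = N.val x.2 := N.val_sec_mul_add (b2 z' hz') h0'
        rw [e1, e2]
        exact P.val_mem x hx.1
    · obtain ⟨f, w', hw', rfl⟩ := mem_span_cons_iff.1 hw
      have hf := hzero f.1 f.2
      -- If one leading coefficient is nonzero, the residue is `e / f` in both coordinates;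
      -- otherwise `x` drops out of both combinations and induction applies.
      by_cases h0 : e.1.1 ≠ 0 ∨ f.1.1 ≠ 0
      · have h0' : e.1.2 ≠ 0 ∨ f.1.2 ≠ 0 := h0.imp (mt he.2) (mt hf.2)
        have e1 : M.resDiv (e • x + z').1 (f • x + w').1 = e.1.1 * (f.1.1)⁻¹ :=
          M.resDiv_sec_mul_add (b1 z' hz') (b1 w' hw') h0
        have e2 : N.resDiv (e • x + z').2 (f • x + w').2 = e.1.2 * (f.1.2)⁻¹ :=
          N.resDiv_sec_mul_add (b2 z' hz') (b2 w' hw') h0'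
        rw [e1, e2]
        exact D'.mul_mem e.2 (hinv _ f.2)
      · push Not at h0
        have e0 : e • x + z' = z' := by
          rw [sec_smul_def, h0.1, he.1 h0.1]
          simp
        have f0 : f • x + w' = w' := by
          rw [sec_smul_def, h0.2, hf.1 h0.2]
          simp
        rw [e0, f0]
        exact (ih' z' hz').2 w' hw'

/-- The separated list is found over the old residues `P.D`. Being separated concerns only the
values of the list, so it serves for the new scalars as well. -/
lemma val_resDiv_of_mem_span (hD : P.D ≤ D') {z w : M.K × N.K}
    (hz : z ∈ Submodule.span D' (P.R : Set (M.K × N.K)))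
    (hw : w ∈ Submodule.span D' (P.R : Set (M.K × N.K))) :
    GTop P.G (M.val z.1) (N.val z.2) ∧ (M.resDiv z.1 w.1, N.resDiv z.2 w.2) ∈ D' := by
  classical
  obtain ⟨t, ht, hzt⟩ := Submodule.mem_span_finite_of_mem_span hz
  obtain ⟨t', ht', hwt⟩ := Submodule.mem_span_finite_of_mem_span hw
  obtain ⟨s, h1, h2, h3⟩ := P.exists_separated (t ∪ t') (by
    intro x hx
    rcases Finset.mem_union.1 hx with hx | hx
    exacts [ht hx, ht' hx])
  have hle : Submodule.span D' (↑(t ∪ t') : Set (M.K × N.K)) ≤ Submodule.span D' {x | x ∈ s} := by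
    rw [Submodule.span_le]
    intro x hx
    exact mem_span_of_le hD (h3 x hx)
  have hz' := hle (Submodule.span_mono (by simp) hzt)
  have hw' := hle (Submodule.span_mono (by simp) hwt)
  have := val_resDiv_of_mem_span_list hinv hzero s h1 h2 z hz'
  exact ⟨this.1, this.2 w hw'⟩

end Span

/-- Since `R` is closed under multiplication, adjoining it as an algebra adds nothing beyond linear
combinations. -/
lemma adjoin_toSubmodule (D' : Subring (M.k × N.k)) :
    Subalgebra.toSubmodule (Algebra.adjoin D' (P.R : Set (M.K × N.K))) =
      Submodule.span D' (P.R : Set (M.K × N.K)) := by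
  rw [Algebra.adjoin_eq_span]
  congr 1
  exact congrArg _ (Submonoid.closure_eq P.R.toSubmonoid)

/-- Enlarge the residues of a partial isomorphism. -/
noncomputable def addResidues (D' : Subring (M.k × N.k)) (hD : P.D ≤ D')
    (hinv : ∀ c ∈ D', c⁻¹ ∈ D') (hzero : ∀ c ∈ D', c.1 = 0 ↔ c.2 = 0) : PIso M N where
  R := (Algebra.adjoin D' (P.R : Set (M.K × N.K))).toSubring
  D := D'
  G := P.G
  one_mem := P.one_mem
  pos_iff := P.pos_iff
  val_mem z hz := by
    have hz' : z ∈ Submodule.span D' (P.R : Set (M.K × N.K)) := by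
      rw [← P.adjoin_toSubmodule]
      exact hz
    exact (val_resDiv_of_mem_span hinv hzero hD hz' hz').1
  sec_mem c hc := (Algebra.adjoin D' (P.R : Set (M.K × N.K))).algebraMap_mem ⟨c, hc⟩
  resDiv_mem z hz w hw := by
    have hz' : z ∈ Submodule.span D' (P.R : Set (M.K × N.K)) := by
      rw [← P.adjoin_toSubmodule]
      exact hz
    have hw' : w ∈ Submodule.span D' (P.R : Set (M.K × N.K)) := by
      rw [← P.adjoin_toSubmodule]
      exact hw
    exact (val_resDiv_of_mem_span hinv hzero hD hz' hw').2

lemma le_addResidues (D' : Subring (M.k × N.k)) (hD : P.D ≤ D')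
    (hinv : ∀ c ∈ D', c⁻¹ ∈ D') (hzero : ∀ c ∈ D', c.1 = 0 ↔ c.2 = 0) :
    P ≤ P.addResidues D' hD hinv hzero :=
  ⟨fun _ hx => Algebra.subset_adjoin hx, hD, le_rfl⟩

lemma addResidues_domLE {E : Subfield M.K} (hP : P.DomLE E) (D' : Subring (M.k × N.k))
    (hD : P.D ≤ D') (hinv : ∀ c ∈ D', c⁻¹ ∈ D') (hzero : ∀ c ∈ D', c.1 = 0 ↔ c.2 = 0)
    (hE : ∀ c ∈ D', M.sec c.1 ∈ E) : (P.addResidues D' hD hinv hzero).DomLE E := by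
  refine ⟨fun z hz => ?_, hE, hP.valueGroup⟩
  have hz' : z ∈ Submodule.span D' (P.R : Set (M.K × N.K)) := by
    rw [← P.adjoin_toSubmodule]
    exact hz
  clear hz
  induction hz' using Submodule.span_induction with
  | mem x hx => exact hP.field x hx
  | zero => exact E.zero_mem
  | add x y _ _ hx hy => exact E.add_mem hx hy
  | smul c x _ hx => exact E.mul_mem (hE c.1 c.2) hx

section Residue

/-- The first projection on the residues of a partial isomorphism. -/
def fstD : P.D →+* M.k := (RingHom.fst M.k N.k).comp P.D.subtype

/-- The second projection on the residues of a partial isomorphism. -/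
def sndD : P.D →+* N.k := (RingHom.snd M.k N.k).comp P.D.subtype

lemma countable_polynomial {A : Type*} [CommRing A] (hA : Countable A) :
    Countable (Polynomial A) := by
  rw [← Cardinal.mk_le_aleph0_iff] at hA ⊢
  exact Polynomial.cardinalMk_le_max.trans (max_le hA le_rfl)

/-- `D` is a field. For algebraic `c`, a root of the transported minimal polynomial has the same
minimal polynomial. For transcendental `c`, the partner must avoid the roots of countably many
nonzero polynomials, which is finitely satisfiable because the residue field is infinite. -/
lemma exists_matching_residue (hN : N.Saturated) (hP : (P.D : Set (M.k × N.k)).Countable)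
    (c : M.k) : ∃ d : N.k, ∀ p : Polynomial P.D,
      (p.map P.fstD).eval c = 0 ↔ (p.map P.sndD).eval d = 0 := by
  classical
  have hfield : IsField P.D := by
    refine ⟨⟨0, 1, zero_ne_one⟩, mul_comm, fun {a} ha => ⟨⟨_, P.inv_mem_D' _ a.2⟩, ?_⟩⟩
    have h1 : a.1.1 ≠ 0 := by
      intro h0
      exact ha (Subtype.ext (Prod.ext h0 ((P.fst_eq_zero_iff_D a.2).1 h0)))
    have h2 := mt (P.fst_eq_zero_iff_D a.2).2 h1
    exact Subtype.ext (Prod.ext (mul_inv_cancel₀ h1) (mul_inv_cancel₀ h2))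
  let : Field P.D := hfield.toField
  let : Algebra P.D M.k := P.fstD.toAlgebra
  let : Algebra P.D N.k := P.sndD.toAlgebra
  have e1 : ∀ (p : Polynomial P.D) (x : M.k), (p.map P.fstD).eval x = Polynomial.aeval x p :=
    fun p x => (Polynomial.eval_map _ _)
  have e2 : ∀ (p : Polynomial P.D) (x : N.k), (p.map P.sndD).eval x = Polynomial.aeval x p :=
    fun p x => (Polynomial.eval_map _ _)
  simp only [e1, e2]
  have hk := N.isAlgClosed_k
  by_cases halg : IsIntegral P.D c
  · have hirr := minpoly.irreducible halg
    have hdeg : ((minpoly P.D c).map P.sndD).degree ≠ 0 := by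
      rw [Polynomial.degree_map]
      exact (Polynomial.degree_pos_of_irreducible hirr).ne'
    obtain ⟨d, hd⟩ := IsAlgClosed.exists_root _ hdeg
    have hd' : Polynomial.aeval d (minpoly P.D c) = 0 := (e2 _ _).symm.trans hd
    have hmin : minpoly P.D c = minpoly P.D d :=
      minpoly.eq_of_irreducible_of_monic hirr hd' (minpoly.monic halg)
    refine ⟨d, fun p => ?_⟩
    rw [← minpoly.dvd_iff, ← minpoly.dvd_iff, hmin]
  · have halg' : ∀ p : Polynomial P.D, Polynomial.aeval c p = 0 → p = 0 := by
      intro p hp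
      by_contra hne
      exact halg (isAlgebraic_iff_isIntegral.1 ⟨p, hne, hp⟩)
    have hcount : Countable P.D := hP.to_subtype
    have := countable_polynomial hcount
    obtain ⟨d, hd⟩ := hN.resField
      (Set.range fun p : Polynomial P.D => (p.map P.sndD, Polynomial.aeval c p = 0))
      (Set.countable_range _) (by
        intro F hF
        have : Infinite N.k := IsAlgClosed.instInfinite
        obtain ⟨d, hd⟩ := Infinite.exists_notMem_finset (F.biUnion fun q => q.1.roots.toFinset)
        refine ⟨d, fun q hq => ?_⟩
        obtain ⟨p, rfl⟩ := hF hq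
        by_cases hp : p = 0
        · simp [hp]
        · have h1 : p.map P.sndD ≠ 0 := by
            rwa [Ne, Polynomial.map_eq_zero]
          have h2 : ¬ Polynomial.aeval c p = 0 := fun h => hp (halg' p h)
          simp only [h2, iff_false]
          intro h3
          exact hd (Finset.mem_biUnion.2 ⟨_, hq, by
            rw [Multiset.mem_toFinset, Polynomial.mem_roots h1]
            exact h3⟩))
    refine ⟨d, fun p => ?_⟩
    have := hd _ ⟨p, rfl⟩
    rw [← e2]
    exact this.symm

/-- The fractions in the ring generated by `D` and the matched pair are closed under inverses and
pair zero only with zero, as enlarging the residues requires; maximality then absorbs them. -/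
lemma exists_mem_D_of_maximal {E : Subfield M.K} (hN : N.Saturated)
    (hE : (E : Set M.K).Countable) (hP : Maximal (fun S : PIso M N => S.DomLE E) P) {c : M.k}
    (hc : M.sec c ∈ E) : ∃ d, (c, d) ∈ P.D := by
  obtain ⟨d, hd⟩ := P.exists_matching_residue hN (countable_D hE hP.prop) c
  let ev : Polynomial P.D →+* M.k × N.k := Polynomial.eval₂RingHom P.D.subtype (c, d)
  have ev1 : ∀ p, (ev p).1 = (p.map P.fstD).eval c := by
    intro p
    rw [Polynomial.eval_map]
    exact Polynomial.hom_eval₂ p P.D.subtype (RingHom.fst M.k N.k) (c, d)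
  have ev2 : ∀ p, (ev p).2 = (p.map P.sndD).eval d := by
    intro p
    rw [Polynomial.eval_map]
    exact Polynomial.hom_eval₂ p P.D.subtype (RingHom.snd M.k N.k) (c, d)
  have hz : ∀ z ∈ ev.range, z.1 = 0 ↔ z.2 = 0 := by
    rintro _ ⟨p, rfl⟩
    rw [ev1, ev2]
    exact hd p
  have hle : P.D ≤ ev.range := fun z hz =>
    ⟨Polynomial.C ⟨z, hz⟩, Polynomial.eval₂_C _ _⟩
  have hle' : ev.range ≤ fractionSubring ev.range hz := le_fractionSubring _ _
  have hevE : ∀ z ∈ ev.range, M.sec z.1 ∈ E := by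
    rintro _ ⟨p, rfl⟩
    induction p using Polynomial.induction_on' with
    | add p q hp hq =>
      rw [map_add, Prod.fst_add, map_add]
      exact E.add_mem hp hq
    | monomial n a =>
      rw [ev1, Polynomial.map_monomial, Polynomial.eval_monomial, map_mul, map_pow]
      exact E.mul_mem (hP.prop.resField a.1 a.2) (E.pow_mem hc n)
  have hdom := P.addResidues_domLE hP.prop (fractionSubring ev.range hz) (hle.trans hle')
    (fun c hc => inv_mem_fractionSubring hc) (fun c hc => fst_eq_zero_iff_fractionSubring hc) (by
      rintro _ ⟨a, ha, b, hb, -, rfl⟩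
      rw [Prod.fst_div, map_div₀]
      exact E.div_mem (hevE a ha) (hevE b hb))
  refine ⟨d, (hP.le_of_ge hdom (P.le_addResidues _ _ _ _)).2.1 (hle' ⟨Polynomial.X, ?_⟩)⟩
  exact Polynomial.eval₂_X _ _

end Residue

end PIso

end TLoc

end

/-! ### Dominant terms of polynomials and the values of roots -/

section
open Polynomial

namespace TLoc

section Newton

variable {K Γ : Type*} [Field K] [AddCommGroup Γ] [LinearOrder Γ] [IsOrderedAddMonoid Γ]
  (v : AddValuation K (WithTop Γ)) (γ : Γ)

/-- Exactly one term of `p` has minimal value at the elements of value `γ`. -/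
def HasDominantTerm (p : K[X]) : Prop :=
  ∃ i, v (p.coeff i) ≠ ⊤ ∧ ∀ j ≠ i,
    v (p.coeff i) + i • (γ : WithTop Γ) < v (p.coeff j) + j • (γ : WithTop Γ)

variable {v γ}

/-- One term has strictly smaller value than all the others together, so nothing can cancel it. -/
lemma HasDominantTerm.eval_ne_zero {p : K[X]} (h : HasDominantTerm v γ p) {x : K}
    (hx : v x = γ) : p.eval x ≠ 0 := by
  classical
  obtain ⟨i, hi, hmin⟩ := h
  have hc : p.coeff i ≠ 0 := fun h0 => hi (by rw [h0, v.map_zero])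
  have hval : ∀ j, v (p.coeff j * x ^ j) = v (p.coeff j) + j • (γ : WithTop Γ) := by
    intro j
    rw [v.map_mul, v.map_pow, hx]
  have hxne : x ≠ 0 := by
    rintro rfl
    rw [v.map_zero] at hx
    exact WithTop.top_ne_coe hx
  have hti : v (p.coeff i * x ^ i) ≠ ⊤ := (v.ne_top_iff).2 (mul_ne_zero hc (pow_ne_zero _ hxne))
  intro h0
  rw [Polynomial.eval_eq_sum_range, ← Finset.add_sum_erase _ _
    (Finset.mem_range.2 (Nat.lt_succ_of_le (le_natDegree_of_ne_zero hc)))] at h0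
  have hlt : v (p.coeff i * x ^ i) <
      v (∑ j ∈ (Finset.range (p.natDegree + 1)).erase i, p.coeff j * x ^ j) := by
    apply v.map_lt_sum hti
    intro j hj
    rw [hval, hval]
    exact hmin j (Finset.ne_of_mem_erase hj)
  have := v.map_add_eq_of_lt_left hlt
  rw [h0, v.map_zero] at this
  exact hti this.symm

lemma WithTop_lt_of_add_lt_add_right {a b c : WithTop Γ} (h : a + c < b + c) : a < b := by
  by_contra hn
  exact absurd h (not_lt.2 (by gcongr; exact not_lt.1 hn))

/-- At elements of value `γ` the factor `X - y` behaves like `-y` if `v y < γ`, and like `X` if `v y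
> γ`. So the dominant index stays the same in the first case and moves up by one in the second. -/
lemma HasDominantTerm.linear_mul {p : K[X]} (h : HasDominantTerm v γ p) {y : K}
    (hy : v y ≠ γ) : HasDominantTerm v γ ((X - C y) * p) := by
  obtain ⟨i, hi, hmin⟩ := h
  let w : ℕ → WithTop Γ := fun j => v (p.coeff j) + j • (γ : WithTop Γ)
  have hmin' : ∀ j ≠ i, w i < w j := hmin
  have hle : ∀ j, w i ≤ w j := by
    intro j
    by_cases hj : j = i
    · rw [hj]
    · exact (hmin' j hj).le
  have hnsmul : ∀ j : ℕ, j • (γ : WithTop Γ) = ((j • γ : Γ) : WithTop Γ) :=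
    fun j => (WithTop.coe_nsmul _ _).symm
  have hwi : w i ≠ ⊤ := by
    change v (p.coeff i) + i • (γ : WithTop Γ) ≠ ⊤
    rw [hnsmul]
    exact WithTop.add_ne_top.2 ⟨hi, WithTop.coe_ne_top⟩
  have c0 : ((X - C y) * p).coeff 0 = -(y * p.coeff 0) := by
    simp [sub_mul]
  have cs : ∀ j, ((X - C y) * p).coeff (j + 1) = p.coeff j - y * p.coeff (j + 1) := by
    intro j
    simp [sub_mul, coeff_X_mul]
  have hu : ∀ j, v (y * p.coeff j) + j • (γ : WithTop Γ) = w j + v y := by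
    intro j
    rw [v.map_mul, add_comm (v y), add_right_comm]
  have ht : ∀ j, v (p.coeff j) + (j + 1) • (γ : WithTop Γ) = w j + γ := by
    intro j
    rw [succ_nsmul, ← add_assoc]
  have hlower : ∀ {j} {β : WithTop Γ}, β < w j + γ → β < w (j + 1) + v y →
      β < v (((X - C y) * p).coeff (j + 1)) + (j + 1) • (γ : WithTop Γ) := by
    intro j β h1 h2
    rw [cs]
    rw [← ht] at h1
    rw [← hu] at h2
    rcases min_le_iff.1 (v.map_sub (p.coeff j) (y * p.coeff (j + 1))) with h | h
    · exact h1.trans_le (by gcongr)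
    · exact h2.trans_le (by gcongr)
  rcases lt_or_gt_of_ne hy with hlt | hlt
  · have hyt : v y ≠ ⊤ := (hlt.trans (WithTop.coe_lt_top _)).ne
    have hcoef : v (((X - C y) * p).coeff i) = v (y * p.coeff i) := by
      cases i with
      | zero => rw [c0, v.map_neg]
      | succ i =>
        rw [cs]
        apply v.map_sub_eq_of_lt_right
        apply WithTop_lt_of_add_lt_add_right (c := (i + 1) • (γ : WithTop Γ))
        rw [hu, ht]
        exact WithTop.add_lt_add_of_le_of_lt hwi (hle i) hlt
    refine ⟨i, ?_, fun j hj => ?_⟩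
    · rw [hcoef, v.map_mul]
      exact WithTop.add_ne_top.2 ⟨hyt, hi⟩
    · rw [hcoef, hu]
      cases j with
      | zero =>
        rw [c0, v.map_neg, hu]
        exact WithTop.add_lt_add_right hyt (hmin' 0 hj)
      | succ j =>
        exact hlower (WithTop.add_lt_add_of_le_of_lt hwi (hle j) hlt)
          (WithTop.add_lt_add_right hyt (hmin' _ hj))
  · have hcoef : v (((X - C y) * p).coeff (i + 1)) = v (p.coeff i) := by
      rw [cs]
      apply v.map_sub_eq_of_lt_left
      apply WithTop_lt_of_add_lt_add_right (c := (i + 1) • (γ : WithTop Γ))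
      rw [hu, ht]
      exact WithTop.add_lt_add_of_le_of_lt hwi (hle _) hlt
    refine ⟨i + 1, by rwa [hcoef], fun j hj => ?_⟩
    rw [hcoef, ht]
    cases j with
    | zero =>
      rw [c0, v.map_neg, hu]
      exact WithTop.add_lt_add_of_le_of_lt hwi (hle _) hlt
    | succ j =>
      exact hlower (WithTop.add_lt_add_right WithTop.coe_ne_top (hmin' j fun h => hj (by rw [h])))
        (WithTop.add_lt_add_of_le_of_lt hwi (hle _) hlt)

/-- By splitting into linear factors. It converts the existence of a root of value `γ` into a
statement about the values of the coefficients, which a partial isomorphism preserves. -/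
lemma hasDominantTerm_of_roots [IsAlgClosed K] (n : ℕ) : ∀ p : K[X], p.natDegree = n → p ≠ 0 →
    (∀ y, p.eval y = 0 → v y ≠ γ) → HasDominantTerm v γ p := by
  induction n with
  | zero =>
    intro p hp hp0 _
    rw [Polynomial.eq_C_of_natDegree_eq_zero hp] at hp0 ⊢
    refine ⟨0, ?_, fun j hj => ?_⟩
    · rw [coeff_C_zero]
      exact (v.ne_top_iff).2 fun h => hp0 (by rw [h, C_0])
    · rw [coeff_C_zero, coeff_C_of_ne_zero hj, v.map_zero, zero_smul, add_zero, WithTop.top_add]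
      exact lt_top_iff_ne_top.2 ((v.ne_top_iff).2 fun h => hp0 (by rw [h, C_0]))
  | succ n ih =>
    intro p hp hp0 hroots
    obtain ⟨y, hy⟩ := IsAlgClosed.exists_root p (by
      rw [Polynomial.degree_eq_natDegree hp0, hp]
      exact_mod_cast Nat.succ_ne_zero n)
    obtain ⟨q, rfl⟩ := Polynomial.dvd_iff_isRoot.2 hy
    have hq0 : q ≠ 0 := right_ne_zero_of_mul hp0
    rw [Polynomial.natDegree_mul (X_sub_C_ne_zero y) hq0, natDegree_X_sub_C] at hp
    refine HasDominantTerm.linear_mul (ih q (by omega) hq0 fun z hz => hroots z ?_) (hroots y hy)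
    rw [eval_mul, hz, mul_zero]

end Newton

end TLoc

end

/-! ### Finding a partner at the same distances from the domain -/

section
open Polynomial

namespace TLoc

/-- A countable subfield of a model that is closed under residues and relatively algebraically
closed. -/
structure Model.IsClosedSubfield (M : Model.{u}) (E : Subfield M.K) : Prop where
  countable : (E : Set M.K).Countable
  root_mem : ∀ p : M.K[X], p ≠ 0 → (∀ j, p.coeff j ∈ E) → ∀ x, p.eval x = 0 → x ∈ E
  sec_resDiv_mem : ∀ x ∈ E, ∀ y ∈ E, M.sec (M.resDiv x y) ∈ E

namespace PIso

variable {M N : Model.{u}} (P : PIso M N)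

/-- The domain of the partial isomorphism lies in `E` and exhausts its residues and values. -/
structure IsFull (E : Subfield M.K) : Prop where
  dom : P.DomLE E
  inv_mem : ∀ p ∈ P.R, p⁻¹ ∈ P.R
  value : ∀ x ∈ E, ∀ γ : M.Γ, M.val x = γ → ∃ δ, (γ, δ) ∈ P.G
  residue : ∀ c, M.sec c ∈ E → ∃ d, (c, d) ∈ P.D

/-- The first projection on the field elements of a partial isomorphism. -/
def fstR : P.R →+* M.K := (RingHom.fst M.K N.K).comp P.R.subtype

/-- The second projection on the field elements of a partial isomorphism. -/
def sndR : P.R →+* N.K := (RingHom.snd M.K N.K).comp P.R.subtype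

lemma val_R (a : P.R) : GTop P.G (M.val a.1.1) (N.val a.1.2) := P.val_mem _ a.2

lemma fstR_injective : Function.Injective P.fstR := by
  intro a b h
  refine Subtype.ext (Prod.ext h ?_)
  exact (P.rel_eq_iff (s := .VF) a.2 b.2).1 h

lemma hasDominantTerm_iff {p : M.Γ × N.Γ} (hp : p ∈ P.G) (q : P.R[X]) :
    HasDominantTerm M.val p.1 (q.map P.fstR) ↔ HasDominantTerm N.val p.2 (q.map P.sndR) := by
  unfold HasDominantTerm
  simp only [coeff_map]
  have hc : ∀ j, GTop P.G (M.val (P.fstR (q.coeff j))) (N.val (P.sndR (q.coeff j))) :=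
    fun j => P.val_R (q.coeff j)
  refine exists_congr fun i => and_congr ?_ (forall_congr' fun j => imp_congr Iff.rfl ?_)
  · exact not_congr ((hc i).eq_iff P.pos_iff GTop.top)
  · exact ((hc i).add ((GTop.coe hp).nsmul i)).lt_iff P.pos_iff ((hc j).add ((GTop.coe hp).nsmul j))

/-- `y` is at the same distance from the image of `a` as `x` is from `a`. -/
def SameDist (x : M.K) (a : P.R) (y : N.K) : Prop :=
  GTop P.G (M.val (x - a.1.1)) (N.val (y - a.1.2))

variable {P}

/-- If `x` is closer to `b` than to `a`, its distance from `a` is that of `b` from `a`, which is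
known on both sides. -/
lemma SameDist.of_lt {x : M.K} {a b : P.R} {y : N.K} (h : P.SameDist x b y)
    (hlt : M.val (x - a.1.1) < M.val (x - b.1.1)) : P.SameDist x a y := by
  have e1 : x - a.1.1 = (b.1.1 - a.1.1) + (x - b.1.1) := by ring
  have e2 : y - a.1.2 = (b.1.2 - a.1.2) + (y - b.1.2) := by ring
  have e3 : M.val (b.1.1 - a.1.1) = M.val (x - a.1.1) := by
    have : b.1.1 - a.1.1 = (x - a.1.1) - (x - b.1.1) := by ring
    rw [this, M.val.map_sub_eq_of_lt_left hlt]
  have hba := P.val_R (b - a)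
  have hlt' : M.val (b - a).1.1 < M.val (x - b.1.1) := by
    change M.val (b.1.1 - a.1.1) < _
    rwa [e3]
  have hlt2 := (hba.lt_iff P.pos_iff h).1 hlt'
  have hN : N.val (y - a.1.2) = N.val (b - a).1.2 := by
    rw [e2]
    exact N.val.map_add_eq_of_lt_left hlt2
  change GTop P.G _ _
  rw [← e3, hN]
  exact hba

lemma SameDist.of_eq {x : M.K} {a b : P.R} {y : N.K} (h : P.SameDist x b y)
    (heq : M.val (x - a.1.1) = M.val (x - b.1.1))
    (hlt : M.val (x - b.1.1) < M.val (b - a).1.1) : P.SameDist x a y := by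
  have e2 : y - a.1.2 = (y - b.1.2) + (b.1.2 - a.1.2) := by ring
  have hlt2 := (h.lt_iff P.pos_iff (P.val_R (b - a))).1 hlt
  have hN : N.val (y - a.1.2) = N.val (y - b.1.2) := by
    rw [e2]
    exact N.val.map_add_eq_of_lt_left hlt2
  change GTop P.G _ _
  rw [heq, hN]
  exact h

section Full

variable {E : Subfield M.K} (hE : M.IsClosedSubfield E) (hP : P.IsFull E) {x : M.K} (hx : x ∈ E)
  (hxR : ∀ y, (x, y) ∉ P.R)
include hE hP hx hxR

omit hE hP hx in
lemma sub_fst_ne_zero (a : P.R) : x - a.1.1 ≠ 0 := by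
  intro h
  rw [sub_eq_zero] at h
  exact hxR a.1.2 (by rw [h]; exact a.2)

/-- The residue of `(x - a) / b` already has a partner, and its section multiplied by `b` is an
element of the domain that cancels the leading term of `x - a`. -/
lemma exists_closer {a b : P.R} (h : M.val (b.1.1) ≤ M.val (x - a.1.1)) (hb : b.1.1 ≠ 0) :
    ∃ e : P.R, e.1.1 = M.sec (M.resDiv (x - a.1.1) b.1.1) * b.1.1 ∧
      M.val b.1.1 < M.val (x - a.1.1 - e.1.1) := by
  have hmem : M.sec (M.resDiv (x - a.1.1) b.1.1) ∈ E :=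
    hE.sec_resDiv_mem _ (E.sub_mem hx (hP.dom.field _ a.2)) _ (hP.dom.field _ b.2)
  obtain ⟨d, hd⟩ := hP.residue _ hmem
  exact ⟨⟨_, P.R.mul_mem (P.sec_mem _ hd) b.2⟩, rfl, M.val_lt_sub_resDiv hb h⟩

/-- Distance conditions are directed. The centre closer to `x` controls the other one. If `a`, `b`
and `x` are mutually equidistant, `b - a` has the value of `x - a`, and cancelling a leading term
produces a centre closer than both. -/
lemma exists_sameDist_imp (a b : P.R) :
    ∃ c : P.R, ∀ y, P.SameDist x c y → P.SameDist x a y ∧ P.SameDist x b y := by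
  rcases lt_trichotomy (M.val (x - a.1.1)) (M.val (x - b.1.1)) with hlt | heq | hlt
  · exact ⟨b, fun y hy => ⟨hy.of_lt hlt, hy⟩⟩
  · by_cases h : M.val (x - b.1.1) < M.val (b - a).1.1
    · exact ⟨b, fun y hy => ⟨hy.of_eq heq h, hy⟩⟩
    · have hle : M.val (x - b.1.1) ≤ M.val (b - a).1.1 := by
        have : (b - a).1.1 = (x - a.1.1) - (x - b.1.1) := by
          change b.1.1 - a.1.1 = _
          ring
        rw [this]
        exact M.val.map_le_sub heq.ge le_rfl
      have heq' : M.val (b - a).1.1 = M.val (x - a.1.1) := by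
        rw [heq]
        exact le_antisymm (not_lt.1 h) hle
      have hne : (b - a).1.1 ≠ 0 := by
        intro h0
        rw [h0, M.val.map_zero, eq_comm, M.val_eq_top_iff] at heq'
        exact sub_fst_ne_zero hxR a heq'
      obtain ⟨e, -, he⟩ := exists_closer hE hP hx hxR heq'.le hne
      refine ⟨a + e, fun y hy => ?_⟩
      have h1 : M.val (x - a.1.1) < M.val (x - (a + e).1.1) := by
        rw [← heq']
        have : x - (a + e).1.1 = x - a.1.1 - e.1.1 := by
          change x - (a.1.1 + e.1.1) = _
          ring
        rwa [this]
      exact ⟨hy.of_lt h1, hy.of_lt (heq ▸ h1)⟩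
  · exact ⟨a, fun y hy => ⟨hy, hy.of_lt hlt⟩⟩

/-- After translation by `a`, the polynomial has the root `x - a` of value `γ`, hence no dominant
term at `γ`. This transfers to the other side and gives a root of value `δ` there. For `m = 0` only
an element of value `δ` is needed. -/
lemma exists_root_sameDist {m : P.R[X]} (hm : m = 0 ∨ m.Monic) (hroot : (m.map P.fstR).eval x = 0)
    (a : P.R) : ∃ y, (m.map P.sndR).eval y = 0 ∧ P.SameDist x a y := by
  obtain ⟨γ, hγ⟩ := M.exists_val_eq (sub_fst_ne_zero hxR a)
  obtain ⟨δ, hδ⟩ := hP.value _ (E.sub_mem hx (hP.dom.field _ a.2)) γ hγ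
  rcases hm with rfl | hm
  · obtain ⟨z, hz⟩ := N.val_surjective δ
    refine ⟨z + a.1.2, by simp, ?_⟩
    rw [SameDist, hγ, add_sub_cancel_right, hz]
    exact GTop.coe hδ
  · have hcomp : (m.comp (X + C a)).Monic := hm.comp_X_add_C a
    have h1 : ¬ HasDominantTerm M.val γ ((m.comp (X + C a)).map P.fstR) := by
      intro h
      refine h.eval_ne_zero hγ ?_
      rw [Polynomial.map_comp, eval_comp]
      simp only [Polynomial.map_add, map_X, map_C, eval_add, eval_X, eval_C]
      rw [show P.fstR a = a.1.1 from rfl, sub_add_cancel]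
      exact hroot
    rw [P.hasDominantTerm_iff hδ] at h1
    have h2 : ∃ z, ((m.comp (X + C a)).map P.sndR).eval z = 0 ∧ N.val z = δ := by
      by_contra hn
      push Not at hn
      exact h1 (hasDominantTerm_of_roots _ _ rfl (hcomp.map _).ne_zero hn)
    obtain ⟨z, hz, hzδ⟩ := h2
    refine ⟨z + a.1.2, ?_, ?_⟩
    · rw [Polynomial.map_comp, eval_comp] at hz
      simp only [Polynomial.map_add, map_X, map_C, eval_add, eval_X, eval_C] at hz
      exact hz
    · rw [SameDist, hγ, add_sub_cancel_right, hzδ]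
      exact GTop.coe hδ

/-- Directedness reduces finitely many distances to a single one, and saturation passes to all of
them, keeping the polynomial equation. -/
lemma exists_forall_sameDist (hN : N.Saturated) {m : P.R[X]} (hm : m = 0 ∨ m.Monic)
    (hroot : (m.map P.fstR).eval x = 0) :
    ∃ y, (m.map P.sndR).eval y = 0 ∧ ∀ a, P.SameDist x a y := by
  classical
  let S : Set (N.K × N.Γ) := {q | ∃ a : P.R, a.1.2 = q.1 ∧ ∃ p ∈ P.G, p.2 = q.2 ∧
    M.val (x - a.1.1) = (p.1 : M.Γ)}
  have hS : S.Countable := by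
    refine ((countable_R hE.countable hP.dom).prod (countable_G hE.countable hP.dom)).image
      (fun q => (q.1.2, q.2.2)) |>.mono ?_
    rintro q ⟨a, ha, p, hp, hpq, -⟩
    exact ⟨(a.1, p), ⟨a.2, hp⟩, Prod.ext ha hpq⟩
  have hdir : ∀ F : Finset P.R, ∃ c : P.R, ∀ y, P.SameDist x c y → ∀ a ∈ F, P.SameDist x a y := by
    intro F
    induction F using Finset.induction_on with
    | empty => exact ⟨0, by simp⟩
    | insert a F _ ih =>
      obtain ⟨c, hc⟩ := ih
      obtain ⟨d, hd⟩ := exists_sameDist_imp hE hP hx hxR a c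
      refine ⟨d, fun y hy b hb => ?_⟩
      rcases Finset.mem_insert.1 hb with rfl | hb
      exacts [(hd y hy).1, hc y (hd y hy).2 b hb]
  obtain ⟨y, hy, hyS⟩ := hN.field (m.map P.sndR) S hS (by
    intro F hF
    have : ∀ q : N.K × N.Γ, ∃ a : P.R, q ∈ F → a.1.2 = q.1 ∧ ∃ p ∈ P.G, p.2 = q.2 ∧
        M.val (x - a.1.1) = (p.1 : M.Γ) := by
      intro q
      by_cases hq : q ∈ F
      · obtain ⟨a, ha⟩ := hF hq
        exact ⟨a, fun _ => ha⟩
      · exact ⟨0, fun h => absurd h hq⟩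
    choose a ha using this
    obtain ⟨c, hc⟩ := hdir (F.image a)
    obtain ⟨y, hy, hyc⟩ := exists_root_sameDist hE hP hx hxR hm hroot c
    refine ⟨y, hy, fun q hq => ?_⟩
    obtain ⟨h1, p, hp, h2, h3⟩ := ha q hq
    have h4 : GTop P.G _ _ := hc y hyc (a q) (Finset.mem_image_of_mem _ hq)
    rw [← h1, ← h2]
    exact (h4.eq_iff P.pos_iff (GTop.coe hp)).1 h3)
  refine ⟨y, hy, fun a => ?_⟩
  obtain ⟨γ, hγ⟩ := M.exists_val_eq (sub_fst_ne_zero hxR a)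
  obtain ⟨δ, hδ⟩ := hP.value _ (E.sub_mem hx (hP.dom.field _ a.2)) γ hγ
  have := hyS (a.1.2, δ) ⟨a, rfl, (γ, δ), hδ, rfl, hγ⟩
  rw [SameDist, hγ, this]
  exact GTop.coe hδ

end Full

end PIso

end TLoc

end

/-! ### Leading terms and the extension by a field element -/

section
open Polynomial

namespace TLoc

namespace Model

variable {M : Model.{u}}

lemma val_mul_lt_val_mul_sub_mul {z w z' w' : M.K} (h : M.val w < M.val (z - w))
    (h' : M.val w' < M.val (z' - w')) : M.val (w * w') < M.val (z * z' - w * w') := by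
  have hw : M.val w ≠ ⊤ := h.ne_top
  have hw' : M.val w' ≠ ⊤ := h'.ne_top
  have e : z * z' - w * w' = (z - w) * z' + w * (z' - w') := by ring
  rw [e]
  refine (lt_min ?_ ?_).trans_le (M.val.map_add _ _)
  · rw [M.val.map_mul, M.val.map_mul, M.val_eq_of_lt_sub h']
    exact WithTop.add_lt_add_right hw' h
  · rw [M.val.map_mul, M.val.map_mul]
    exact WithTop.add_lt_add_left hw h'

end Model

namespace PIso

variable {M N : Model.{u}}

/-- The two coordinates of `z` have the same leading terms as those of `w`. -/
def SameLead (z w : M.K × N.K) : Prop :=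
  M.val w.1 < M.val (z.1 - w.1) ∧ N.val w.2 < N.val (z.2 - w.2)

lemma SameLead.mul {z w z' w' : M.K × N.K} (h : SameLead z w) (h' : SameLead z' w') :
    SameLead (z * z') (w * w') :=
  ⟨Model.val_mul_lt_val_mul_sub_mul h.1 h'.1, Model.val_mul_lt_val_mul_sub_mul h.2 h'.2⟩

lemma sameLead_refl {z : M.K × N.K} (h : z.1 ≠ 0) (h' : z.2 ≠ 0) : SameLead z z := by
  constructor
  · rw [sub_self, M.val.map_zero]
    exact lt_top_iff_ne_top.2 ((M.val.ne_top_iff).2 h)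
  · rw [sub_self, N.val.map_zero]
    exact lt_top_iff_ne_top.2 ((N.val.ne_top_iff).2 h')

variable (P : PIso M N)

/-- `z` has the same leading term as `b * u ^ l` with a nonzero element `b` of the partial
isomorphism and `l ≤ n`. -/
def HasLead (u : M.K × N.K) (n : ℕ) (z : M.K × N.K) : Prop :=
  ∃ b ∈ P.R, b.1 ≠ 0 ∧ ∃ l ≤ n, SameLead z (b * u ^ l)

variable {P}

lemma HasLead.mul {u z z' : M.K × N.K} {n n' : ℕ} (h : P.HasLead u n z) (h' : P.HasLead u n' z') :
    P.HasLead u (n + n') (z * z') := by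
  obtain ⟨b, hb, hb0, l, hl, hz⟩ := h
  obtain ⟨b', hb', hb0', l', hl', hz'⟩ := h'
  refine ⟨b * b', P.R.mul_mem hb hb', mul_ne_zero hb0 hb0', l + l', by omega, ?_⟩
  have : b * b' * u ^ (l + l') = b * u ^ l * (b' * u ^ l') := by ring
  rw [this]
  exact hz.mul hz'

lemma hasLead_of_mem {u z : M.K × N.K} (hz : z ∈ P.R) (hz0 : z.1 ≠ 0) (n : ℕ) :
    P.HasLead u n z := by
  refine ⟨z, hz, hz0, 0, Nat.zero_le _, ?_⟩
  rw [pow_zero, mul_one]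
  exact sameLead_refl hz0 (mt (P.fst_eq_zero_iff hz).2 hz0)

/-- The evaluation of polynomials over a partial isomorphism at a pair. -/
noncomputable def evalPair (P : PIso M N) (z : M.K × N.K) : P.R[X] →+* M.K × N.K :=
  eval₂RingHom P.R.subtype z

lemma evalPair_fst (z : M.K × N.K) (p : P.R[X]) :
    (P.evalPair z p).1 = (p.map P.fstR).eval z.1 := by
  rw [eval_map]
  exact hom_eval₂ p P.R.subtype (RingHom.fst M.K N.K) z

lemma evalPair_snd (z : M.K × N.K) (p : P.R[X]) :
    (P.evalPair z p).2 = (p.map P.sndR).eval z.2 := by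
  rw [eval_map]
  exact hom_eval₂ p P.R.subtype (RingHom.snd M.K N.K) z

@[simp] lemma evalPair_C (z : M.K × N.K) (a : P.R) : P.evalPair z (C a) = a.1 := eval₂_C _ _

@[simp] lemma evalPair_X (z : M.K × N.K) : P.evalPair z X = z := eval₂_X _ _

/-- Polynomials of admissible degree split over the domain, and leading terms multiply; so linear
factors suffice. The predicate `d` covers both "every degree" and "degree less than that of `m`". -/
lemma hasLead_evalPair {u z : M.K × N.K} {d : ℕ → Prop} (hd : ∀ i j, i ≤ j → d j → d i)
    (hroots : ∀ p : P.R[X], p ≠ 0 → d p.natDegree → ∀ r, (p.map P.fstR).eval r = 0 →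
      ∃ y, (r, y) ∈ P.R)
    (hlin : ∀ a : P.R, P.HasLead u 1 (z - a.1)) (n : ℕ) :
    ∀ p : P.R[X], p ≠ 0 → p.natDegree = n → d n → P.HasLead u n (P.evalPair z p) := by
  induction n with
  | zero =>
    intro p hp0 hp _
    rw [eq_C_of_natDegree_eq_zero hp] at hp0 ⊢
    rw [evalPair_C]
    refine hasLead_of_mem (p.coeff 0).2 (fun h0 => hp0 ?_) 0
    rw [P.fstR_injective ((show P.fstR (p.coeff 0) = P.fstR 0 by rw [map_zero]; exact h0)), C_0]
  | succ n ih =>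
    intro p hp0 hp hdn
    have hmap : (p.map P.fstR).degree ≠ 0 := by
      rw [degree_map_eq_of_injective P.fstR_injective, degree_eq_natDegree hp0, hp]
      exact_mod_cast Nat.succ_ne_zero n
    obtain ⟨r, hr⟩ := IsAlgClosed.exists_root _ hmap
    obtain ⟨y, hy⟩ := hroots p hp0 (hp ▸ hdn) r hr
    let a : P.R := ⟨(r, y), hy⟩
    have ha : p.IsRoot a := by
      apply P.fstR_injective
      rw [map_zero]
      rw [← eval₂_hom, ← eval_map]
      exact hr
    obtain ⟨q, rfl⟩ := dvd_iff_isRoot.2 ha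
    have hq0 : q ≠ 0 := right_ne_zero_of_mul hp0
    rw [natDegree_mul' (by simpa using hq0), natDegree_X_sub_C] at hp
    rw [map_mul, add_comm]
    refine HasLead.mul ?_ (ih q hq0 (by omega) (hd _ _ (Nat.le_succ n) hdn))
    rw [map_sub, evalPair_X, evalPair_C]
    exact hlin a

/-- Extend the field part of a partial isomorphism, with the same residues and values. -/
def extendField (P : PIso M N) (R' : Subring (M.K × N.K)) (hR : P.R ≤ R')
    (hval : ∀ z ∈ R', GTop P.G (M.val z.1) (N.val z.2))
    (hres : ∀ z ∈ R', ∀ w ∈ R', (M.resDiv z.1 w.1, N.resDiv z.2 w.2) ∈ P.D) : PIso M N where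
  R := R'
  D := P.D
  G := P.G
  one_mem := P.one_mem
  pos_iff := P.pos_iff
  val_mem := hval
  sec_mem p hp := hR (P.sec_mem p hp)
  resDiv_mem := hres

/-- Values and residues of quotients depend only on leading terms. Hence the whole ring generated by
`z` over `R` is compatible with the existing values and residues, and by maximality it is already
contained in `R`. -/
lemma mem_R_of_hasLead {E : Subfield M.K} (hP : Maximal (fun S : PIso M N => S.DomLE E) P)
    {z u : M.K × N.K} (hz : z.1 ∈ E) {d : ℕ → Prop}
    (hval : GTop P.G (M.val u.1) (N.val u.2))
    (hres : ∀ b ∈ P.R, b.1 ≠ 0 → ∀ b' ∈ P.R, b'.1 ≠ 0 → ∀ l l', d l → d l' →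
      (M.resDiv (b * u ^ l).1 (b' * u ^ l').1, N.resDiv (b * u ^ l).2 (b' * u ^ l').2) ∈ P.D)
    (hd : ∀ i j, i ≤ j → d j → d i)
    (hlead : ∀ w ∈ (P.evalPair z).range, w = 0 ∨ ∃ n, d n ∧ P.HasLead u n w) : z ∈ P.R := by
  have hle : P.R ≤ (P.evalPair z).range := fun a ha => ⟨C ⟨a, ha⟩, evalPair_C _ _⟩
  have hval' : ∀ w ∈ (P.evalPair z).range, GTop P.G (M.val w.1) (N.val w.2) := by
    intro w hw
    rcases hlead w hw with rfl | ⟨n, -, b, hb, -, l, -, h⟩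
    · simpa using GTop.top
    · rw [M.val_eq_of_lt_sub h.1, N.val_eq_of_lt_sub h.2]
      simp only [Prod.fst_mul, Prod.snd_mul, Prod.pow_fst, Prod.pow_snd, M.val.map_mul,
        N.val.map_mul, M.val.map_pow, N.val.map_pow]
      exact (P.val_mem b hb).add (hval.nsmul l)
  have hres' : ∀ w ∈ (P.evalPair z).range, ∀ w' ∈ (P.evalPair z).range,
      (M.resDiv w.1 w'.1, N.resDiv w.2 w'.2) ∈ P.D := by
    intro w hw w' hw'
    rcases hlead w hw with rfl | ⟨n, hn, b, hb, hb0, l, hl, h⟩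
    · simp only [Prod.fst_zero, Prod.snd_zero, Model.resDiv_zero_left]
      exact P.D.zero_mem
    rcases hlead w' hw' with rfl | ⟨n', hn', b', hb', hb0', l', hl', h'⟩
    · simp only [Prod.fst_zero, Prod.snd_zero, Model.resDiv_zero_right]
      exact P.D.zero_mem
    rw [M.resDiv_congr h.1 h'.1, N.resDiv_congr h.2 h'.2]
    exact hres b hb hb0 b' hb' hb0' l l' (hd _ _ hl hn) (hd _ _ hl' hn')
  have hdom : (P.extendField _ hle hval' hres').DomLE E := by
    refine ⟨?_, hP.prop.resField, hP.prop.valueGroup⟩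
    rintro _ ⟨p, rfl⟩
    change (P.evalPair z p).1 ∈ E
    induction p using Polynomial.induction_on' with
    | add p q hp hq =>
      rw [map_add, Prod.fst_add]
      exact E.add_mem hp hq
    | monomial n a =>
      rw [evalPair_fst, map_monomial, eval_monomial]
      exact E.mul_mem (hP.prop.field a.1 a.2) (E.pow_mem hz n)
  exact (hP.le_of_ge hdom ⟨hle, le_rfl, le_rfl⟩).1 ⟨X, evalPair_X _⟩

section Full

variable {E : Subfield M.K} (hE : M.IsClosedSubfield E) (hP : P.IsFull E)
include hE hP

/-- A polynomial over the partial isomorphism, zero or monic, with a root in `E` outside the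
domain and minimal with this property. -/
lemma exists_minimal_polynomial {x₀ : M.K} (hx₀ : x₀ ∈ E) (hx₀R : ∀ y, (x₀, y) ∉ P.R) :
    ∃ m : P.R[X], (m = 0 ∨ m.Monic) ∧ (∃ x ∈ E, (∀ y, (x, y) ∉ P.R) ∧
      (m.map P.fstR).eval x = 0) ∧
      ∀ p : P.R[X], p ≠ 0 → (m = 0 ∨ p.natDegree < m.natDegree) →
        ∀ r, (p.map P.fstR).eval r = 0 → ∃ y, (r, y) ∈ P.R := by
  classical
  have key : ∀ p : P.R[X], p ≠ 0 → ∀ r, (p.map P.fstR).eval r = 0 → (∀ y, (r, y) ∉ P.R) →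
      ∃ q : P.R[X], q.Monic ∧ q.natDegree = p.natDegree ∧
        ∃ x ∈ E, (∀ y, (x, y) ∉ P.R) ∧ (q.map P.fstR).eval x = 0 := by
    intro p hp r hr hrR
    have hlc : P.fstR p.leadingCoeff ≠ 0 := by
      rw [← map_zero P.fstR]
      exact fun h => hp (leadingCoeff_eq_zero.1 (P.fstR_injective h))
    -- The domain is a field, so the polynomial can be made monic without leaving it.
    let c : P.R := ⟨_, hP.inv_mem _ p.leadingCoeff.2⟩
    have hc : c * p.leadingCoeff = 1 := by
      apply P.fstR_injective
      rw [map_mul, map_one]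
      exact inv_mul_cancel₀ hlc
    have hc0 : c ≠ 0 := left_ne_zero_of_mul (hc ▸ one_ne_zero)
    have hm : (C c * p).Monic := by
      rw [Monic, leadingCoeff_mul' (by rw [leadingCoeff_C, hc]; exact one_ne_zero),
        leadingCoeff_C, hc]
    refine ⟨C c * p, hm, ?_, r, ?_, hrR, ?_⟩
    · exact natDegree_C_mul_of_mul_ne_zero (by rw [hc]; exact one_ne_zero)
    · refine hE.root_mem (p.map P.fstR) ?_ (fun j => ?_) r hr
      · rwa [Ne, Polynomial.map_eq_zero_iff P.fstR_injective]
      · rw [coeff_map]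
        exact hP.dom.field _ (p.coeff j).2
    · rw [Polynomial.map_mul, eval_mul, hr, mul_zero]
  by_cases h : ∃ n, ∃ q : P.R[X], q.Monic ∧ q.natDegree = n ∧
      ∃ x ∈ E, (∀ y, (x, y) ∉ P.R) ∧ (q.map P.fstR).eval x = 0
  · obtain ⟨m, hm, hmn, hx⟩ := Nat.find_spec h
    refine ⟨m, Or.inr hm, hx, fun p hp hdeg r hr => ?_⟩
    by_contra! hn
    obtain ⟨q, hq⟩ := key p hp r hr hn
    have hlt := hdeg.resolve_left hm.ne_zero
    rw [hmn] at hlt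
    exact Nat.find_min h hlt ⟨q, hq⟩
  -- Here all roots of nonzero polynomials over the domain already lie in it; `m = 0` encodes this
  -- transcendental case, where no bound on the degree is imposed.
  · refine ⟨0, Or.inl rfl, ⟨x₀, hx₀, hx₀R, by simp⟩, fun p hp _ r hr => ?_⟩
    by_contra! hn
    obtain ⟨q, hq⟩ := key p hp r hr hn
    exact h ⟨_, q, hq⟩

variable {x : M.K} (hx : x ∈ E) (hxR : ∀ y, (x, y) ∉ P.R) {y : N.K} (hy : ∀ a, P.SameDist x a y)
include hx hxR hy

/-- The case without new values: `x - a` has an element `e` of the domain as its leading term. The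
same holds for `y`, because `y` is at the matching distance from `a + e`. -/
lemma hasLead_one_linear (hval : ∀ a : P.R, ∃ b : P.R, M.val (x - a.1.1) = M.val b.1.1) (a : P.R) :
    P.HasLead 1 1 ((x, y) - a.1) := by
  obtain ⟨b, hb⟩ := hval a
  have hb0 : b.1.1 ≠ 0 := by
    intro h0
    rw [h0, M.val.map_zero, M.val_eq_top_iff] at hb
    exact sub_fst_ne_zero hxR a hb
  obtain ⟨e, he, hlt⟩ := exists_closer hE hP hx hxR hb.ge hb0
  have hc : M.resDiv (x - a.1.1) b.1.1 ≠ 0 := by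
    intro h0
    rw [he, h0, map_zero, zero_mul, sub_zero, hb] at hlt
    exact lt_irrefl _ hlt
  have hve : M.val e.1.1 = M.val b.1.1 := by
    rw [he, M.val.map_mul, M.val_sec hc, zero_add]
  have hsub : x - a.1.1 - e.1.1 = x - (a + e).1.1 := by
    change _ = x - (a.1.1 + e.1.1)
    ring
  have hsub' : y - a.1.2 - e.1.2 = y - (a + e).1.2 := by
    change _ = y - (a.1.2 + e.1.2)
    ring
  have h1 : M.val e.1.1 < M.val (x - (a + e).1.1) := by rwa [hve, ← hsub]
  have h2 := ((P.val_R e).lt_iff P.pos_iff (hy (a + e))).1 h1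
  refine ⟨e.1, e.2, ?_, 0, Nat.zero_le _, ?_⟩
  · intro h0
    rw [h0] at h1
    simp at h1
  · rw [pow_zero, mul_one]
    constructor
    · change _ < M.val (x - a.1.1 - e.1.1)
      rwa [hsub]
    · change _ < N.val (y - a.1.2 - e.1.2)
      rwa [hsub']

omit hE hP hx in
-- The case of a new value: `x - a` is the sum of `x - a₀` and `a₀ - a`, whose values never
-- coincide, so one of the two summands is the leading term.
lemma hasLead_sub_linear {a₀ : P.R} (hval : ∀ b : P.R, M.val (x - a₀.1.1) ≠ M.val b.1.1)
    (a : P.R) : P.HasLead ((x, y) - a₀.1) 1 ((x, y) - a.1) := by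
  rcases lt_or_gt_of_ne (hval (a₀ - a)) with hlt | hlt
  · have h2 := ((hy a₀).lt_iff P.pos_iff (P.val_R (a₀ - a))).1 hlt
    refine ⟨1, P.R.one_mem, one_ne_zero, 1, le_rfl, ?_⟩
    rw [one_mul, pow_one]
    constructor
    · change M.val (x - a₀.1.1) < M.val (x - a.1.1 - (x - a₀.1.1))
      rwa [sub_sub_sub_cancel_left]
    · change N.val (y - a₀.1.2) < N.val (y - a.1.2 - (y - a₀.1.2))
      rwa [sub_sub_sub_cancel_left]
  · have h2 := ((P.val_R (a₀ - a)).lt_iff P.pos_iff (hy a₀)).1 hlt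
    refine ⟨(a₀ - a).1, (a₀ - a).2, ?_, 0, Nat.zero_le _, ?_⟩
    · intro h0
      rw [h0] at hlt
      simp at hlt
    · rw [pow_zero, mul_one]
      constructor
      · change M.val (a₀.1.1 - a.1.1) < M.val (x - a.1.1 - (a₀.1.1 - a.1.1))
        rwa [sub_sub_sub_cancel_right]
      · change N.val (a₀.1.2 - a.1.2) < N.val (y - a.1.2 - (a₀.1.2 - a.1.2))
        rwa [sub_sub_sub_cancel_right]

end Full

/-- A multiple of `val u` is not a value of the domain, if `val u` is not and the domain contains
the roots of polynomials of that degree. -/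
lemma val_pow_ne {u : M.K} {d : ℕ → Prop}
    (hroots : ∀ p : P.R[X], p ≠ 0 → d p.natDegree → ∀ r, (p.map P.fstR).eval r = 0 →
      ∃ y, (r, y) ∈ P.R)
    (hval : ∀ b : P.R, M.val u ≠ M.val b.1.1) {j : ℕ} (hj : j ≠ 0) (hdj : d j) (b : P.R) :
    M.val (u ^ j) ≠ M.val b.1.1 := by
  intro h
  obtain ⟨r, hr⟩ := IsAlgClosed.exists_pow_nat_eq b.1.1 (Nat.pos_of_ne_zero hj)
  obtain ⟨y, hy⟩ := hroots (X ^ j - C b) (X_pow_sub_C_ne_zero (Nat.pos_of_ne_zero hj) b)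
    (by rwa [natDegree_X_pow_sub_C]) r (by
      simp only [Polynomial.map_sub, Polynomial.map_pow, map_X, map_C, eval_sub, eval_pow, eval_X,
        eval_C]
      rw [hr]
      exact sub_self _)
  refine hval ⟨(r, y), hy⟩ ?_
  change M.val u = M.val r
  rw [← hr, M.val.map_pow, M.val.map_pow] at h
  by_cases hu : u = 0
  · subst hu
    exfalso
    exact hval 0 (by simp)
  obtain ⟨α, hα⟩ := M.exists_val_eq hu
  rw [hα, ← WithTop.coe_nsmul] at h
  have hr0 : r ≠ 0 := by
    rintro rfl
    rw [M.val.map_zero, ← Nat.succ_pred_eq_of_ne_zero hj, succ_nsmul (⊤ : WithTop M.Γ), WithTop.add_top] at h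
    exact WithTop.coe_ne_top h
  obtain ⟨β, hβ⟩ := M.exists_val_eq hr0
  rw [hβ, ← WithTop.coe_nsmul, WithTop.coe_inj] at h
  rw [hα, hβ, nsmul_right_injective hj h]

/-- Equal powers of `u` cancel. Different powers give different values, because no admissible
positive multiple of the value of `u` is a value of the domain; the residue is then `0` on both
sides. -/
lemma resDiv_mul_pow_mem (hinv : ∀ p ∈ P.R, p⁻¹ ∈ P.R) {u : M.K × N.K} {d : ℕ → Prop}
    (hd : ∀ i j, i ≤ j → d j → d i)
    (hroots : ∀ p : P.R[X], p ≠ 0 → d p.natDegree → ∀ r, (p.map P.fstR).eval r = 0 →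
      ∃ y, (r, y) ∈ P.R)
    (hval : ∀ b : P.R, M.val u.1 ≠ M.val b.1.1) (hu : GTop P.G (M.val u.1) (N.val u.2)) :
    ∀ b ∈ P.R, b.1 ≠ 0 → ∀ b' ∈ P.R, b'.1 ≠ 0 → ∀ l l', d l → d l' →
      (M.resDiv (b * u ^ l).1 (b' * u ^ l').1, N.resDiv (b * u ^ l).2 (b' * u ^ l').2) ∈ P.D := by
  intro b hb hb0 b' hb' hb0' l l' hl hl'
  have hu0 : u.1 ≠ 0 := fun h => hval 0 (by rw [h]; rfl)
  have hu0' : u.2 ≠ 0 := by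
    rw [← (N.val.ne_top_iff)]
    rw [← (M.val.ne_top_iff)] at hu0
    exact mt (hu.eq_iff P.pos_iff GTop.top).2 hu0
  have hne : ∀ b ∈ P.R, b.1 ≠ 0 → ∀ b' ∈ P.R, b'.1 ≠ 0 → ∀ l l', d l' → l < l' →
      M.val (b * u ^ l).1 ≠ M.val (b' * u ^ l').1 := by
    intro b hb hb0 b' hb' hb0' l l' hl' hlt h
    refine val_pow_ne hroots hval (Nat.sub_pos_of_lt hlt).ne' (hd _ _ (Nat.sub_le l' l) hl')
      ⟨_, P.R.mul_mem hb (hinv _ hb')⟩ ?_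
    have e : (b' * u ^ l').1 = (u.1 ^ (l' - l) * b'.1) * u.1 ^ l := by
      simp only [Prod.fst_mul, Prod.pow_fst]
      rw [mul_right_comm, ← pow_add, Nat.sub_add_cancel hlt.le, mul_comm]
    have hcancel : ∀ {a c d : M.K}, d ≠ 0 → M.val (a * d) = M.val (c * d) → M.val a = M.val c := by
      intro a c d hd' hac
      refine le_antisymm (not_lt.1 fun hlt => ?_) (not_lt.1 fun hlt => ?_)
      · exact ((M.val_mul_lt_mul hd').2 hlt).ne hac.symm
      · exact ((M.val_mul_lt_mul hd').2 hlt).ne hac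
    rw [e] at h
    have h1 := hcancel (pow_ne_zero l hu0) h
    refine hcancel hb0' ?_
    change _ = M.val (b.1 * b'.1⁻¹ * b'.1)
    rw [mul_assoc, inv_mul_cancel₀ hb0', mul_one, h1]
  rcases eq_or_ne l l' with rfl | hll
  · have e1 : M.resDiv (b * u ^ l).1 (b' * u ^ l).1 = M.resDiv b.1 b'.1 :=
      M.resDiv_mul_right (pow_ne_zero l hu0)
    have e2 : N.resDiv (b * u ^ l).2 (b' * u ^ l).2 = N.resDiv b.2 b'.2 :=
      N.resDiv_mul_right (pow_ne_zero l hu0')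
    rw [e1, e2]
    exact P.resDiv_mem b hb b' hb'
  · have hMne : M.val (b * u ^ l).1 ≠ M.val (b' * u ^ l').1 := by
      rcases lt_or_gt_of_ne hll with hlt | hlt
      · exact hne b hb hb0 b' hb' hb0' l l' hl' hlt
      · exact (hne b' hb' hb0' b hb hb0 l' l hl hlt).symm
    have hG : ∀ b ∈ P.R, ∀ l : ℕ, GTop P.G (M.val (b * u ^ l).1) (N.val (b * u ^ l).2) := by
      intro b hb l
      simp only [Prod.fst_mul, Prod.snd_mul, Prod.pow_fst, Prod.pow_snd, M.val.map_mul,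
        N.val.map_mul, M.val.map_pow, N.val.map_pow]
      exact (P.val_mem b hb).add (hu.nsmul l)
    have hNne := mt ((hG b hb l).eq_iff P.pos_iff (hG b' hb' l')).2 hMne
    rw [M.resDiv_eq_zero_of_ne hMne, N.resDiv_eq_zero_of_ne hNne]
    exact P.D.zero_mem

/-- A partial isomorphism with maximal domain in a closed subfield is defined on the subfield. -/
theorem exists_mem_R_of_maximal {E : Subfield M.K} (hN : N.Saturated)
    (hE : M.IsClosedSubfield E) (hP : Maximal (fun S : PIso M N => S.DomLE E) P) {x₀ : M.K}
    (hx₀ : x₀ ∈ E) : ∃ y, (x₀, y) ∈ P.R := by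
  have hfull : P.IsFull E := ⟨hP.prop, fun p hp => P.inv_mem_of_maximal hP hp,
    fun x hx γ hγ => P.exists_mem_G_of_maximal hN hE.countable hP hx hγ,
    fun c hc => P.exists_mem_D_of_maximal hN hE.countable hP hc⟩
  by_contra! hx₀R
  obtain ⟨m, hm, ⟨x, hx, hxR, hmx⟩, hmin⟩ := exists_minimal_polynomial hE hfull hx₀ hx₀R
  obtain ⟨y, hmy, hy⟩ := exists_forall_sameDist hE hfull hx hxR hN hm hmx
  let d : ℕ → Prop := fun n => m = 0 ∨ n < m.natDegree
  have hd : ∀ i j, i ≤ j → d j → d i := fun i j hij hj => hj.imp id hij.trans_lt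
  have hroots : ∀ p : P.R[X], p ≠ 0 → d p.natDegree → ∀ r, (p.map P.fstR).eval r = 0 →
      ∃ y, (r, y) ∈ P.R := hmin
  have hlead : ∀ u : M.K × N.K, (∀ a : P.R, P.HasLead u 1 ((x, y) - a.1)) →
      ∀ w ∈ (P.evalPair (x, y)).range, w = 0 ∨ ∃ n, d n ∧ P.HasLead u n w := by
    rintro u hu _ ⟨p, rfl⟩
    -- Both coordinates are roots of `m`, so division with remainder by `m` does not change the
    -- evaluation at the pair.
    have hred : ∃ q : P.R[X], P.evalPair (x, y) p = P.evalPair (x, y) q ∧ (q = 0 ∨ d q.natDegree) := by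
      rcases hm with rfl | hm
      · exact ⟨p, rfl, Or.inr (Or.inl rfl)⟩
      · have hm0 : P.evalPair (x, y) m = 0 :=
          Prod.ext ((evalPair_fst _ _).trans hmx) ((evalPair_snd _ _).trans hmy)
        refine ⟨p %ₘ m, ?_, Or.inr (Or.inr (natDegree_modByMonic_lt p hm ?_))⟩
        · conv_lhs => rw [← modByMonic_add_div p m]
          rw [map_add, map_mul, hm0, zero_mul, add_zero]
        · rintro rfl
          simp at hmx
    obtain ⟨q, hq, hq'⟩ := hred
    by_cases hq0 : q = 0
    · left
      rw [hq, hq0, map_zero]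
    · have hdq := hq'.resolve_left hq0
      exact Or.inr ⟨_, hdq, hq ▸ hasLead_evalPair hd hroots hu _ q hq0 rfl hdq⟩
  -- Either some difference `x - a₀` has a value that the domain does not attain, and it serves as
  -- `u`, or no new values arise and `u = 1` suffices.
  by_cases hcase : ∃ a₀ : P.R, ∀ b : P.R, M.val (x - a₀.1.1) ≠ M.val b.1.1
  · obtain ⟨a₀, ha₀⟩ := hcase
    exact hxR y (mem_R_of_hasLead hP hx (u := (x, y) - a₀.1) (hy a₀)
      (resDiv_mul_pow_mem hfull.inv_mem hd hroots ha₀ (hy a₀)) hd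
      (hlead _ fun a => hasLead_sub_linear hxR hy ha₀ a))
  · push Not at hcase
    refine hxR y (mem_R_of_hasLead hP hx (u := 1) ?_ ?_ hd
      (hlead _ fun a => hasLead_one_linear hE hfull hx hxR hy hcase a))
    · simpa using GTop.zero
    · intro b hb _ b' hb' _ l l' _ _
      rw [one_pow, one_pow, mul_one, mul_one]
      exact P.resDiv_mem b hb b' hb'

end PIso

end TLoc

end

/-! ### Countable closed subfields and one-element extensions of tuples -/

section
open Polynomial

namespace TLoc

namespace Model

variable (M : Model.{u})

/-- The elements algebraic over the field generated by `A`, and the sections of its residues. -/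
def closureStep (A : Set M.K) : Set M.K :=
  A ∪ {x | ∃ p : M.K[X], p ≠ 0 ∧ (∀ j, p.coeff j ∈ Subfield.closure A) ∧ p.eval x = 0} ∪
    Set.image2 (fun x y => M.sec (M.resDiv x y)) (Subfield.closure A) (Subfield.closure A)

variable {M}

lemma countable_closure {A : Set M.K} (hA : A.Countable) :
    (Subfield.closure A : Set M.K).Countable := by
  rw [← Cardinal.le_aleph0_iff_set_countable] at hA ⊢
  exact (Subfield.cardinalMk_closure_le_max A).trans (max_le hA le_rfl)

lemma countable_closureStep {A : Set M.K} (hA : A.Countable) : (M.closureStep A).Countable := by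
  have hF := countable_closure hA
  refine (hA.union ?_).union (hF.image2 hF _)
  have hc : Countable (Subfield.closure A) := hF.to_subtype
  have := PIso.countable_polynomial hc
  refine (Set.countable_iUnion fun p : (Subfield.closure A)[X] =>
    (p.map (Subfield.closure A).subtype).rootSet_finite M.K |>.countable).mono ?_
  rintro x ⟨p, hp, hpA, hpx⟩
  obtain ⟨q, rfl⟩ := (lifts_iff_coeff_lifts (f := (Subfield.closure A).subtype) p).2 fun j =>
    ⟨⟨_, hpA j⟩, rfl⟩
  refine Set.mem_iUnion.2 ⟨q, ?_⟩
  rw [mem_rootSet]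
  refine ⟨hp, ?_⟩
  rw [← hpx]
  simp [aeval_def, eval_map]

/-- Every countable set is contained in a closed subfield. -/
lemma exists_isClosedSubfield {A : Set M.K} (hA : A.Countable) :
    ∃ E : Subfield M.K, M.IsClosedSubfield E ∧ A ⊆ E := by
  let B : ℕ → Set M.K := fun n => M.closureStep^[n] A
  have hB : ∀ n, B (n + 1) = M.closureStep (B n) := fun n =>
    Function.iterate_succ_apply' _ _ _
  have hsub : ∀ n, B n ⊆ B (n + 1) := fun n x hx => by
    rw [hB]
    exact Or.inl (Or.inl hx)
  have hmono : Monotone fun n => Subfield.closure (B n) :=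
    monotone_nat_of_le_succ fun n => Subfield.closure_mono (hsub n)
  have hcount : ∀ n, (B n).Countable := by
    intro n
    induction n with
    | zero => exact hA
    | succ n ih =>
      rw [hB]
      exact countable_closureStep ih
  have hmem : ∀ {x}, x ∈ (⨆ n, Subfield.closure (B n)) ↔ ∃ n, x ∈ Subfield.closure (B n) :=
    fun {x} => Subfield.mem_iSup_of_directed hmono.directed_le
  refine ⟨⨆ n, Subfield.closure (B n), ⟨?_, ?_, ?_⟩, ?_⟩
  · refine (Set.countable_iUnion fun n => countable_closure (hcount n)).mono fun x hx => ?_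
    exact Set.mem_iUnion.2 (hmem.1 hx)
  · intro p hp hcoef x hx
    have : ∀ j, ∃ n, p.coeff j ∈ Subfield.closure (B n) := fun j => hmem.1 (hcoef j)
    choose n hn using this
    let m := (Finset.range (p.natDegree + 1)).sup n
    have hm : ∀ j, p.coeff j ∈ Subfield.closure (B m) := by
      intro j
      by_cases hj : j ≤ p.natDegree
      · exact hmono (Finset.le_sup (Finset.mem_range.2 (Nat.lt_succ_of_le hj))) (hn j)
      · rw [coeff_eq_zero_of_natDegree_lt (not_le.1 hj)]
        exact zero_mem _
    refine hmem.2 ⟨m + 1, Subfield.subset_closure ?_⟩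
    rw [hB]
    exact Or.inl (Or.inr ⟨p, hp, hm, hx⟩)
  · intro x hx y hy
    obtain ⟨n, hn⟩ := hmem.1 hx
    obtain ⟨n', hn'⟩ := hmem.1 hy
    refine hmem.2 ⟨max n n' + 1, Subfield.subset_closure ?_⟩
    rw [hB]
    exact Or.inr ⟨x, hmono (le_max_left _ _) hn, y, hmono (le_max_right _ _) hn', rfl⟩
  · exact fun x hx => hmem.2 ⟨0, Subfield.subset_closure hx⟩

/-- The elements of the substructure given by a subfield. -/
def InSub (E : Subfield M.K) : (s : Srt) → M.carrier s → Prop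
  | .VF => fun x => x ∈ E
  | .k => fun c => M.sec c ∈ E
  | .Γ => fun γ => ∃ x ∈ E, M.val x = γ

/-- An element of any sort is captured by one field element: itself, its section, or an element with
that value. So a countable tuple needs only a countable subfield. -/
lemma exists_forall_inSub (s : Srt) (a : M.carrier s) :
    ∃ x : M.K, ∀ E : Subfield M.K, x ∈ E → M.InSub E s a := by
  cases s with
  | VF => exact ⟨a, fun E h => h⟩
  | k => exact ⟨M.sec a, fun E h => h⟩
  | Γ =>
    obtain ⟨x, hx⟩ := M.val_surjective a
    exact ⟨x, fun E h => ⟨x, h, hx⟩⟩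

lemma IsClosedSubfield.inSub_fn {E : Subfield M.K} (hE : M.IsClosedSubfield E)
    (hone : ∃ x ∈ E, M.val x = M.one) {l : List Srt} {s : Srt} (f : Fn l s)
    (a : ∀ j : Fin l.length, M.carrier (l.get j)) (h : ∀ j, M.InSub E (l.get j) (a j)) :
    M.InSub E s (M.fn f a) := by
  cases f with
  | vfZero => exact E.zero_mem
  | vfOne => exact E.one_mem
  | vfNeg => exact E.neg_mem (h 0)
  | vfAdd => exact E.add_mem (h 0) (h 1)
  | vfMul => exact E.mul_mem (h 0) (h 1)
  | kZero => exact (E.comap M.sec).zero_mem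
  | kOne => exact (E.comap M.sec).one_mem
  | kNeg => exact (E.comap M.sec).neg_mem (h 0)
  | kAdd => exact (E.comap M.sec).add_mem (h 0) (h 1)
  | kMul => exact (E.comap M.sec).mul_mem (h 0) (h 1)
  | gZero => exact ⟨1, E.one_mem, M.val.map_one⟩
  | gOne => exact hone
  | gNeg =>
    obtain ⟨x, hx, hxa⟩ := h 0
    exact ⟨x⁻¹, E.inv_mem hx, (M.val.map_inv (x := x)).trans (congrArg Neg.neg hxa)⟩
  | gAdd =>
    obtain ⟨x, hx, hxa⟩ := h 0
    obtain ⟨y, hy, hya⟩ := h 1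
    exact ⟨x * y, E.mul_mem hx hy, (M.val.map_mul x y).trans (congrArg₂ (· + ·) hxa hya)⟩
  | val => exact ⟨a 0, h 0, rfl⟩
  | resDiv => exact hE.sec_resDiv_mem _ (h 0) _ (h 1)
  | sec => exact h 0

end Model

/-- Application of a unary function symbol. -/
def app₁ {ι : Type v} {σ : ι → Srt} {s₁ s : Srt} (f : Fn [s₁] s) (t₁ : MSTerm lang σ s₁) :
    MSTerm lang σ s :=
  .app (L := lang) f fun j => match j with | ⟨0, _⟩ => t₁

/-- Application of a binary function symbol. -/
def app₂ {ι : Type v} {σ : ι → Srt} {s₁ s₂ s : Srt} (f : Fn [s₁, s₂] s) (t₁ : MSTerm lang σ s₁)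
    (t₂ : MSTerm lang σ s₂) : MSTerm lang σ s :=
  .app (L := lang) f fun j => match j with | ⟨0, _⟩ => t₁ | ⟨1, _⟩ => t₂

/-- A constant symbol as a term. -/
def app₀ {ι : Type v} {σ : ι → Srt} {s : Srt} (f : Fn [] s) : MSTerm lang σ s :=
  .app (L := lang) f fun j => j.elim0

/-- The atomic formula `t₁ < t₂`. -/
def ltFormula {ι : Type v} {σ : ι → Srt} (t₁ t₂ : MSTerm lang σ .Γ) : MSFormula lang σ :=
  .rel (L := lang) (l := [.Γ, .Γ]) Rel.lt fun j => match j with | ⟨0, _⟩ => t₁ | ⟨1, _⟩ => t₂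

section Generated

variable {M N : Model.{u}} {ι : Type v} {σ : ι → Srt} (e : ∀ i, M.toStructure.carrier (σ i))
  (e' : ∀ i, N.toStructure.carrier (σ i))

/-- The value in a model of a term for a field element. -/
noncomputable def valueVF {M : Model.{u}} (e : ∀ i, M.toStructure.carrier (σ i))
    (t : MSTerm lang σ .VF) : M.K := M.toStructure.value e t

/-- The value in a model of a term for a residue. -/
noncomputable def valuek {M : Model.{u}} (e : ∀ i, M.toStructure.carrier (σ i))
    (t : MSTerm lang σ .k) : M.k := M.toStructure.value e t

/-- The value in a model of a term for a value. -/
noncomputable def valueΓ {M : Model.{u}} (e : ∀ i, M.toStructure.carrier (σ i))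
    (t : MSTerm lang σ .Γ) : WithTop M.Γ := M.toStructure.value e t

variable (h : ∀ φ : MSFormula lang σ, φ.IsQuantifierFree →
  (M.toStructure.Sat φ e ↔ N.toStructure.Sat φ e'))
include h

lemma valueΓ_eq_top_iff (t : MSTerm lang σ .Γ) : valueΓ e t = ⊤ ↔ valueΓ e' t = ⊤ := by
  have := h (.equal t (app₁ .val (app₀ .vfZero))) trivial
  change valueΓ e t = M.val 0 ↔ valueΓ e' t = N.val 0 at this
  rwa [M.val.map_zero, N.val.map_zero] at this

omit h in
lemma value_gTop_aux {G : AddSubgroup (M.Γ × N.Γ)} (t : MSTerm lang σ .Γ)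
    (htop : valueΓ e t = ⊤ ↔ valueΓ e' t = ⊤)
    (hG : ∀ p : M.Γ × N.Γ, valueΓ e t = p.1 → valueΓ e' t = p.2 → p ∈ G) :
    GTop G (valueΓ e t) (valueΓ e' t) := by
  by_cases h0 : valueΓ e t = ⊤
  · exact Or.inl ⟨h0, htop.1 h0⟩
  · obtain ⟨γ, hγ⟩ := WithTop.ne_top_iff_exists.1 h0
    obtain ⟨δ, hδ⟩ := WithTop.ne_top_iff_exists.1 (mt htop.2 h0)
    exact Or.inr ⟨(γ, δ), hG _ hγ.symm hδ.symm, hγ.symm, hδ.symm⟩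

/-- The partial isomorphism generated by two tuples with the same quantifier-free type. -/
noncomputable def generatedPIso : PIso M N where
  R :=
    { carrier := {z | ∃ t, z = (valueVF e t, valueVF e' t)}
      mul_mem' := by
        rintro _ _ ⟨t, rfl⟩ ⟨t', rfl⟩
        exact ⟨app₂ .vfMul t t', rfl⟩
      one_mem' := ⟨app₀ .vfOne, rfl⟩
      add_mem' := by
        rintro _ _ ⟨t, rfl⟩ ⟨t', rfl⟩
        exact ⟨app₂ .vfAdd t t', rfl⟩
      zero_mem' := ⟨app₀ .vfZero, rfl⟩
      neg_mem' := by
        rintro _ ⟨t, rfl⟩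
        exact ⟨app₁ .vfNeg t, rfl⟩ }
  D :=
    { carrier := {z | ∃ t, z = (valuek e t, valuek e' t)}
      mul_mem' := by
        rintro _ _ ⟨t, rfl⟩ ⟨t', rfl⟩
        exact ⟨app₂ .kMul t t', rfl⟩
      one_mem' := ⟨app₀ .kOne, rfl⟩
      add_mem' := by
        rintro _ _ ⟨t, rfl⟩ ⟨t', rfl⟩
        exact ⟨app₂ .kAdd t t', rfl⟩
      zero_mem' := ⟨app₀ .kZero, rfl⟩
      neg_mem' := by
        rintro _ ⟨t, rfl⟩
        exact ⟨app₁ .kNeg t, rfl⟩ }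
  G :=
    { carrier := {p | ∃ t, valueΓ e t = (p.1 : M.Γ) ∧ valueΓ e' t = (p.2 : N.Γ)}
      add_mem' := by
        rintro p p' ⟨t, h1, h2⟩ ⟨t', h1', h2'⟩
        exact ⟨app₂ .gAdd t t', congrArg₂ (· + ·) h1 h1', congrArg₂ (· + ·) h2 h2'⟩
      zero_mem' := ⟨app₀ .gZero, rfl, rfl⟩
      neg_mem' := by
        rintro p ⟨t, h1, h2⟩
        exact ⟨app₁ .gNeg t, congrArg Neg.neg h1, congrArg Neg.neg h2⟩ }
  one_mem := ⟨app₀ .gOne, rfl, rfl⟩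
  pos_iff := by
    rintro p ⟨t, h1, h2⟩
    have := h (ltFormula (app₀ .gZero) t) trivial
    change (0 : WithTop M.Γ) < valueΓ e t ↔ (0 : WithTop N.Γ) < valueΓ e' t at this
    rw [h1, h2] at this
    exact_mod_cast this
  val_mem := by
    rintro _ ⟨t, rfl⟩
    exact value_gTop_aux e e' (app₁ .val t) (valueΓ_eq_top_iff e e' h _)
      fun p h1 h2 => ⟨_, h1, h2⟩
  sec_mem := by
    rintro _ ⟨t, rfl⟩
    exact ⟨app₁ .sec t, rfl⟩
  resDiv_mem := by
    rintro _ ⟨t, rfl⟩ _ ⟨t', rfl⟩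
    exact ⟨app₂ .resDiv t t', rfl⟩

lemma generatedPIso_rel {s : Srt} (t : MSTerm lang σ s) :
    (generatedPIso e e' h).rel s (M.toStructure.value e t) (N.toStructure.value e' t) := by
  cases s with
  | VF => exact ⟨t, rfl⟩
  | k => exact ⟨t, rfl⟩
  | Γ => exact value_gTop_aux e e' t (valueΓ_eq_top_iff e e' h _) fun p h1 h2 => ⟨_, h1, h2⟩

omit h in
lemma inSub_value {E : Subfield M.K} (hE : M.IsClosedSubfield E)
    (hone : ∃ x ∈ E, M.val x = M.one) (he : ∀ i, M.InSub E (σ i) (e i)) {s : Srt}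
    (t : MSTerm lang σ s) : M.InSub E s (M.toStructure.value e t) := by
  induction t with
  | var i => exact he i
  | app f t ih => exact hE.inSub_fn hone f _ ih

/-- Tuples with the same quantifier-free type can be extended by one element, if the target is
saturated. -/
theorem exists_extendAssignment [Countable ι] (hN : N.Saturated) (s : Srt)
    (a : M.toStructure.carrier s) : ∃ b : N.toStructure.carrier s,
      ∀ φ : MSFormula lang (extendSorts σ s), φ.IsQuantifierFree →
        (M.toStructure.Sat φ (M.toStructure.extendAssignment e a) ↔
          N.toStructure.Sat φ (N.toStructure.extendAssignment e' b)) := by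
  choose x hx using fun i => M.exists_forall_inSub (σ i) (e i)
  obtain ⟨y, hy⟩ := M.exists_forall_inSub s a
  obtain ⟨z, hz⟩ := M.exists_forall_inSub .Γ (M.one : WithTop M.Γ)
  -- Generated by witnesses for the tuple, for the new element and for the distinguished value `1`,
  -- so that all term values remain in `E`.
  obtain ⟨E, hE, hsub⟩ := M.exists_isClosedSubfield
    (((Set.countable_range x).insert z).insert y)
  have hone := hz E (hsub (Or.inr (Or.inl rfl)))
  have hdom : (generatedPIso e e' h).DomLE E := by
    have := fun {s} (t : MSTerm lang σ s) => inSub_value e hE hone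
      (fun i => hx i E (hsub (Or.inr (Or.inr ⟨i, rfl⟩)))) t
    refine ⟨?_, ?_, ?_⟩
    · rintro _ ⟨t, rfl⟩
      exact this t
    · rintro _ ⟨t, rfl⟩
      exact this t
    · rintro p ⟨t, h1, -⟩
      obtain ⟨x, hx, hxt⟩ := this t
      exact ⟨x, hx, hxt.trans h1⟩
  obtain ⟨P, hle, hP⟩ := PIso.exists_le_maximal hdom
  have key : ∃ b, P.rel s a b := by
    have ha := hy E (hsub (Or.inl rfl))
    cases s with
    | VF => exact P.exists_mem_R_of_maximal hN hE hP ha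
    | k => exact P.exists_mem_D_of_maximal hN hE.countable hP ha
    | Γ =>
      by_cases h0 : (show WithTop M.Γ from a) = ⊤
      · exact ⟨(⊤ : WithTop N.Γ), Or.inl ⟨h0, rfl⟩⟩
      · obtain ⟨γ, hγ⟩ := WithTop.ne_top_iff_exists.1 h0
        obtain ⟨x, hx, hxa⟩ := ha
        obtain ⟨δ, hδ⟩ := P.exists_mem_G_of_maximal hN hE.countable hP hx (hxa.trans hγ.symm)
        exact ⟨(δ : WithTop N.Γ), Or.inr ⟨_, hδ, hγ.symm, rfl⟩⟩
  obtain ⟨b, hb⟩ := key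
  refine ⟨b, fun φ hφ => P.sat_iff φ hφ ?_⟩
  rintro (_ | i)
  · exact hb
  · exact PIso.rel_mono hle (generatedPIso_rel e e' h (.var i))

end Generated

end TLoc

end

/-! ### From saturated models to quantifier elimination -/

section
open Filter

namespace TLoc

section QuantifierFree

variable {ι : Type v} {σ : ι → Srt}

/-- Atomic formulas: equations between terms of one sort, and inequalities. -/
abbrev Atom (σ : ι → Srt) : Type v :=
  (Σ s, MSTerm lang σ s × MSTerm lang σ s) ⊕ (MSTerm lang σ .Γ × MSTerm lang σ .Γ)

/-- An atomic formula as a formula. -/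
def Atom.toFormula : Atom σ → MSFormula lang σ
  | .inl p => .equal p.2.1 p.2.2
  | .inr p => ltFormula p.1 p.2

lemma Atom.isQuantifierFree (α : Atom σ) : α.toFormula.IsQuantifierFree := by
  cases α <;> trivial

/-- Two tuples satisfy the same atomic formulas from `F`. -/
def SameAtoms (F : Set (Atom σ)) {M N : Model.{u}} (e : ∀ i, M.toStructure.carrier (σ i))
    (e' : ∀ i, N.toStructure.carrier (σ i)) : Prop :=
  ∀ α ∈ F, (M.toStructure.Sat α.toFormula e ↔ N.toStructure.Sat α.toFormula e')

lemma SameAtoms.sat_iff {M N : Model.{u}} {φ : MSFormula lang σ} (hφ : φ.IsQuantifierFree)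
    {e : ∀ i, M.toStructure.carrier (σ i)} {e' : ∀ i, N.toStructure.carrier (σ i)}
    (h : SameAtoms Set.univ e e') : M.toStructure.Sat φ e ↔ N.toStructure.Sat φ e' := by
  induction φ with
  | falsum => exact Iff.rfl
  | @equal ι σ s t₁ t₂ => exact h (.inl ⟨s, t₁, t₂⟩) trivial
  | @rel ι σ l R t =>
    cases R with
    | lt =>
      have e : ∀ (M : Model.{u}) (e : ∀ i, M.toStructure.carrier (σ i)),
        M.toStructure.Sat (.rel (L := lang) Rel.lt t) e ↔
          M.toStructure.Sat (ltFormula (t 0) (t 1)) e := fun M e => Iff.rfl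
      rw [e, e]
      exact h (.inr (t 0, t 1)) trivial
  | imp φ ψ ih₁ ih₂ => exact imp_congr (ih₁ hφ.1 h) (ih₂ hφ.2 h)
  | all => exact hφ.elim

/-- A property that depends only on the truth of finitely many atomic formulas is expressed by a
quantifier-free formula. -/
lemma exists_isQuantifierFree_of_sameAtoms (F : Finset (Atom σ)) :
    ∀ Q : ∀ M : Model.{u}, (∀ i, M.toStructure.carrier (σ i)) → Prop,
      (∀ M N e e', SameAtoms (M := M) (N := N) (F : Set (Atom σ)) e e' → Q M e → Q N e') →
      ∃ ψ : MSFormula lang σ, ψ.IsQuantifierFree ∧ ∀ M e, Q M e ↔ M.toStructure.Sat ψ e := by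
  classical
  induction F using Finset.induction_on with
  | empty =>
    intro Q hQ
    by_cases h : ∃ M e, Q M e
    · obtain ⟨M, e, h⟩ := h
      exact ⟨.imp .falsum .falsum, ⟨trivial, trivial⟩, fun N e' =>
        iff_of_true (hQ M N e e' (fun α hα => by simp at hα) h) id⟩
    · exact ⟨.falsum, trivial, fun N e' => iff_of_false (fun h' => h ⟨N, e', h'⟩) id⟩
  | insert α F _ ih =>
    intro Q hQ
    -- For a fixed truth value of `α`, the property is replaced by its projection to the remaining
    -- atoms: some tuple in some model satisfies `Q`, gives `α` this truth value and agrees on `F`.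
    -- The two resulting formulas are then combined by cases on `α`.
    have key : ∀ p : Prop, ∃ ψ : MSFormula lang σ, ψ.IsQuantifierFree ∧
        ∀ (M : Model.{u}) e, (M.toStructure.Sat α.toFormula e ↔ p) →
          (Q M e ↔ M.toStructure.Sat ψ e) := by
      intro p
      obtain ⟨ψ, hψ, h⟩ := ih (fun M e => ∃ (N : Model.{u}) (e' : ∀ i, N.toStructure.carrier (σ i)),
          SameAtoms (F : Set (Atom σ)) e e' ∧ (N.toStructure.Sat α.toFormula e' ↔ p) ∧ Q N e') (by
        rintro M N e e' hF ⟨N', e'', hF', h⟩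
        exact ⟨N', e'', fun β hβ => (hF β hβ).symm.trans (hF' β hβ), h⟩)
      refine ⟨ψ, hψ, fun M e hα => ?_⟩
      rw [← h]
      constructor
      · exact fun hq => ⟨M, e, fun _ _ => Iff.rfl, hα, hq⟩
      · rintro ⟨N, e', hF, hα', hq⟩
        refine hQ N M e' e (fun β hβ => ?_) hq
        rw [Finset.coe_insert] at hβ
        rcases hβ with rfl | hβ
        · exact hα'.trans hα.symm
        · exact (hF β hβ).symm
    obtain ⟨ψ₁, hψ₁, h₁⟩ := key True
    obtain ⟨ψ₀, hψ₀, h₀⟩ := key False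
    have hα := α.isQuantifierFree
    refine ⟨.imp (.imp (.imp α.toFormula ψ₁) (.imp (.imp (.imp α.toFormula .falsum) ψ₀) .falsum))
      .falsum, ⟨⟨⟨hα, hψ₁⟩, ⟨⟨⟨hα, trivial⟩, hψ₀⟩, trivial⟩⟩, trivial⟩, fun M e => ?_⟩
    have h₁' := h₁ M e
    have h₀' := h₀ M e
    simp only [MSStructure.Sat]
    tauto

end QuantifierFree

/-- A formula is equivalent to a quantifier-free one if its truth depends only on the
quantifier-free type of the tuple, for tuples in saturated models. -/
theorem exists_isQuantifierFree_of_saturated {ι : Type} {σ : ι → Srt} (φ : MSFormula lang σ)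
    (h : ∀ (M N : Model.{u}), M.Saturated → N.Saturated →
      ∀ (e : ∀ i, M.toStructure.carrier (σ i)) (e' : ∀ i, N.toStructure.carrier (σ i)),
        SameAtoms Set.univ e e' → M.toStructure.Sat φ e → N.toStructure.Sat φ e') :
    ∃ ψ : MSFormula lang σ, ψ.IsQuantifierFree ∧
      ∀ (M : Model.{u}) (e : ∀ i, M.toStructure.carrier (σ i)),
        M.toStructure.Sat φ e ↔ M.toStructure.Sat ψ e := by
  classical
  by_cases hF : ∃ F : Finset (Atom σ), ∀ (M N : Model.{u}) e e',
      SameAtoms (M := M) (N := N) (F : Set (Atom σ)) e e' →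
        M.toStructure.Sat φ e → N.toStructure.Sat φ e'
  · obtain ⟨F, hF⟩ := hF
    exact exists_isQuantifierFree_of_sameAtoms F (fun M e => M.toStructure.Sat φ e) hF
  exfalso
  push Not at hF
  choose M N e e' hs h1 h2 using hF
  -- The finite sets make all atomic formulas agree in the limit. The factor `ℕ` makes the
  -- ultrafilter countably incomplete, which gives saturation.
  let U : Ultrafilter (Finset (Atom σ) × ℕ) := Ultrafilter.of atTop
  have hU : (U : Filter (Finset (Atom σ) × ℕ)) ≤ atTop := Ultrafilter.of_le atTop
  have hN : ∀ j, ∀ᶠ i in (U : Filter (Finset (Atom σ) × ℕ)), j ≤ i.2 := by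
    intro j
    filter_upwards [hU (eventually_ge_atTop (∅, j))] with i hi
    exact hi.2
  have hα : ∀ α, ∀ᶠ i in (U : Filter (Finset (Atom σ) × ℕ)), α ∈ i.1 := by
    intro α
    filter_upwards [hU (eventually_ge_atTop ({α}, 0))] with i hi
    exact hi.1 (Finset.mem_singleton_self α)
  have hsat := h (Model.ultra U fun i => M i.1) (Model.ultra U fun i => N i.1)
    (Model.ultra_saturated _ hN) (Model.ultra_saturated _ hN)
    (Model.ultraAssign U _ fun i => e i.1) (Model.ultraAssign U _ fun i => e' i.1) (by
      intro α _
      rw [Model.sat_ultra, Model.sat_ultra]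
      refine eventually_congr ?_
      filter_upwards [hα α] with i hi
      exact hs i.1 α hi)
  rw [Model.sat_ultra, Model.sat_ultra] at hsat
  have := hsat (Eventually.of_forall fun i => h1 i.1)
  obtain ⟨i, hi⟩ := this.exists
  exact h2 i.1 hi

/-- Quantifier elimination. -/
theorem hasQuantifierElimination : HasQuantifierElimination.{u} := by
  intro ι hι σ φ
  suffices H : Finite ι → ∃ ψ : MSFormula lang σ, ψ.IsQuantifierFree ∧
      ∀ (M : Model.{u}) (e : ∀ i, M.toStructure.carrier (σ i)),
        M.toStructure.Sat φ e ↔ M.toStructure.Sat ψ e from H hι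
  clear hι
  induction φ with
  | falsum => exact fun _ => ⟨.falsum, trivial, fun _ _ => Iff.rfl⟩
  | equal t₁ t₂ => exact fun _ => ⟨.equal t₁ t₂, trivial, fun _ _ => Iff.rfl⟩
  | rel R t => exact fun _ => ⟨.rel R t, trivial, fun _ _ => Iff.rfl⟩
  | imp φ₁ φ₂ ih₁ ih₂ =>
    intro hι
    obtain ⟨ψ₁, hψ₁, h₁⟩ := ih₁ hι
    obtain ⟨ψ₂, hψ₂, h₂⟩ := ih₂ hι
    exact ⟨.imp ψ₁ ψ₂, ⟨hψ₁, hψ₂⟩, fun M e => imp_congr (h₁ M e) (h₂ M e)⟩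
  | @all ι σ s φ ih =>
    intro hι
    obtain ⟨ψ, hψ, h⟩ := ih inferInstance
    refine exists_isQuantifierFree_of_saturated _ fun M N hM hN e e' hs hall b => ?_
    -- The challenge `b` lies in `N` and is answered in `M`, so the roles of the two models are
    -- exchanged and saturation of `M` is used.
    obtain ⟨a, ha⟩ := exists_extendAssignment e' e
      (fun χ hχ => (SameAtoms.sat_iff hχ hs).symm) hM s b
    rw [h, ha ψ hψ, ← h]
    exact hall a

end TLoc

end

/-! ### Definable sets through families of functions; stable embeddedness of the value group -/

section

namespace TLoc

/-- Every definable set is defined by a quantifier-free formula in finitely many of the variables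
and parameters. -/
lemma exists_isQuantifierFree_of_definable {M : Model.{u}} {A : Set M.toStructure.Elements}
    {ι : Type v} {σ : ι → Srt} {X : Set (∀ i, M.toStructure.carrier (σ i))}
    (hX : M.toStructure.Definable A X) :
    ∃ (κ : Type) (f : κ → ι ⊕ A)
      (ψ : MSFormula lang fun k => Sum.elim σ (fun a : A => a.1.1) (f k)), ψ.IsQuantifierFree ∧
      ∀ x, x ∈ X ↔ M.toStructure.Sat ψ fun k => M.toStructure.withParams A x (f k) := by
  obtain ⟨φ, hφ⟩ := hX
  obtain ⟨κ, _, f, φ₀, h₀⟩ := φ.exists_finite_support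
  obtain ⟨ψ, hψ, h⟩ := hasQuantifierElimination κ _ φ₀
  refine ⟨κ, f, ψ, hψ, fun x => ?_⟩
  rw [hφ, ← h]
  exact (h₀ M.toStructure (M.toStructure.withParams A x)).symm

/-- Functions to the sorts of a model that are closed under the function symbols, and a Boolean
algebra of sets that contains the sets given by the atomic formulas in these functions. -/
structure FunctionFamily (M : Model.{u}) (Ω : Type w) where
  good : ∀ s, (Ω → M.carrier s) → Prop
  fn : ∀ {l s} (f : Fn l s) (a : ∀ j : Fin l.length, Ω → M.carrier (l.get j)),
    (∀ j, good _ (a j)) → good s fun ω => M.fn f fun j => a j ω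
  sets : Set Ω → Prop
  empty : sets ∅
  imp : ∀ X Y, sets X → sets Y → sets {ω | ω ∈ X → ω ∈ Y}
  eq : ∀ s a b, good s a → good s b → sets {ω | a ω = b ω}
  lt : ∀ a b : Ω → WithTop M.Γ, good .Γ a → good .Γ b → sets {ω | a ω < b ω}

namespace FunctionFamily

variable {M : Model.{u}} {Ω : Type w} (C : FunctionFamily M Ω) {ι : Type v} {σ : ι → Srt}
  {e : Ω → ∀ i, M.toStructure.carrier (σ i)} (he : ∀ i, C.good (σ i) fun ω => e ω i)
include he

lemma good_value {s : Srt} (t : MSTerm lang σ s) :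
    C.good s fun ω => M.toStructure.value (e ω) t := by
  induction t with
  | var i => exact he i
  | app f t ih => exact C.fn f (fun j ω => M.toStructure.value (e ω) (t j)) ih

lemma sets_sat (φ : MSFormula lang σ) (hφ : φ.IsQuantifierFree) :
    C.sets {ω | M.toStructure.Sat φ (e ω)} := by
  induction φ with
  | falsum => exact C.empty
  | equal t₁ t₂ => exact C.eq _ _ _ (C.good_value he t₁) (C.good_value he t₂)
  | rel R t =>
    cases R with
    | lt => exact C.lt _ _ (C.good_value he (t 0)) (C.good_value he (t 1))
  | imp φ ψ ih₁ ih₂ => exact C.imp _ _ (ih₁ he hφ.1) (ih₂ he hφ.2)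
  | all => exact hφ.elim

end FunctionFamily

/-- The family of functions in which field elements and residues are constant. -/
def constantFamily (M : Model.{u}) {Ω : Type w} (S : Subring M.K)
    (hS : ∀ x ∈ S, ∀ y ∈ S, M.sec (M.resDiv x y) ∈ S) (C : (Ω → WithTop M.Γ) → Prop)
    (hone : C fun _ => M.one) (hval : ∀ x ∈ S, C fun _ => M.val x)
    (hneg : ∀ a, C a → C fun ω => -a ω) (hadd : ∀ a b, C a → C b → C fun ω => a ω + b ω)
    (B : Set Ω → Prop) (empty : B ∅) (imp : ∀ X Y, B X → B Y → B {ω | ω ∈ X → ω ∈ Y})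
    (eq : ∀ a b, C a → C b → B {ω | a ω = b ω}) (lt : ∀ a b, C a → C b → B {ω | a ω < b ω}) :
    FunctionFamily M Ω where
  good s := match s with
    | .VF => fun a => ∃ x ∈ S, a = fun _ => x
    | .k => fun a => ∃ c, M.sec c ∈ S ∧ a = fun _ => c
    | .Γ => C
  fn {l s} f a h := by
    cases f with
    | vfZero => exact ⟨0, S.zero_mem, rfl⟩
    | vfOne => exact ⟨1, S.one_mem, rfl⟩
    | vfNeg =>
      obtain ⟨x, hx, h1⟩ := h 0
      exact ⟨_, S.neg_mem hx, funext fun ω => congrArg (fun a : M.K => -a) (congrFun h1 ω)⟩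
    | vfAdd =>
      obtain ⟨x, hx, h1⟩ := h 0
      obtain ⟨y, hy, h2⟩ := h 1
      exact ⟨_, S.add_mem hx hy,
        funext fun ω => congrArg₂ (fun a b : M.K => a + b) (congrFun h1 ω) (congrFun h2 ω)⟩
    | vfMul =>
      obtain ⟨x, hx, h1⟩ := h 0
      obtain ⟨y, hy, h2⟩ := h 1
      exact ⟨_, S.mul_mem hx hy,
        funext fun ω => congrArg₂ (fun a b : M.K => a * b) (congrFun h1 ω) (congrFun h2 ω)⟩
    | kZero => exact ⟨0, (S.comap M.sec).zero_mem, rfl⟩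
    | kOne => exact ⟨1, (S.comap M.sec).one_mem, rfl⟩
    | kNeg =>
      obtain ⟨x, hx, h1⟩ := h 0
      exact ⟨_, (S.comap M.sec).neg_mem hx, funext fun ω => congrArg (fun a : M.k => -a) (congrFun h1 ω)⟩
    | kAdd =>
      obtain ⟨x, hx, h1⟩ := h 0
      obtain ⟨y, hy, h2⟩ := h 1
      exact ⟨_, (S.comap M.sec).add_mem hx hy,
        funext fun ω => congrArg₂ (fun a b : M.k => a + b) (congrFun h1 ω) (congrFun h2 ω)⟩
    | kMul =>
      obtain ⟨x, hx, h1⟩ := h 0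
      obtain ⟨y, hy, h2⟩ := h 1
      exact ⟨_, (S.comap M.sec).mul_mem hx hy,
        funext fun ω => congrArg₂ (fun a b : M.k => a * b) (congrFun h1 ω) (congrFun h2 ω)⟩
    | gZero =>
      have := hval 1 S.one_mem
      rw [M.val.map_one] at this
      exact this
    | gOne => exact hone
    | gNeg => exact hneg _ (h 0)
    | gAdd => exact hadd _ _ (h 0) (h 1)
    | val =>
      obtain ⟨x, hx, h1⟩ := h 0
      have e : (fun _ : Ω => M.val x) = fun ω => M.val (a 0 ω) :=
        funext fun ω => congrArg M.val (congrFun h1 ω).symm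
      exact e ▸ hval x hx
    | resDiv =>
      obtain ⟨x, hx, h1⟩ := h 0
      obtain ⟨y, hy, h2⟩ := h 1
      exact ⟨_, hS x hx y hy,
        funext fun ω => congrArg₂ M.resDiv (congrFun h1 ω) (congrFun h2 ω)⟩
    | sec =>
      obtain ⟨x, hx, h1⟩ := h 0
      exact ⟨_, hx, funext fun ω => congrArg M.sec (congrFun h1 ω)⟩
  sets := B
  empty := empty
  imp := imp
  eq s a b ha hb := by
    have hconst : ∀ p : Prop, B {_ω | p} := by
      intro p
      by_cases hp : p
      · have := imp _ _ empty empty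
        simpa [hp] using this
      · simpa [hp] using empty
    cases s with
    | VF =>
      obtain ⟨x, -, rfl⟩ := ha
      obtain ⟨y, -, rfl⟩ := hb
      exact hconst (x = y)
    | k =>
      obtain ⟨x, -, rfl⟩ := ha
      obtain ⟨y, -, rfl⟩ := hb
      exact hconst (x = y)
    | Γ => exact eq a b ha hb
  lt := lt

/-- The value group is stably embedded. -/
theorem stablyEmbedded_valueGroup (M : Model.{u}) : M.toStructure.StablyEmbedded .Γ M.valueGroup := by
  intro n X _ hX
  let A : Set M.toStructure.Elements := Sigma.mk Srt.Γ '' M.valueGroup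
  let Ω := Fin n → M.toStructure.carrier .Γ
  let τ : Fin n ⊕ A → Srt := Sum.elim (fun _ : Fin n => Srt.Γ) fun a : A => a.1.1
  let C : (Ω → WithTop M.Γ) → Prop := fun a =>
    ∃ t : MSTerm lang τ .Γ, ∀ ω, a ω = M.toStructure.value (M.toStructure.withParams A ω) t
  have hconst : ∀ γ : WithTop M.Γ, C fun _ => γ := by
    intro γ
    cases γ with
    -- The element `∞` is not an allowed parameter, but it is the value of `0`.
    | top => exact ⟨app₁ .val (app₀ .vfZero), fun ω => M.val.map_zero.symm⟩
    | coe γ =>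
      exact ⟨.var (Sum.inr (⟨⟨Srt.Γ, (γ : WithTop M.Γ)⟩, ⟨_, ⟨γ, rfl⟩, rfl⟩⟩ : A)), fun ω => rfl⟩
  -- Arbitrary field and residue parameters are admitted as constants; they influence the sort `Γ`
  -- only through their values, which are named by parameters from `Γ`.
  let F : FunctionFamily M Ω := constantFamily M ⊤ (fun _ _ _ _ => trivial) C (hconst _)
    (fun _ _ => hconst _)
    (by
      rintro a ⟨t, ht⟩
      exact ⟨app₁ .gNeg t, fun ω => congrArg Neg.neg (ht ω)⟩)
    (by
      rintro a b ⟨t, ht⟩ ⟨t', ht'⟩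
      exact ⟨app₂ .gAdd t t', fun ω =>
        congrArg₂ (fun a b : WithTop M.Γ => a + b) (ht ω) (ht' ω)⟩)
    (fun X => M.toStructure.DefinablePower A .Γ X) MSStructure.Definable.falsum
    (fun _ _ h h' => h.imp h')
    (by
      rintro a b ⟨t, ht⟩ ⟨t', ht'⟩
      exact ⟨.equal t t', fun ω => iff_of_eq (congrArg₂ (· = ·) (ht ω) (ht' ω))⟩)
    (by
      rintro a b ⟨t, ht⟩ ⟨t', ht'⟩
      exact ⟨ltFormula t t', fun ω => iff_of_eq (congrArg₂ (· < ·) (ht ω) (ht' ω))⟩)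
  obtain ⟨κ, f, ψ, hψ, h⟩ := exists_isQuantifierFree_of_definable hX
  have key := F.sets_sat (e := fun ω k => M.toStructure.withParams Set.univ ω (f k)) (by
    intro k
    rcases f k with i | ⟨⟨s, a⟩, ha⟩
    · exact ⟨.var (Sum.inl i), fun ω => rfl⟩
    · cases s with
      | VF => exact ⟨a, trivial, rfl⟩
      | k => exact ⟨a, trivial, rfl⟩
      | Γ => exact hconst a) ψ hψ
  exact MSStructure.Definable.congr key h

/-! ### Definability in an interpreted one-sorted structure -/

section Translation

open FirstOrder

variable {S : Type} {Λ : MSLanguage S} (M : MSStructure.{u} Λ) {L : FirstOrder.Language.{0, 0}} {F : Type u}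
  [L.Structure F] {s : S} (j : F → M.carrier s)

/-- The set of tuples of elements of `F`, as elements of `M`, that satisfy a formula. -/
def translatedSet {n m : ℕ} (φ : L.BoundedFormula (Fin n) m) : Set (Fin n ⊕ Fin m → M.carrier s) :=
  {z | ∃ w : Fin n ⊕ Fin m → F, (∀ i, z i = j (w i)) ∧ φ.Realize (w ∘ Sum.inl) (w ∘ Sum.inr)}

variable {M j} (hj : Function.Injective j)
  (hrange : M.Definable ∅ (σ := fun _ : Unit => s) {z | z () ∈ Set.range j})
  (hfun : ∀ {n} (f : L.Functions n) {ι : Type u} {σ : ι → S} (t : Fin n → MSTerm Λ σ s),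
    ∃ t' : MSTerm Λ σ s, ∀ e (x : Fin n → F), (∀ i, M.value e (t i) = j (x i)) →
      M.value e t' = j (FirstOrder.Language.Structure.funMap f x))
  (hrel : ∀ {n} (R : L.Relations n) {ι : Type u} {σ : ι → S} (t : Fin n → MSTerm Λ σ s),
    ∃ φ : MSFormula Λ σ, ∀ e (x : Fin n → F), (∀ i, M.value e (t i) = j (x i)) →
      (M.Sat φ e ↔ FirstOrder.Language.Structure.RelMap R x))
include hj hrange hfun hrel

omit hj hrange hrel in
lemma exists_translated_term {ι : Type} (t : L.Term ι) :
    ∃ t' : MSTerm Λ (Sum.elim (fun _ : ι => s) fun a : (∅ : Set M.Elements) => a.1.1) s,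
      ∀ (z : ι → M.carrier s) (w : ι → F), (∀ i, z i = j (w i)) →
        M.value (M.withParams ∅ z) t' = j (t.realize w) := by
  induction t with
  | var i => exact ⟨.var (Sum.inl i), fun z w h => h i⟩
  | func f t ih =>
    choose t' ht' using ih
    obtain ⟨t₀, h₀⟩ := hfun f t'
    exact ⟨t₀, fun z w h => h₀ _ _ fun i => ht' i z w h⟩

omit hj hfun hrel in
lemma definable_forall_mem_range {ι : Type} [Finite ι] :
    M.Definable ∅ (σ := fun _ : ι => s) {z | ∀ i, z i ∈ Set.range j} := by
  have := Fintype.ofFinite ι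
  refine (MSStructure.Definable.biInter Finset.univ
    (F := fun i => {z : ι → M.carrier s | z i ∈ Set.range j}) fun i _ => ?_).congr fun z => by simp
  refine hrange.reindex (fun _ => i) (fun _ => rfl) fun x z h => ?_
  have : z () = x i := eq_of_heq (h ())
  simp only [Set.mem_ofPred_eq, this]

omit hrange hfun hrel in
lemma mem_translatedSet_iff {n m : ℕ} {φ : L.BoundedFormula (Fin n) m}
    {z : Fin n ⊕ Fin m → M.carrier s} {w : Fin n ⊕ Fin m → F} (h : ∀ i, z i = j (w i)) :
    z ∈ translatedSet M j φ ↔ φ.Realize (w ∘ Sum.inl) (w ∘ Sum.inr) := by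
  constructor
  · rintro ⟨w', hw', hφ⟩
    have : w' = w := funext fun i => hj ((hw' i).symm.trans (h i))
    rwa [← this]
  · exact fun hφ => ⟨w, h, hφ⟩

/-- Symbols are translated by hypothesis and quantifiers are relativised to the range of `j`. Every
set is intersected with the tuples from this range, so that complements stay inside it. -/
lemma definable_translatedSet {n m : ℕ} (φ : L.BoundedFormula (Fin n) m) :
    M.Definable ∅ (σ := fun _ : Fin n ⊕ Fin m => s) (translatedSet M j φ) := by
  have hU : ∀ m : ℕ, M.Definable ∅ (σ := fun _ : Fin n ⊕ Fin m => s)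
      {z | ∀ i, z i ∈ Set.range j} := fun m => definable_forall_mem_range hrange
  have hsub : ∀ {m} (φ : L.BoundedFormula (Fin n) m), ∀ z ∈ translatedSet M j φ,
      ∀ i, z i ∈ Set.range j := fun φ z ⟨w, hw, _⟩ i => ⟨w i, (hw i).symm⟩
  have hcongr : ∀ {m} (φ : L.BoundedFormula (Fin n) m) {Y : Set (Fin n ⊕ Fin m → M.carrier s)},
      M.Definable ∅ (σ := fun _ : Fin n ⊕ Fin m => s) Y →
      (∀ z w, (∀ i, z i = j (w i)) → (z ∈ Y ↔ φ.Realize (w ∘ Sum.inl) (w ∘ Sum.inr))) →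
      M.Definable ∅ (σ := fun _ : Fin n ⊕ Fin m => s) (translatedSet M j φ) := by
    intro m φ Y hY h
    refine ((hU m).inter hY).congr fun z => ⟨fun hz => ⟨hsub φ z hz, ?_⟩, fun ⟨hz, hz'⟩ => ?_⟩
    · obtain ⟨w, hw, hφ⟩ := hz
      exact (h z w hw).2 hφ
    · choose w hw using hz
      exact ⟨w, fun i => (hw i).symm, (h z w fun i => (hw i).symm).1 hz'⟩
  induction φ with
  | falsum => exact hcongr _ .falsum fun z w h => Iff.rfl
  | equal t₁ t₂ =>
    obtain ⟨t₁', h₁⟩ := exists_translated_term (M := M) hfun t₁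
    obtain ⟨t₂', h₂⟩ := exists_translated_term (M := M) hfun t₂
    refine hcongr _ ⟨.equal t₁' t₂', fun z => Iff.rfl⟩ fun z w h => ?_
    change M.value (M.withParams ∅ z) t₁' = M.value (M.withParams ∅ z) t₂' ↔ _
    rw [h₁ z w h, h₂ z w h, hj.eq_iff]
    change _ ↔ _ = _
    rw [Sum.elim_comp_inl_inr]
  | rel R t =>
    choose t' ht' using fun i => exists_translated_term (M := M) hfun (t i)
    obtain ⟨ψ, hψ⟩ := hrel R t'
    refine hcongr _ ⟨ψ, fun z => Iff.rfl⟩ fun z w h => ?_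
    refine (hψ (M.withParams ∅ z) _ fun i => ht' i z w h).trans ?_
    change _ ↔ FirstOrder.Language.Structure.RelMap R _
    rw [Sum.elim_comp_inl_inr]
  | imp φ ψ ih₁ ih₂ =>
    refine hcongr _ (ih₁.imp ih₂) fun z w h => ?_
    exact imp_congr (mem_translatedSet_iff hj h) (mem_translatedSet_iff hj h)
  | @all m φ ih =>
    let f : Fin n ⊕ Fin (m + 1) → Option (Fin n ⊕ Fin m) :=
      Sum.elim (fun i => some (Sum.inl i)) (Fin.snoc (fun i => some (Sum.inr i)) none)
    -- The new variable `none` becomes the last bound variable. The tuple `z` is determined by `y`;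
    -- quantifying over it avoids transport along equalities of sorts.
    have hY : M.Definable ∅ (σ := extendSorts (fun _ : Fin n ⊕ Fin m => s) s)
        {y | y none ∈ Set.range j → ∀ z : Fin n ⊕ Fin (m + 1) → M.carrier s,
          (∀ i, z i ≍ y (f i)) → z ∈ translatedSet M j φ} := by
      have hsort : ∀ o, extendSorts (fun _ : Fin n ⊕ Fin m => s) s o = s := by
        rintro (_ | _) <;> rfl
      refine (MSStructure.Definable.reindex hrange (fun _ => none) (fun _ => rfl) ?_).imp
        (MSStructure.Definable.reindex ih f (fun i => (hsort _).symm) ?_)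
      · intro x z h
        have : z () = x none := eq_of_heq (h ())
        exact iff_of_eq (congrArg (· ∈ Set.range j) this.symm)
      · intro x z h
        refine ⟨fun h' => h' z h, fun hz z' hz' => ?_⟩
        have : z' = z := funext fun i => eq_of_heq ((hz' i).trans (h i).symm)
        rwa [this]
    refine hcongr _ hY.all fun z w h => ?_
    simp only [Set.mem_ofPred_eq, FirstOrder.Language.BoundedFormula.realize_all]
    have hext : ∀ (a : M.carrier s) {o o'}, o = o' →
        M.extendAssignment (σ := fun _ : Fin n ⊕ Fin m => s) z a o ≍
          M.extendAssignment (σ := fun _ : Fin n ⊕ Fin m => s) z a o' := by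
      rintro a o _ rfl
      exact HEq.rfl
    have hlast : f (Sum.inr (Fin.last m)) = none := by
      simp only [f, Sum.elim_inr, Fin.snoc_last]
    have hcast : ∀ i : Fin m, f (Sum.inr i.castSucc) = some (Sum.inr i) :=
      fun i => by simp only [f, Sum.elim_inr, Fin.snoc_castSucc]
    have key : ∀ (a : F) (z' : Fin n ⊕ Fin (m + 1) → M.carrier s),
        (∀ i, z' i ≍ M.extendAssignment (σ := fun _ : Fin n ⊕ Fin m => s) z (j a) (f i)) →
        (z' ∈ translatedSet M j φ ↔ φ.Realize (w ∘ Sum.inl) (Fin.snoc (w ∘ Sum.inr) a)) := by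
      intro a z' hz'
      rw [mem_translatedSet_iff hj (w := Sum.elim (w ∘ Sum.inl) (Fin.snoc (w ∘ Sum.inr) a))]
      · simp
      · rintro (i | i)
        · exact (eq_of_heq (hz' (Sum.inl i))).trans (h _)
        · have := hz' (Sum.inr i)
          revert this
          refine Fin.lastCases ?_ (fun i => ?_) i
          · intro h'
            simp only [Sum.elim_inr, Fin.snoc_last]
            exact eq_of_heq (h'.trans (hext _ hlast))
          · intro h'
            simp only [Sum.elim_inr, Fin.snoc_castSucc]
            exact (eq_of_heq (h'.trans (hext _ (hcast i)))).trans (h _)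
    constructor
    · intro hall a
      let z' : Fin n ⊕ Fin (m + 1) → M.carrier s :=
        Sum.elim (fun i => z (Sum.inl i)) (Fin.snoc (fun i => z (Sum.inr i)) (j a))
      have hz' : ∀ i, z' i ≍ M.extendAssignment (σ := fun _ : Fin n ⊕ Fin m => s) z (j a) (f i) := by
        rintro (i | i)
        · exact HEq.rfl
        · refine Fin.lastCases ?_ (fun i => ?_) i
          · refine HEq.trans (heq_of_eq ?_) (hext _ hlast.symm)
            simp only [z', Sum.elim_inr, Fin.snoc_last]
            rfl
          · refine HEq.trans (heq_of_eq ?_) (hext _ (hcast i).symm)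
            simp only [z', Sum.elim_inr, Fin.snoc_castSucc]
            rfl
      exact (key a z' hz').1 (hall (j a) ⟨a, rfl⟩ z' hz')
    · rintro hφ _ ⟨a, rfl⟩ z' hz'
      exact (key a z' hz').2 (hφ a)

/-- Sets that are definable in an interpreted structure are definable. -/
lemma definable_image_of_definable {n : ℕ} {X : Set (Fin n → F)}
    (hX : (∅ : Set F).Definable L X) :
    M.DefinablePower ∅ s ((fun (x : Fin n → F) i => j (x i)) '' X) := by
  obtain ⟨φ, rfl⟩ := Set.empty_definable_iff.1 hX
  refine MSStructure.Definable.reindex (definable_translatedSet hj hrange hfun hrel φ)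
    (Sum.elim id Fin.elim0) (by rintro (i | i); exacts [rfl, i.elim0]) fun x z h => ?_
  constructor
  · rintro ⟨w, hw, rfl⟩
    refine ⟨Sum.elim w Fin.elim0, ?_, ?_⟩
    · rintro (i | i)
      exacts [eq_of_heq (h (Sum.inl i)), i.elim0]
    · convert hw using 1
      exact iff_of_eq (congrArg _ (Subsingleton.elim _ _))
  · rintro ⟨w, hw, hφ⟩
    refine ⟨w ∘ Sum.inl, ?_, funext fun i => ?_⟩
    · change FirstOrder.Language.BoundedFormula.Realize φ (w ∘ Sum.inl) default
      rwa [Subsingleton.elim (default : Fin 0 → F) (w ∘ Sum.inr)]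
    · exact (hw _).symm.trans (eq_of_heq (h (Sum.inl i)))

end Translation

end TLoc

end

/-! ### Induced structure on the value group -/

section

namespace TLoc

section OrderedGroup

open FirstOrder

/-- The structure induced on the value group is that of an ordered group with a distinguished
element. -/
theorem valueGroupInducedPure (M : Model.{u}) : M.ValueGroupInducedPure := by
  intro n X
  let := ogStructure M.Γ M.one
  change _ ↔ (∅ : Set M.Γ).Definable ogLang X
  constructor
  · intro hX
    let Ω := Fin n → M.Γ
    let C : (Ω → WithTop M.Γ) → Prop := fun a =>
      (∀ ω, a ω = ⊤) ∨ ∃ t : ogLang.Term (Fin n), ∀ ω, a ω = (t.realize ω : M.Γ)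
    -- Without parameters the field terms can be kept in the image of the section, whose elements
    -- have value `0` or `∞`. So every `Γ`-valued function is constantly `∞` or a term of the
    -- ordered group.
    let F : FunctionFamily M Ω := constantFamily M M.sec.range (fun _ _ _ _ => ⟨_, rfl⟩) C
      (Or.inr ⟨FirstOrder.Language.Constants.term (L := ogLang) OGFn.one, fun ω => rfl⟩)
      (by
        rintro _ ⟨c, rfl⟩
        by_cases hc : c = 0
        · exact Or.inl fun _ => by rw [hc, map_zero, M.val.map_zero]
        · exact Or.inr ⟨FirstOrder.Language.Constants.term (L := ogLang) OGFn.zero,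
            fun ω => by rw [M.val_sec hc]; rfl⟩)
      (by
        rintro a (h | ⟨t, ht⟩)
        · exact Or.inl fun ω => congrArg (fun a : WithTop M.Γ => -a) (h ω)
        · exact Or.inr ⟨FirstOrder.Language.Functions.apply₁ (L := ogLang) OGFn.neg t,
            fun ω => congrArg (fun a : WithTop M.Γ => -a) (ht ω)⟩)
      (by
        rintro a b (h | ⟨t, ht⟩) h'
        · exact Or.inl fun ω => (congrArg (· + b ω) (h ω)).trans (WithTop.top_add _)
        · rcases h' with h' | ⟨t', ht'⟩
          · exact Or.inl fun ω => (congrArg (a ω + ·) (h' ω)).trans (WithTop.add_top _)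
          · exact Or.inr ⟨FirstOrder.Language.Functions.apply₂ (L := ogLang) OGFn.add t t',
              fun ω => congrArg₂ (fun a b : WithTop M.Γ => a + b) (ht ω) (ht' ω)⟩)
      (fun X => (∅ : Set M.Γ).Definable ogLang X) Set.definable_empty
      (fun X Y hX hY => by
        have : {ω | ω ∈ X → ω ∈ Y} = Xᶜ ∪ Y := by
          ext ω
          exact imp_iff_not_or
        rw [this]
        exact hX.compl.union hY)
      (by
        rintro a b (h | ⟨t, ht⟩) (h' | ⟨t', ht'⟩)
        · simp only [h, h', Set.ofPred_true]
          exact Set.definable_univ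
        · simp only [h, ht', WithTop.top_ne_coe, Set.ofPred_false]
          exact Set.definable_empty
        · simp only [h', ht, WithTop.coe_ne_top, Set.ofPred_false]
          exact Set.definable_empty
        · refine Set.empty_definable_iff.2 ⟨t.equal t', ?_⟩
          ext ω
          simp only [Set.mem_ofPred_eq, ht, ht', WithTop.coe_inj]
          exact FirstOrder.Language.Formula.realize_equal.symm)
      (by
        rintro a b (h | ⟨t, ht⟩) (h' | ⟨t', ht'⟩)
        · simp only [h, h', lt_irrefl, Set.ofPred_false]
          exact Set.definable_empty
        · simp only [h, ht', not_top_lt, Set.ofPred_false]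
          exact Set.definable_empty
        · simp only [h', ht, WithTop.coe_lt_top, Set.ofPred_true]
          exact Set.definable_univ
        · refine Set.empty_definable_iff.2
            ⟨FirstOrder.Language.Relations.formula₂ (L := ogLang) OGRel.lt t t', ?_⟩
          ext ω
          simp only [Set.mem_ofPred_eq, ht, ht', WithTop.coe_lt_coe]
          refine Iff.trans ?_ (FirstOrder.Language.Formula.realize_rel₂ (L := ogLang)).symm
          exact Iff.rfl)
    obtain ⟨κ, f, ψ, hψ, h⟩ := exists_isQuantifierFree_of_definable hX
    have key := F.sets_sat (e := fun ω k => M.toStructure.withParams ∅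
      (σ := fun _ : Fin n => Srt.Γ) (fun i => ((ω i : M.Γ) : WithTop M.Γ)) (f k)) (by
      intro k
      rcases f k with i | ⟨_, ha⟩
      · exact Or.inr ⟨.var i, fun ω => rfl⟩
      · exact ha.elim) ψ hψ
    change (∅ : Set M.Γ).Definable ogLang _ at key
    convert key using 1
    ext ω
    refine Iff.trans ?_ (h _)
    constructor
    · exact fun hω => ⟨ω, hω, rfl⟩
    · rintro ⟨ω', hω', he⟩
      have : ω' = ω := funext fun i => WithTop.coe_inj.1 (congrFun he i)
      rwa [← this]
  · intro hX
    refine definable_image_of_definable (M := M.toStructure) (L := ogLang) (s := Srt.Γ)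
      (j := fun γ : M.Γ => (γ : WithTop M.Γ)) WithTop.coe_injective ?_ ?_ ?_ hX
    · refine MSStructure.Definable.compl
        ⟨.equal (.var (Sum.inl ())) (app₁ .val (app₀ .vfZero)), fun z => ?_⟩ |>.congr
          (X := {z | (show WithTop M.Γ from z ()) = ⊤}ᶜ) fun z => ?_
      · change (show WithTop M.Γ from z ()) = ⊤ ↔ (show WithTop M.Γ from z ()) = M.val 0
        rw [M.val.map_zero]
      · exact WithTop.ne_top_iff_exists.symm
    · intro n f ι σ t
      cases f with
      | zero => exact ⟨app₀ .gZero, fun e x h => rfl⟩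
      | one => exact ⟨app₀ .gOne, fun e x h => rfl⟩
      | neg => exact ⟨app₁ .gNeg (t 0), fun e x h =>
          congrArg (fun a : WithTop M.Γ => -a) (h 0)⟩
      | add => exact ⟨app₂ .gAdd (t 0) (t 1), fun e x h =>
          congrArg₂ (fun a b : WithTop M.Γ => a + b) (h 0) (h 1)⟩
    · intro n R ι σ t
      cases R with
      | lt =>
        refine ⟨ltFormula (t 0) (t 1), fun e x h => ?_⟩
        refine (iff_of_eq (congrArg₂ (fun a b : WithTop M.Γ => a < b) (h 0) (h 1))).trans ?_
        exact WithTop.coe_lt_coe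

end OrderedGroup

end TLoc

end

/-! ### Functions on powers of the residue field -/

section

namespace TLoc

/-- A Boolean algebra of subsets of `Ω`. -/
structure SetAlgebra (Ω : Type w) where
  sets : Set Ω → Prop
  empty : sets ∅
  imp : ∀ X Y, sets X → sets Y → sets {ω | ω ∈ X → ω ∈ Y}

namespace SetAlgebra

variable {Ω : Type w} (B : SetAlgebra Ω)

lemma compl {X : Set Ω} (hX : B.sets X) : B.sets Xᶜ := B.imp _ _ hX B.empty

lemma inter {X Y : Set Ω} (hX : B.sets X) (hY : B.sets Y) : B.sets (X ∩ Y) := by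
  convert B.compl (B.imp _ _ hX (B.compl hY)) using 1
  ext ω
  simp

lemma union {X Y : Set Ω} (hX : B.sets X) (hY : B.sets Y) : B.sets (X ∪ Y) := by
  convert B.imp _ _ (B.compl hX) hY using 1
  ext ω
  simp [or_iff_not_imp_left]

lemma const (p : Prop) : B.sets {_ω | p} := by
  by_cases hp : p
  · simpa [hp] using B.compl B.empty
  · simpa [hp] using B.empty

lemma biUnion {T : Type v} (t : Set T) (ht : t.Finite) {X : T → Set Ω} (hX : ∀ a ∈ t, B.sets (X a)) :
    B.sets {ω | ∃ a ∈ t, ω ∈ X a} := by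
  induction t, ht using Set.Finite.induction_on with
  | empty => simpa using B.empty
  | @insert a t _ _ ih =>
    convert B.union (hX a (Set.mem_insert _ _)) (ih fun b hb => hX b (Set.mem_insert_of_mem _ hb))
      using 1
    ext ω
    simp

/-- Functions with finitely many values, all of whose fibres belong to the algebra. -/
def Simple {Λ : Type v} (a : Ω → Λ) : Prop :=
  (Set.range a).Finite ∧ ∀ γ, B.sets {ω | a ω = γ}

variable {B} {Λ Λ' : Type*}

lemma Simple.const (γ : Λ) : B.Simple fun _ => γ :=
  ⟨(Set.finite_singleton γ).subset (by rintro _ ⟨_, rfl⟩; rfl), fun δ => B.const (γ = δ)⟩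

lemma Simple.rel {a : Ω → Λ} {b : Ω → Λ'} (ha : B.Simple a) (hb : B.Simple b)
    (r : Λ → Λ' → Prop) : B.sets {ω | r (a ω) (b ω)} := by
  convert B.biUnion _ (ha.1.prod hb.1) (X := fun p => {ω | r p.1 p.2} ∩ ({ω | a ω = p.1} ∩ {ω | b ω = p.2}))
    fun p _ => B.inter (B.const _) (B.inter (ha.2 p.1) (hb.2 p.2)) using 1
  ext ω
  constructor
  · exact fun h => ⟨(a ω, b ω), ⟨⟨ω, rfl⟩, ⟨ω, rfl⟩⟩, h, rfl, rfl⟩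
  · rintro ⟨p, -, h, h1, h2⟩
    rw [Set.mem_ofPred_eq] at h1 h2 ⊢
    rwa [h1, h2]

lemma Simple.map₂ {Λ'' : Type*} {a : Ω → Λ} {b : Ω → Λ'} (ha : B.Simple a) (hb : B.Simple b)
    (f : Λ → Λ' → Λ'') : B.Simple fun ω => f (a ω) (b ω) := by
  refine ⟨(ha.1.image2 f hb.1).subset ?_, fun γ => ha.rel hb fun x y => f x y = γ⟩
  rintro _ ⟨ω, rfl⟩
  exact ⟨_, ⟨ω, rfl⟩, _, ⟨ω, rfl⟩, rfl⟩

end SetAlgebra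

section ResidueFamily

variable {M : Model.{u}} {Ω : Type w} (𝓕 : Subring (Ω → M.k))

/-- Functions to the residue field act on functions to the valued field through the section. -/
noncomputable instance functionAlgebra : Algebra 𝓕 (Ω → M.K) :=
  RingHom.toAlgebra ((RingHom.pi fun ω => M.sec.comp (Pi.evalRingHom _ ω)).comp 𝓕.subtype)

/-- The combinations of constants from `S`, with coefficients in a ring of functions to the residue
field. -/
noncomputable def combinations (S : Submonoid M.K) : Subalgebra 𝓕 (Ω → M.K) :=
  Algebra.adjoin 𝓕 ((S.map (Pi.constMonoidHom Ω M.K) : Submonoid (Ω → M.K)) : Set (Ω → M.K))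

variable {𝓕} (B : SetAlgebra Ω) (hinv : ∀ p ∈ 𝓕, p⁻¹ ∈ 𝓕)
  (hB : ∀ p ∈ 𝓕, B.sets {ω | p ω = 0})
include hinv hB

/-- The leading coefficient argument, pointwise: the first coefficient that does not vanish at `ω`
decides the value. Only values from the list and `∞` occur, and the pieces are cut out by zero sets
of functions in `𝓕`. -/
lemma simple_val_of_mem_span (s : List M.K) (h1 : ∀ x ∈ s, M.val x ≠ ⊤)
    (h2 : s.Pairwise fun x y => M.val x < M.val y) :
    ∀ z ∈ Submodule.span 𝓕 {f : Ω → M.K | f ∈ s.map fun x _ => x},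
      B.Simple (fun ω => M.val (z ω)) ∧
        ∀ w ∈ Submodule.span 𝓕 {f : Ω → M.K | f ∈ s.map fun x _ => x},
          (fun ω => M.resDiv (z ω) (w ω)) ∈ 𝓕 := by
  induction s with
  | nil =>
    intro z hz
    have hz0 : z = 0 := by simpa using hz
    subst hz0
    simp only [Pi.zero_apply, M.val.map_zero, Model.resDiv_zero_left]
    exact ⟨.const _, fun _ _ => 𝓕.zero_mem⟩
  | cons x s ih =>
    rw [List.pairwise_cons] at h2
    have ih' := ih (fun y hy => h1 y (List.mem_cons_of_mem _ hy)) h2.2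
    have hx : M.val x < ⊤ := lt_top_iff_ne_top.2 (h1 x List.mem_cons_self)
    have hlt : ∀ z ∈ Submodule.span 𝓕 {f : Ω → M.K | f ∈ s.map fun x _ => x}, ∀ ω,
        M.val x < M.val (z ω) := fun z hz ω =>
      lt_of_mem_span (v := fun z : Ω → M.K => M.val (z ω)) (fun _ _ => M.val.map_sub _ _)
        (fun _ _ => M.val_le_val_sec_mul _ _) M.val.map_zero hx (by
          intro f hf
          obtain ⟨y, hy, rfl⟩ := List.mem_map.1 hf
          exact h2.1 y hy) hz
    intro z hz
    obtain ⟨p, z', hz', rfl⟩ := mem_span_cons_iff.1 hz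
    obtain ⟨hz1, hz2⟩ := ih' z' hz'
    have happ : ∀ (p : 𝓕) (z' : Ω → M.K) ω,
        (p • (fun _ => x) + z' : Ω → M.K) ω = M.sec (p.1 ω) * x + z' ω := fun _ _ _ => rfl
    simp only [happ]
    refine ⟨?_, fun w hw => ?_⟩
    · classical
      have hp : B.Simple fun ω => p.1 ω = 0 := by
        refine ⟨Set.toFinite _, fun q => ?_⟩
        by_cases hq : q
        · simpa [hq] using hB _ p.2
        · convert B.compl (hB _ p.2) using 1
          ext ω
          simp [hq]
      convert hp.map₂ hz1 fun (q : Prop) (γ : WithTop M.Γ) => if q then γ else M.val x using 2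
      rename_i ω
      split_ifs with h0
      · rw [h0, map_zero, zero_mul, zero_add]
      · exact M.val_sec_mul_add (hlt z' hz' ω) h0
    · obtain ⟨q, w', hw', rfl⟩ := mem_span_cons_iff.1 hw
      simp only [happ]
      have hr := hz2 w' hw'
      -- With `0⁻¹ = 0`, the function `1 - p * p⁻¹` is the indicator of the zero set of `p`. The
      -- residue is `p * q⁻¹`, plus the inductive residue where `p` and `q` both vanish.
      convert 𝓕.add_mem (𝓕.mul_mem p.2 (hinv _ q.2)) (𝓕.mul_mem (𝓕.mul_mem
        (𝓕.sub_mem 𝓕.one_mem (𝓕.mul_mem p.2 (hinv _ p.2)))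
        (𝓕.sub_mem 𝓕.one_mem (𝓕.mul_mem q.2 (hinv _ q.2)))) hr) using 1
      funext ω
      simp only [Pi.add_apply, Pi.mul_apply, Pi.sub_apply, Pi.one_apply, Pi.inv_apply]
      by_cases h0 : p.1 ω ≠ 0 ∨ q.1 ω ≠ 0
      · rw [M.resDiv_sec_mul_add (hlt z' hz' ω) (hlt w' hw' ω) h0]
        rcases h0 with h0 | h0 <;> simp [mul_inv_cancel₀ h0]
      · push Not at h0
        simp [h0.1, h0.2]

variable {S : Submonoid M.K}
  (hsep : ∀ t : Finset M.K, (∀ x ∈ t, x ∈ S) → ∃ s : List M.K, (∀ x ∈ s, M.val x ≠ ⊤) ∧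
    s.Pairwise (fun x y => M.val x < M.val y) ∧
    ∀ x ∈ t, (fun _ => x) ∈ Submodule.span 𝓕 {f : Ω → M.K | f ∈ s.map fun x _ => x})
include hsep

lemma simple_val_of_mem_combinations {z w : Ω → M.K} (hz : z ∈ combinations 𝓕 S)
    (hw : w ∈ combinations 𝓕 S) :
    B.Simple (fun ω => M.val (z ω)) ∧ (fun ω => M.resDiv (z ω) (w ω)) ∈ 𝓕 := by
  classical
  have hspan : Subalgebra.toSubmodule (combinations 𝓕 S) =
      Submodule.span 𝓕 ((fun (x : M.K) (_ : Ω) => x) '' S) := by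
    rw [combinations, Algebra.adjoin_eq_span, Submonoid.closure_eq]
    rfl
  rw [← Subalgebra.mem_toSubmodule, hspan] at hz hw
  obtain ⟨t, ht, hzt⟩ := Submodule.mem_span_finite_of_mem_span hz
  obtain ⟨t', ht', hwt⟩ := Submodule.mem_span_finite_of_mem_span hw
  obtain ⟨r, hr, hrt⟩ := Finset.subset_set_image_iff.1 ht
  obtain ⟨r', hr', hrt'⟩ := Finset.subset_set_image_iff.1 ht'
  obtain ⟨s, h1, h2, h3⟩ := hsep (r ∪ r') (by
    intro x hx
    rcases Finset.mem_union.1 hx with hx | hx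
    exacts [hr hx, hr' hx])
  have hle : ∀ r₀ ⊆ r ∪ r', Submodule.span 𝓕 (↑(r₀.image fun (x : M.K) (_ : Ω) => x) : Set (Ω → M.K)) ≤
      Submodule.span 𝓕 {f : Ω → M.K | f ∈ s.map fun x _ => x} := by
    intro r₀ hr₀
    rw [Submodule.span_le]
    intro f hf
    obtain ⟨x, hx, rfl⟩ := Finset.mem_image.1 (Finset.mem_coe.1 hf)
    exact h3 x (hr₀ hx)
  rw [← hrt] at hzt
  rw [← hrt'] at hwt
  have := simple_val_of_mem_span B hinv hB s h1 h2 z (hle r Finset.subset_union_left hzt)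
  exact ⟨this.1, this.2 w (hle r' Finset.subset_union_right hwt)⟩

omit hinv hB hsep in
lemma const_mem_combinations {x : M.K} (hx : x ∈ S) :
    (fun _ => x) ∈ combinations (Ω := Ω) 𝓕 S :=
  Algebra.subset_adjoin ⟨x, hx, rfl⟩

/-- The family of functions whose residues are in a given ring. -/
noncomputable def residueFamily : FunctionFamily M Ω where
  good s := match s with
    | .VF => fun a => a ∈ combinations 𝓕 S
    | .k => fun a => a ∈ 𝓕
    | .Γ => fun a => B.Simple a
  fn {l s} f a h := by
    cases f with
    | vfZero => exact (combinations 𝓕 S).zero_mem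
    | vfOne => exact (combinations 𝓕 S).one_mem
    | vfNeg => exact (combinations 𝓕 S).neg_mem (h 0)
    | vfAdd => exact (combinations 𝓕 S).add_mem (h 0) (h 1)
    | vfMul => exact (combinations 𝓕 S).mul_mem (h 0) (h 1)
    | kZero => exact 𝓕.zero_mem
    | kOne => exact 𝓕.one_mem
    | kNeg => exact 𝓕.neg_mem (h 0)
    | kAdd => exact 𝓕.add_mem (h 0) (h 1)
    | kMul => exact 𝓕.mul_mem (h 0) (h 1)
    | gZero => exact .const (0 : WithTop M.Γ)
    | gOne => exact .const (M.one : WithTop M.Γ)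
    | gNeg => exact (h 0).map₂ (.const ()) fun (a : WithTop M.Γ) _ => -a
    | gAdd => exact (h 0).map₂ (h 1) fun (a b : WithTop M.Γ) => a + b
    | val => exact (simple_val_of_mem_combinations B hinv hB hsep (h 0) (h 0)).1
    | resDiv => exact (simple_val_of_mem_combinations B hinv hB hsep (h 0) (h 1)).2
    | sec => exact (combinations 𝓕 S).algebraMap_mem ⟨a 0, h 0⟩
  sets := B.sets
  empty := B.empty
  imp := B.imp
  eq s a b ha hb := by
    cases s with
    | VF =>
      have h := (combinations 𝓕 S).sub_mem ha hb
      convert (simple_val_of_mem_combinations B hinv hB hsep h h).1.2 ⊤ using 1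
      ext ω
      exact (M.val_eq_top_iff.trans (@sub_eq_zero M.K _ (a ω) (b ω))).symm
    | k =>
      convert hB _ (𝓕.sub_mem ha hb) using 1
      ext ω
      exact (@sub_eq_zero M.k _ (a ω) (b ω)).symm
    | Γ => exact ha.rel hb fun x y => x = y
  lt a b ha hb := ha.rel hb fun x y : WithTop M.Γ => x < y

end ResidueFamily

/-- Constant functions can be separated if the ring of functions contains the constants. -/
lemma exists_separated_constants {M : Model.{u}} {Ω : Type w} {𝓕 : Subring (Ω → M.k)}
    (h : ∀ c, (fun _ => c) ∈ 𝓕) (t : Finset M.K) :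
    ∃ s : List M.K, (∀ x ∈ s, M.val x ≠ ⊤) ∧ s.Pairwise (fun x y => M.val x < M.val y) ∧
    ∀ x ∈ t, (fun _ => x) ∈ Submodule.span 𝓕 {f : Ω → M.K | f ∈ s.map fun x _ => x} := by
  let := M.sec.toAlgebra
  obtain ⟨s, h1, h2, -, h4⟩ := exists_separated_list (D := M.k) (v := M.val) (⊤ : Submodule M.k M.K)
    (fun x _ hx => M.val_eq_top_iff.1 hx)
    (fun x _ y _ hxy hy => ⟨M.resDiv x y,
      M.val_lt_sub_resDiv ((M.val.ne_top_iff).1 hy) hxy.ge⟩) t.card t le_rfl fun _ _ => trivial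
  refine ⟨s, fun x hx => (h1 x hx).2, h2, fun x hx => ?_⟩
  have hx' := h4 x hx
  clear hx
  induction hx' using Submodule.span_induction with
  | mem x hx => exact Submodule.subset_span (List.mem_map.2 ⟨x, hx, rfl⟩)
  | zero => exact Submodule.zero_mem _
  | add x y _ _ hx hy => exact Submodule.add_mem _ hx hy
  | smul c x _ hx => exact Submodule.smul_mem _ (⟨_, h c⟩ : 𝓕) hx

end TLoc

end

/-! ### Stable embeddedness and induced structure of the residue field -/

section

namespace TLoc

/-- The residue field is stably embedded. -/
theorem stablyEmbedded_resField (M : Model.{u}) : M.toStructure.StablyEmbedded .k M.resField := by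
  intro n X _ hX
  let A : Set M.toStructure.Elements := Sigma.mk Srt.k '' M.resField
  let Ω := Fin n → M.toStructure.carrier .k
  let τ : Fin n ⊕ A → Srt := Sum.elim (fun _ : Fin n => Srt.k) fun a : A => a.1.1
  let 𝓕 : Subring (Ω → M.k) :=
    { carrier := {a | ∃ t : MSTerm lang τ .k,
        ∀ ω, a ω = M.toStructure.value (M.toStructure.withParams A ω) t}
      mul_mem' := by
        rintro a b ⟨t, ht⟩ ⟨t', ht'⟩
        exact ⟨app₂ .kMul t t', fun ω => congrArg₂ (fun a b : M.k => a * b) (ht ω) (ht' ω)⟩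
      one_mem' := ⟨app₀ .kOne, fun ω => rfl⟩
      add_mem' := by
        rintro a b ⟨t, ht⟩ ⟨t', ht'⟩
        exact ⟨app₂ .kAdd t t', fun ω => congrArg₂ (fun a b : M.k => a + b) (ht ω) (ht' ω)⟩
      zero_mem' := ⟨app₀ .kZero, fun ω => rfl⟩
      neg_mem' := by
        rintro a ⟨t, ht⟩
        exact ⟨app₁ .kNeg t, fun ω => congrArg (fun a : M.k => -a) (ht ω)⟩ }
  have hconst : ∀ c : M.k, (fun _ => c) ∈ 𝓕 := fun c =>
    ⟨.var (Sum.inr (⟨⟨Srt.k, c⟩, ⟨_, trivial, rfl⟩⟩ : A)), fun ω => rfl⟩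
  let B : SetAlgebra Ω := ⟨fun X => M.toStructure.DefinablePower A .k X, .falsum,
    fun _ _ h h' => h.imp h'⟩
  let F : FunctionFamily M Ω := residueFamily (S := ⊤) B
    (by
      rintro a ⟨t, ht⟩
      -- Inversion of residues is a term of the language: the residue of `1` divided by a section.
      refine ⟨app₂ .resDiv (app₀ .vfOne) (app₁ .sec t), fun ω => ?_⟩
      change (a ω)⁻¹ = M.resDiv 1 (M.sec (valuek (M.toStructure.withParams A ω) t))
      rw [← map_one M.sec, M.resDiv_sec, one_mul, ht ω]
      rfl)
    (by
      rintro a ⟨t, ht⟩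
      exact ⟨.equal t (app₀ .kZero), fun ω =>
        iff_of_eq (congrArg (fun c : M.k => c = 0) (ht ω))⟩)
    fun t _ => exists_separated_constants hconst t
  obtain ⟨κ, f, ψ, hψ, h⟩ := exists_isQuantifierFree_of_definable hX
  have key := F.sets_sat (e := fun ω k => M.toStructure.withParams Set.univ ω (f k)) (by
    intro k
    rcases f k with i | ⟨⟨s, a⟩, ha⟩
    · exact ⟨.var (Sum.inl i), fun ω => rfl⟩
    · cases s with
      | VF => exact const_mem_combinations (S := ⊤) (x := (a : M.K)) trivial
      | k => exact hconst a
      | Γ => exact .const a) ψ hψ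
  exact MSStructure.Definable.congr key h

section PiecewiseFractions

variable {Ω : Type w} {F : Type v} [Field F] (B : SetAlgebra Ω) (T : Subring (Ω → F))

/-- Functions that are piecewise quotients of functions in a given ring. -/
def IsPiecewiseFraction (a : Ω → F) : Prop :=
  ∃ (I : Type) (_ : Finite I) (D : I → Set Ω) (p q : I → Ω → F), (∀ i, B.sets (D i)) ∧
    (∀ ω, ∃ i, ω ∈ D i) ∧ (∀ i, p i ∈ T) ∧ (∀ i, q i ∈ T) ∧
    ∀ i, ∀ ω ∈ D i, q i ω ≠ 0 ∧ a ω = p i ω / q i ω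

variable {B T}

lemma isPiecewiseFraction_of_mem {a : Ω → F} (ha : a ∈ T) : IsPiecewiseFraction B T a := by
  refine ⟨Unit, inferInstance, fun _ => Set.univ, fun _ => a, fun _ => 1, fun _ => ?_,
    fun ω => ⟨(), trivial⟩, fun _ => ha, fun _ => T.one_mem, fun _ ω _ => ⟨one_ne_zero, ?_⟩⟩
  · simpa using B.compl B.empty
  · simp

lemma IsPiecewiseFraction.map₂ {a b : Ω → F} (ha : IsPiecewiseFraction B T a)
    (hb : IsPiecewiseFraction B T b) (f : F → F → F) (g h : (Ω → F) → (Ω → F) → (Ω → F) → (Ω → F) → Ω → F)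
    (hg : ∀ p ∈ T, ∀ q ∈ T, ∀ p' ∈ T, ∀ q' ∈ T, g p q p' q' ∈ T ∧ h p q p' q' ∈ T)
    (hf : ∀ p q p' q' ω, q ω ≠ 0 → q' ω ≠ 0 → h p q p' q' ω ≠ 0 ∧
      f (p ω / q ω) (p' ω / q' ω) = g p q p' q' ω / h p q p' q' ω) :
    IsPiecewiseFraction B T fun ω => f (a ω) (b ω) := by
  obtain ⟨I, _, D, p, q, h1, h2, h3, h4, h5⟩ := ha
  obtain ⟨I', _, D', p', q', h1', h2', h3', h4', h5'⟩ := hb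
  refine ⟨I × I', inferInstance, fun i => D i.1 ∩ D' i.2,
    fun i => g (p i.1) (q i.1) (p' i.2) (q' i.2), fun i => h (p i.1) (q i.1) (p' i.2) (q' i.2),
    fun i => B.inter (h1 _) (h1' _), fun ω => ?_,
    fun i => (hg _ (h3 _) _ (h4 _) _ (h3' _) _ (h4' _)).1,
    fun i => (hg _ (h3 _) _ (h4 _) _ (h3' _) _ (h4' _)).2, fun i ω hω => ?_⟩
  · obtain ⟨i, hi⟩ := h2 ω
    obtain ⟨i', hi'⟩ := h2' ω
    exact ⟨(i, i'), hi, hi'⟩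
  · obtain ⟨hq, ha⟩ := h5 _ ω hω.1
    obtain ⟨hq', hb⟩ := h5' _ ω hω.2
    have := hf (p i.1) (q i.1) (p' i.2) (q' i.2) ω hq hq'
    exact ⟨this.1, (congrArg₂ f ha hb).trans this.2⟩

variable (hB : ∀ p ∈ T, B.sets {ω | p ω = 0})
include hB

lemma IsPiecewiseFraction.sets {a : Ω → F} (ha : IsPiecewiseFraction B T a) :
    B.sets {ω | a ω = 0} := by
  obtain ⟨I, _, D, p, q, h1, h2, h3, h4, h5⟩ := ha
  convert B.biUnion (Set.univ : Set I) Set.finite_univ (X := fun i => D i ∩ {ω | p i ω = 0})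
    fun i _ => B.inter (h1 i) (hB _ (h3 i)) using 1
  ext ω
  constructor
  · intro h0
    obtain ⟨i, hi⟩ := h2 ω
    obtain ⟨hq, ha⟩ := h5 i ω hi
    rw [Set.mem_ofPred_eq, ha, div_eq_zero_iff] at h0
    exact ⟨i, trivial, hi, h0.resolve_right hq⟩
  · rintro ⟨i, -, hi, h0⟩
    rw [Set.mem_ofPred_eq] at h0
    rw [Set.mem_ofPred_eq, (h5 i ω hi).2, h0, zero_div]

/-- Each piece is divided according to whether the numerator vanishes; where it does, the inverse is
`0 = 0 / 1`, elsewhere the fraction is turned over. -/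
lemma IsPiecewiseFraction.inv {a : Ω → F} (ha : IsPiecewiseFraction B T a) :
    IsPiecewiseFraction B T a⁻¹ := by
  obtain ⟨I, _, D, p, q, h1, h2, h3, h4, h5⟩ := ha
  refine ⟨I × Bool, inferInstance,
    fun i => if i.2 then D i.1 ∩ {ω | p i.1 ω = 0} else D i.1 ∩ {ω | p i.1 ω = 0}ᶜ,
    fun i => if i.2 then 0 else q i.1, fun i => if i.2 then 1 else p i.1, ?_, ?_, ?_, ?_, ?_⟩
  · rintro ⟨i, _ | _⟩
    exacts [B.inter (h1 i) (B.compl (hB _ (h3 i))), B.inter (h1 i) (hB _ (h3 i))]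
  · intro ω
    obtain ⟨i, hi⟩ := h2 ω
    by_cases h0 : p i ω = 0
    exacts [⟨(i, true), hi, h0⟩, ⟨(i, false), hi, h0⟩]
  · rintro ⟨i, _ | _⟩
    exacts [h4 i, T.zero_mem]
  · rintro ⟨i, _ | _⟩
    exacts [h3 i, T.one_mem]
  · rintro ⟨i, _ | _⟩ ω ⟨hi, h0⟩
    · refine ⟨h0, ?_⟩
      rw [Pi.inv_apply, (h5 i ω hi).2, inv_div]
      rfl
    · rw [Set.mem_ofPred_eq] at h0
      simp [(h5 i ω hi).2, h0]

omit hB in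
/-- The ring of piecewise quotients. -/
def piecewiseFractions (B : SetAlgebra Ω) (T : Subring (Ω → F)) : Subring (Ω → F) where
  carrier := {a | IsPiecewiseFraction B T a}
  mul_mem' ha hb := ha.map₂ hb (fun x y => x * y) (fun p _ p' _ => p * p') (fun _ q _ q' => q * q')
    (fun _ hp _ hq _ hp' _ hq' => ⟨T.mul_mem hp hp', T.mul_mem hq hq'⟩)
    fun _ _ _ _ _ h h' => ⟨mul_ne_zero h h', div_mul_div_comm _ _ _ _⟩
  one_mem' := isPiecewiseFraction_of_mem T.one_mem
  add_mem' ha hb := ha.map₂ hb (fun x y => x + y) (fun p q p' q' => p * q' + q * p')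
    (fun _ q _ q' => q * q')
    (fun _ hp _ hq _ hp' _ hq' =>
      ⟨T.add_mem (T.mul_mem hp hq') (T.mul_mem hq hp'), T.mul_mem hq hq'⟩)
    fun _ _ _ _ _ h h' => ⟨mul_ne_zero h h', div_add_div _ _ h h'⟩
  zero_mem' := isPiecewiseFraction_of_mem T.zero_mem
  neg_mem' ha := ha.map₂ ha (fun x _ => -x) (fun p _ _ _ => -p) (fun _ q _ _ => q)
    (fun _ hp _ hq _ _ _ _ => ⟨T.neg_mem hp, hq⟩)
    fun _ _ _ _ _ h _ => ⟨h, (neg_div _ _).symm⟩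

end PiecewiseFractions

section PureField

open FirstOrder

/-- The structure induced on the residue field is that of a pure field. -/
theorem resFieldInducedPure (M : Model.{u}) : M.ResFieldInducedPure := by
  intro n X
  let := FirstOrder.Ring.compatibleRingOfRing M.k
  change _ ↔ (∅ : Set M.k).Definable FirstOrder.Language.ring X
  constructor
  · intro hX
    let Ω := Fin n → M.k
    let B : SetAlgebra Ω := ⟨fun X => (∅ : Set M.k).Definable FirstOrder.Language.ring X,
      Set.definable_empty, fun X Y hX hY => by
        have : {ω | ω ∈ X → ω ∈ Y} = Xᶜ ∪ Y := by
          ext ω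
          exact imp_iff_not_or
        rw [this]
        exact hX.compl.union hY⟩
    let T : Subring (Ω → M.k) :=
      { carrier := {a | ∃ t : FirstOrder.Language.ring.Term (Fin n), ∀ ω, a ω = t.realize ω}
        mul_mem' := by
          rintro a b ⟨t, ht⟩ ⟨t', ht'⟩
          exact ⟨t * t', fun ω => by simp [ht, ht']⟩
        one_mem' := ⟨1, fun ω => by simp⟩
        add_mem' := by
          rintro a b ⟨t, ht⟩ ⟨t', ht'⟩
          exact ⟨t + t', fun ω => by simp [ht, ht']⟩
        zero_mem' := ⟨0, fun ω => by simp⟩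
        neg_mem' := by
          rintro a ⟨t, ht⟩
          exact ⟨-t, fun ω => by simp [ht]⟩ }
    have hT : ∀ p ∈ T, B.sets {ω | p ω = 0} := by
      rintro p ⟨t, ht⟩
      refine Set.empty_definable_iff.2 ⟨t.equal 0, ?_⟩
      ext ω
      refine Iff.trans ?_ FirstOrder.Language.Formula.realize_equal.symm
      simp [ht]
    -- The language of rings has no inverse, so polynomials are replaced by definable piecewise
    -- quotients. Without parameters the only constant needed in the field is `1`, which is
    -- trivially separated.
    let F : FunctionFamily M Ω := residueFamily (𝓕 := piecewiseFractions B T) (S := ⊥) B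
      (fun _ ha => IsPiecewiseFraction.inv hT ha) (fun _ ha => IsPiecewiseFraction.sets hT ha)
      fun t ht => ⟨[1], by simp, List.pairwise_singleton _ _, fun x hx =>
        Submodule.subset_span (by rw [Submonoid.mem_bot.1 (ht x hx)]; simp)⟩
    obtain ⟨κ, f, ψ, hψ, h⟩ := exists_isQuantifierFree_of_definable hX
    have key := F.sets_sat (e := fun ω k => M.toStructure.withParams ∅
      (σ := fun _ : Fin n => Srt.k) ω (f k)) (by
      intro k
      rcases f k with i | ⟨_, ha⟩
      · exact isPiecewiseFraction_of_mem ⟨.var i, fun ω => rfl⟩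
      · exact ha.elim) ψ hψ
    have hset : X = {ω : Ω | M.toStructure.Sat ψ fun k => M.toStructure.withParams ∅
      (σ := fun _ : Fin n => Srt.k) ω (f k)} := Set.ext h
    rw [hset]
    exact key
  · intro hX
    have := definable_image_of_definable (M := M.toStructure) (L := FirstOrder.Language.ring)
      (s := Srt.k) (j := fun c : M.k => c) Function.injective_id ?_ ?_ ?_ hX
    · exact MSStructure.Definable.congr this fun x => (Set.ext_iff.1 (Set.image_id X) x).symm
    · exact MSStructure.Definable.falsum.compl.congr fun z => iff_of_true ⟨_, rfl⟩ id
    · intro n f ι σ t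
      cases f with
      | zero => exact ⟨app₀ .kZero, fun e x h => rfl⟩
      | one => exact ⟨app₀ .kOne, fun e x h => rfl⟩
      | neg => exact ⟨app₁ .kNeg (t 0), fun e x h => congrArg (fun a : M.k => -a) (h 0)⟩
      | add => exact ⟨app₂ .kAdd (t 0) (t 1), fun e x h =>
          congrArg₂ (fun a b : M.k => a + b) (h 0) (h 1)⟩
      | mul => exact ⟨app₂ .kMul (t 0) (t 1), fun e x h =>
          congrArg₂ (fun a b : M.k => a * b) (h 0) (h 1)⟩
    · intro n R
      exact R.elim

end PureField

end TLoc

end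

/-! ### Strong orthogonality -/

section

namespace TLoc

variable {M : Model.{u}} {A : Set M.toStructure.Elements} {m : ℕ}

/-- The Boolean algebra of definable sets of tuples of residues. -/
noncomputable def definableAlgebra (M : Model.{u}) (A : Set M.toStructure.Elements) (m : ℕ) :
    SetAlgebra (Fin m → M.k) where
  sets X := M.toStructure.DefinablePower A .k X
  empty := .falsum
  imp _ _ h h' := h.imp h'

/-- The sorts of the variables for `m` residues and of the parameters from `A`. -/
abbrev residueSorts (A : Set M.toStructure.Elements) (m : ℕ) : Fin m ⊕ A → Srt :=
  Sum.elim (fun _ : Fin m => Srt.k) fun a : A => a.1.1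

/-- The assignment given by a tuple of residues and the parameters. -/
noncomputable def residueAssign (A : Set M.toStructure.Elements) (x : Fin m → M.k) :
    ∀ i, M.toStructure.carrier (residueSorts A m i) :=
  M.toStructure.withParams A (σ := fun _ : Fin m => Srt.k) x

/-- Only finiteness is wanted, so the ring of all residue functions and the algebra of all subsets
may be used. -/
lemma finite_range_val (t : MSTerm lang (residueSorts A m) .VF) :
    (Set.range fun x : Fin m → M.k => M.val (valueVF (residueAssign A x) t)).Finite := by
  let B : SetAlgebra (Fin m → M.k) := ⟨fun _ => True, trivial, fun _ _ _ _ => trivial⟩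
  let F : FunctionFamily M (Fin m → M.k) := residueFamily (𝓕 := ⊤) (S := ⊤) B
    (fun _ _ => trivial) (fun _ _ => trivial)
    fun t _ => exists_separated_constants (𝓕 := (⊤ : Subring ((Fin m → M.k) → M.k)))
      (fun _ => trivial) t
  have := F.good_value (e := fun x i => residueAssign A x i) (by
    rintro (i | ⟨⟨s, a⟩, ha⟩)
    · trivial
    · cases s with
      | VF => exact const_mem_combinations (S := ⊤) (x := (a : M.K)) trivial
      | k => trivial
      | Γ => exact .const a) (app₁ .val t)
  exact this.1

lemma definable_val_lt (t : MSTerm lang (residueSorts A m) .VF) :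
    M.toStructure.Definable A (σ := Sum.elim (fun _ : Fin m => Srt.k) fun _ : Fin m => Srt.k)
      {w | M.val (valueVF (residueAssign A fun i => w (Sum.inl i)) t) <
        M.val (valueVF (residueAssign A fun i => w (Sum.inr i)) t)} := by
  let τ : (Fin m ⊕ Fin m) ⊕ A → Srt :=
    Sum.elim (Sum.elim (fun _ : Fin m => Srt.k) fun _ : Fin m => Srt.k) fun a : A => a.1.1
  have h : ∀ j : Fin m → Fin m ⊕ Fin m, (∀ i, (Sum.elim (fun _ => Srt.k) fun _ => Srt.k) (j i) = Srt.k) →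
      ∀ i, residueSorts A m i = τ (Sum.map j id i) := by
    rintro j hj (i | a)
    exacts [(hj i).symm, rfl]
  refine ⟨ltFormula (app₁ .val (t.rename (Sum.map Sum.inl id) (h _ fun _ => rfl)))
    (app₁ .val (t.rename (Sum.map Sum.inr id) (h _ fun _ => rfl))), fun w => ?_⟩
  have e1 := M.toStructure.value_rename (Sum.map Sum.inl id) (h _ fun _ => rfl)
    (M.toStructure.withParams A w) (residueAssign A fun i => w (Sum.inl i))
    (by rintro (i | a) <;> exact HEq.rfl) t
  have e2 := M.toStructure.value_rename (Sum.map Sum.inr id) (h _ fun _ => rfl)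
    (M.toStructure.withParams A w) (residueAssign A fun i => w (Sum.inr i))
    (by rintro (i | a) <;> exact HEq.rfl) t
  exact iff_of_eq (congrArg₂ (fun a b : M.K => M.val a < M.val b) e1.symm e2.symm)

/-- A value `γ` attained by the term need not be named by a term over `A`. But the values form a
finite ordered set, and comparing the term at two tuples is definable over `A`. So the fibres are
found from the smallest value upwards: the next one consists of the tuples with minimal value
outside the fibres already found. -/
lemma simple_val (t : MSTerm lang (residueSorts A m) .VF) :
    (definableAlgebra M A m).Simple fun x => M.val (valueVF (residueAssign A x) t) := by
  set h : (Fin m → M.k) → WithTop M.Γ := fun x => M.val (valueVF (residueAssign A x) t) with hh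
  have hfin : (Set.range h).Finite := finite_range_val t
  refine ⟨hfin, fun γ => ?_⟩
  by_cases hγ : γ ∈ Set.range h
  swap
  · convert (definableAlgebra M A m).empty using 1
    ext x
    exact iff_of_false (fun hx => hγ ⟨x, hx⟩) id
  have hwf : (Set.range h).WellFoundedOn (· < ·) := hfin.wellFoundedOn
  refine hwf.induction (P := fun γ => (definableAlgebra M A m).sets {x | h x = γ}) hγ ?_
  intro γ hγ ih
  have hL : (definableAlgebra M A m).sets {x | h x < γ} := by
    convert (definableAlgebra M A m).biUnion {δ ∈ Set.range h | δ < γ} (hfin.subset fun _ h => h.1)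
      (X := fun δ => {x | h x = δ}) (fun δ hδ => ih δ hδ.1 hδ.2) using 1
    ext x
    constructor
    · exact fun hx => ⟨h x, ⟨⟨x, rfl⟩, hx⟩, rfl⟩
    · rintro ⟨δ, ⟨-, hδ⟩, hx⟩
      rw [Set.mem_ofPred_eq] at hx ⊢
      rwa [hx]
  have hZ : M.toStructure.Definable A
      (σ := Sum.elim (fun _ : Fin m => Srt.k) fun _ : Fin m => Srt.k)
      {w | ¬ h (fun i => w (Sum.inl i)) < γ →
        ¬ h (fun i => w (Sum.inl i)) < h fun i => w (Sum.inr i)} := by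
    suffices hL' : M.toStructure.Definable A
        (σ := Sum.elim (fun _ : Fin m => Srt.k) fun _ : Fin m => Srt.k)
        {w | h (fun i => w (Sum.inl i)) < γ} from
      (hL'.compl.imp (definable_val_lt t).compl).congr fun w => Iff.rfl
    refine MSStructure.Definable.reindex hL Sum.inl (fun _ => rfl) fun x z hz => ?_
    have : z = fun i => x (Sum.inl i) := funext fun i => eq_of_heq (hz i)
    rw [this]
    rfl
  -- A tuple attaining `γ` ensures that the minimum outside the set where `h < γ` is `γ` and no
  -- larger value.
  obtain ⟨x₀, hx₀⟩ := hγ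
  refine ((MSStructure.Definable.compl hL).inter hZ.allFin).congr fun x => ?_
  constructor
  · intro hx
    have hx' : h x = γ := hx
    refine ⟨?_, fun y hy => ?_⟩
    · exact fun hlt => absurd hx' (ne_of_lt hlt)
    · change ¬ h y < h x
      rw [hx']
      exact hy
  · rintro ⟨h1, h2⟩
    have h1' : ¬ h x < γ := h1
    have h2' : ¬ h x₀ < γ → ¬ h x₀ < h x := h2 x₀
    rw [hx₀] at h2'
    exact le_antisymm (not_lt.1 (h2' (lt_irrefl _))) (not_lt.1 h1')

variable {n : ℕ}

/-- Functions of residues and values that depend on the residues only through a definable partition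
into finitely many sets. -/
def FinitelyDependent {Λ : Type v} (A : Set M.toStructure.Elements)
    (g : (Fin m → M.k) × (Fin n → WithTop M.Γ) → Λ) : Prop :=
  ∃ (T : Type u) (c : (Fin m → M.k) → T), (definableAlgebra M A m).Simple c ∧
    ∀ x x' γ, c x = c x' → g (x, γ) = g (x', γ)

lemma FinitelyDependent.map₂ {Λ Λ' Λ'' : Type*}
    {a : (Fin m → M.k) × (Fin n → WithTop M.Γ) → Λ}
    {b : (Fin m → M.k) × (Fin n → WithTop M.Γ) → Λ'} (ha : FinitelyDependent A a)
    (hb : FinitelyDependent A b) (f : Λ → Λ' → Λ'') :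
    FinitelyDependent A fun ω => f (a ω) (b ω) := by
  obtain ⟨T, c, hc, h⟩ := ha
  obtain ⟨T', c', hc', h'⟩ := hb
  refine ⟨T × T', _, hc.map₂ hc' Prod.mk, fun x x' γ hx => ?_⟩
  rw [Prod.mk.injEq] at hx
  exact congrArg₂ f (h _ _ _ hx.1) (h' _ _ _ hx.2)

lemma FinitelyDependent.const {Λ : Type*} (a : (Fin n → WithTop M.Γ) → Λ) :
    FinitelyDependent (M := M) (m := m) A fun ω => a ω.2 :=
  ⟨PUnit, fun _ => PUnit.unit, .const _, fun _ _ _ _ => rfl⟩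

lemma FinitelyDependent.of_definable {X : Set (Fin m → M.k)}
    (hX : M.toStructure.DefinablePower A .k X) :
    FinitelyDependent (n := n) A fun ω => ω.1 ∈ X := by
  refine ⟨ULift Prop, fun x => ⟨x ∈ X⟩, ⟨Set.toFinite _, fun p => ?_⟩, fun x x' _ h =>
    congrArg ULift.down h⟩
  by_cases hp : p.down
  · exact MSStructure.Definable.congr hX fun x =>
      ⟨fun h => (congrArg ULift.down h).mpr hp,
        fun h => ULift.ext _ _ (propext (iff_of_true h hp))⟩
  · exact MSStructure.Definable.congr (MSStructure.Definable.compl hX) fun x =>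
      ⟨fun h hx => hp ((congrArg ULift.down h).mp hx),
        fun h => ULift.ext _ _ (propext (iff_of_false h hp))⟩

/-- The functions of residues and values given by terms with parameters in `A`. -/
noncomputable def orthogonalFamily (M : Model.{u}) (A : Set M.toStructure.Elements) (m n : ℕ) :
    FunctionFamily M ((Fin m → M.k) × (Fin n → WithTop M.Γ)) where
  -- No symbol leads from the sort `Γ` to the other sorts, so field and residue terms depend on the
  -- residues alone.
  good s := match s with
    | .VF => fun a => ∃ t : MSTerm lang (residueSorts A m) .VF,
        ∀ ω, a ω = valueVF (residueAssign A ω.1) t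
    | .k => fun a => ∃ t : MSTerm lang (residueSorts A m) .k,
        ∀ ω, a ω = valuek (residueAssign A ω.1) t
    | .Γ => fun a => FinitelyDependent A a
  fn {l s} f a h := by
    cases f with
    | vfZero => exact ⟨app₀ .vfZero, fun ω => rfl⟩
    | vfOne => exact ⟨app₀ .vfOne, fun ω => rfl⟩
    | vfNeg =>
      obtain ⟨t, ht⟩ := h 0
      exact ⟨app₁ .vfNeg t, fun ω => congrArg (fun a : M.K => -a) (ht ω)⟩
    | vfAdd =>
      obtain ⟨t, ht⟩ := h 0
      obtain ⟨t', ht'⟩ := h 1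
      exact ⟨app₂ .vfAdd t t', fun ω => congrArg₂ (fun a b : M.K => a + b) (ht ω) (ht' ω)⟩
    | vfMul =>
      obtain ⟨t, ht⟩ := h 0
      obtain ⟨t', ht'⟩ := h 1
      exact ⟨app₂ .vfMul t t', fun ω => congrArg₂ (fun a b : M.K => a * b) (ht ω) (ht' ω)⟩
    | kZero => exact ⟨app₀ .kZero, fun ω => rfl⟩
    | kOne => exact ⟨app₀ .kOne, fun ω => rfl⟩
    | kNeg =>
      obtain ⟨t, ht⟩ := h 0
      exact ⟨app₁ .kNeg t, fun ω => congrArg (fun a : M.k => -a) (ht ω)⟩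
    | kAdd =>
      obtain ⟨t, ht⟩ := h 0
      obtain ⟨t', ht'⟩ := h 1
      exact ⟨app₂ .kAdd t t', fun ω => congrArg₂ (fun a b : M.k => a + b) (ht ω) (ht' ω)⟩
    | kMul =>
      obtain ⟨t, ht⟩ := h 0
      obtain ⟨t', ht'⟩ := h 1
      exact ⟨app₂ .kMul t t', fun ω => congrArg₂ (fun a b : M.k => a * b) (ht ω) (ht' ω)⟩
    | gZero => exact .const fun _ => (0 : WithTop M.Γ)
    | gOne => exact .const fun _ => (M.one : WithTop M.Γ)
    | gNeg => exact (h 0).map₂ (.const fun _ => ()) fun (a : WithTop M.Γ) _ => -a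
    | gAdd => exact (h 0).map₂ (h 1) fun (a b : WithTop M.Γ) => a + b
    | val =>
      obtain ⟨t, ht⟩ := h 0
      exact ⟨WithTop M.Γ, _, simple_val t, fun x x' γ hx =>
        (congrArg M.val (ht (x, γ))).trans (hx.trans (congrArg M.val (ht (x', γ))).symm)⟩
    | resDiv =>
      obtain ⟨t, ht⟩ := h 0
      obtain ⟨t', ht'⟩ := h 1
      exact ⟨app₂ .resDiv t t', fun ω => congrArg₂ M.resDiv (ht ω) (ht' ω)⟩
    | sec =>
      obtain ⟨t, ht⟩ := h 0
      exact ⟨app₁ .sec t, fun ω => congrArg M.sec (ht ω)⟩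
  sets X := FinitelyDependent A fun ω => ω ∈ X
  empty := .const fun _ => False
  imp _ _ hX hY := hX.map₂ hY fun p q => p → q
  eq s a b ha hb := by
    cases s with
    | VF =>
      obtain ⟨t, ht⟩ := ha
      obtain ⟨t', ht'⟩ := hb
      have := FinitelyDependent.of_definable (M := M) (A := A) (m := m) (n := n)
        (X := {x | valueVF (residueAssign A x) t = valueVF (residueAssign A x) t'})
        ⟨.equal t t', fun _ => Iff.rfl⟩
      convert this using 2 with ω
      exact iff_of_eq (congrArg₂ (fun a b : M.K => a = b) (ht ω) (ht' ω))
    | k =>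
      obtain ⟨t, ht⟩ := ha
      obtain ⟨t', ht'⟩ := hb
      have := FinitelyDependent.of_definable (M := M) (A := A) (m := m) (n := n)
        (X := {x | valuek (residueAssign A x) t = valuek (residueAssign A x) t'})
        ⟨.equal t t', fun _ => Iff.rfl⟩
      convert this using 2 with ω
      exact iff_of_eq (congrArg₂ (fun a b : M.k => a = b) (ht ω) (ht' ω))
    | Γ => exact ha.map₂ hb fun x y => x = y
  lt a b ha hb := ha.map₂ hb fun x y : WithTop M.Γ => x < y

/-- The residue field and the value group are strongly orthogonal. -/
theorem stronglyOrthogonal (M : Model.{u}) :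
    M.toStructure.StronglyOrthogonal .k .Γ M.resField M.valueGroup := by
  intro A m n X _ hX
  obtain ⟨κ, f, ψ, hψ, h⟩ := exists_isQuantifierFree_of_definable hX
  have key := (orthogonalFamily M A m n).sets_sat
    (e := fun ω k => M.toStructure.withParams A
      (M.toStructure.sumAssign (σ := fun _ : Fin m => Srt.k) (τ := fun _ : Fin n => Srt.Γ) ω.1 ω.2)
      (f k)) (by
    intro k
    rcases f k with (i | i) | ⟨⟨s, a⟩, ha⟩
    · exact ⟨.var (Sum.inl i), fun ω => rfl⟩
    · exact .const fun γ => γ i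
    · cases s with
      | VF => exact ⟨.var (Sum.inr (⟨⟨.VF, a⟩, ha⟩ : A)), fun ω => rfl⟩
      | k => exact ⟨.var (Sum.inr (⟨⟨.k, a⟩, ha⟩ : A)), fun ω => rfl⟩
      | Γ => exact .const fun _ => (a : WithTop M.Γ)) ψ hψ
  obtain ⟨T, c, hc, hdep⟩ := key
  have hdep' : ∀ x x' γ, c x = c x' → ((x, γ) ∈ X ↔ (x', γ) ∈ X) := by
    intro x x' γ hx
    exact (h (M.toStructure.sumAssign (σ := fun _ : Fin m => Srt.k)
      (τ := fun _ : Fin n => Srt.Γ) x γ)).trans ((iff_of_eq (hdep x x' γ hx)).trans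
      (h (M.toStructure.sumAssign (σ := fun _ : Fin m => Srt.k)
        (τ := fun _ : Fin n => Srt.Γ) x' γ)).symm)
  have := hc.1.to_subtype
  obtain ⟨N, ⟨e⟩⟩ := Finite.exists_equiv_fin (Set.range c)
  have hP : ∀ r : Fin N, M.toStructure.DefinablePower A .k {x : Fin m → M.k | c x = e.symm r} :=
    fun r => hc.2 _
  -- Over each class of the partition the fibre of `X` is constant, so it equals the projection of
  -- the part of `X` above the class, and this projection is definable over the same parameters.
  refine ⟨N, fun r => {x | c x = e.symm r}, fun r => {γ | ∃ x, c x = e.symm r ∧ (x, γ) ∈ X}, hP,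
    fun r => ?_, ?_⟩
  · have hZ : M.toStructure.Definable A
        (σ := Sum.elim (fun _ : Fin m => Srt.k) fun _ : Fin n => Srt.Γ)
        ({w | c (fun i => w (Sum.inl i)) = e.symm r} ∩
          {w | ((fun i => w (Sum.inl i)), (fun j => w (Sum.inr j))) ∈ X}) := by
      refine MSStructure.Definable.inter ?_ hX
      refine MSStructure.Definable.reindex (hP r) Sum.inl (fun _ => rfl) fun x z hz => ?_
      have : z = fun i => x (Sum.inl i) := funext fun i => eq_of_heq (hz i)
      rw [this]
      rfl
    exact hZ.existsFin
  · ext ⟨x, γ⟩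
    simp only [Set.mem_iUnion, Set.mem_prod, Set.mem_ofPred_eq]
    constructor
    · intro hx
      exact ⟨e ⟨c x, x, rfl⟩, by simp, x, by simp, hx⟩
    · rintro ⟨r, h1, x', h2, h3⟩
      exact (hdep' x x' γ (h1.trans h2.symm)).2 h3

end TLoc

end

/-- Quantifier elimination for the theory `T_loc` of algebraically closed valued fields with a
section of the residue map and a distinguished positive element of the value group; the residue
field and the value group are stably embedded and strongly orthogonal, and their induced structure
is that of a pure field and of a pure ordered group with the distinguished element. -/
theorem mainTheorem7 :
    TLoc.HasQuantifierElimination.{u} ∧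
    ∀ M : TLoc.Model.{u},
      M.toStructure.StablyEmbedded TLoc.Srt.k M.resField ∧
      M.toStructure.StablyEmbedded TLoc.Srt.Γ M.valueGroup ∧
      M.toStructure.StronglyOrthogonal TLoc.Srt.k TLoc.Srt.Γ M.resField M.valueGroup ∧
      M.ResFieldInducedPure ∧
      M.ValueGroupInducedPure := by
  exact ⟨TLoc.hasQuantifierElimination, fun M => ⟨TLoc.stablyEmbedded_resField M,
    TLoc.stablyEmbedded_valueGroup M, TLoc.stronglyOrthogonal M, TLoc.resFieldInducedPure M,
    TLoc.valueGroupInducedPure M⟩⟩
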